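/- **Theorem (complexity of the MAID Jacobian).** A multi-agent influence diagram (MAID) $G$ consists of a finite set $N$ of agents, a directed acyclic graph on chance variables, decision variables (each owned by an agent) and utility variables (each owned by an agent, without children), a finite domain for each chance and decision variable, a conditional distribution $P(X\mid \mathrm{Pa}_X)$ for each chance variable $X$, and for each utility variable $U$ a real function of the values of its parents, whose finite set of values is the domain of $U$. Assume that every chance and decision variable has at least two values, that every agent owns at least one decision variable, and that $G$ has perfect recall: of any two decision variables of the same agent, one (the earlier) and all of its parents are parents of the other. *Deviation function.* The leaves $z\in Z$ are the joint assignments to all chance and decision variables. The payoff $G_n(z)$ is the sum of the utilities of agent $n$ at $z$. A terminal sequence $h$ of agent $n$ is the history $H_n(z)$ of $n$ at a leaf $z$, that is, a joint assignment to the decision variables of $n$ and their parents. A profile of realization plans $\sigma$ assigns to each terminal sequence $h$ of each agent $n$ the product $\sigma_h$ of the probabilities that the decision rules of $n$ give to the actions of $n$ along $h$; write $\sigma_n(z)=\sigma_{H_n(z)}$, and let $\sigma_0(z)$ be the product of the chance probabilities at $z$. For a terminal sequence $h$ of agent $n$ put $$V^G_h(\sigma)=\sum_{z:\,H_n(z)=h}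 G_n(z)\,\sigma_0(z)\prod_{k\in N\setminus\{n\}}\sigma_k(z),$$ and let $\nabla V^G(\sigma)=\bigl(\partial V^G_h/\partial\sigma_{h'}(\sigma)\bigr)_{h,h'}$, where $h,h'$ range over all terminal sequences of all agents. *Clique tree.* A clique tree for $G$ is an undirected tree each of whose nodes $C_1,\dots,C_\ell$ is labelled with a set of variables (a clique), with an assignment of each variable to a clique such that the clique of a chance or decision variable $X$ contains $\{X\}\cup\mathrm{Pa}_X$ and the clique of a utility variable $U$ contains $\mathrm{Pa}_U$ (it may or may not contain $U$), and such that $C_i\cap C_k\subseteq C_j$ whenever $C_j$ lies on the path from $C_i$ to $C_k$. Let $d$ be the largest number of joint assignments to the variables of a clique (the number of entries of the largest clique potential), and $u$ the number of utility variables. *Claim.* There are a single program for the real random access machine (unit cost for arithmetic operations on and comparisons of natural numbers and of real numbers, and for indirect memory access; no rounding of reals, no integer division, no real constants other than $0$ and $1$) and a constant $c$ such that for every such $G$, every clique tree for $G$ and every profile of realization plans $\sigma$ all of whose realization probabilities are positive, the program, given $G$, the clique tree and $\sigma$ in its memory as arrays, computes the matrix $\nabla V^G(\sigma)$ and halts after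 at most $$c\,\bigl(\ell^2 d^3+u\,|N|\,d^4\bigr)$$ steps. That is, $\nabla V^G(\sigma)$ can be computed in time $O(\ell^2 d^3+u|N|d^4)$. -/

import Mathlib

/-! ### Multi-agent influence diagrams -/

/-- A multi-agent influence diagram with agents `Fin N`, chance and decision variables `Fin n`
and utility variables `Fin u`.  Utility variables have no children, so all parents are chance or
decision variables. -/
structure MAID (N n u : ℕ) where
  /-- the chance or decision variable `v` takes its values in `Fin (card v)` -/
  card : Fin n → ℕ
  card_pos : ∀ v, 0 < card v
  /-- `none`: chance variable; `some k`: decision variable of agent `k` -/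
  owner : Fin n → Option (Fin N)
  parents : Fin n → Finset (Fin n)
  acyclic : ∀ v, ¬ Relation.TransGen (fun x y => x ∈ parents y) v v
  /-- conditional distributions of the chance variables given their parents -/
  cpd : ∀ v : {v // owner v = none},
    ((w : {w // w ∈ parents v.1}) → Fin (card w.1)) → Fin (card v.1) → ℝ
  cpd_nonneg : ∀ v pa x, 0 ≤ cpd v pa x
  cpd_sum : ∀ v pa, ∑ x, cpd v pa x = 1
  /-- the agent that receives the utility -/
  utilOwner : Fin u → Fin N
  utilParents : Fin u → Finset (Fin n)
  /-- utility as a function of the values of the parents -/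
  utility : ∀ j : Fin u, ((w : {w // w ∈ utilParents j}) → Fin (card w.1)) → ℝ

namespace MAID

variable {N n u : ℕ} (G : MAID N n u)

/-- Joint assignments to the chance and decision variables: the leaves of the game tree. -/
abbrev Outcome : Type := (v : Fin n) → Fin (G.card v)

/-- Joint assignments to the variables in `S`. -/
abbrev Assign (S : Finset (Fin n)) : Type := (w : {w // w ∈ S}) → Fin (G.card w.1)

variable {G} in
/-- The restriction of an outcome to the variables in `S`. -/
def Outcome.on (z : G.Outcome) (S : Finset (Fin n)) : G.Assign S := fun w => z w.1

/-- A variable together with its parents. -/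
def family (v : Fin n) : Finset (Fin n) := insert v (G.parents v)

abbrev Chance : Type := {v : Fin n // G.owner v = none}

abbrev Decision (k : Fin N) : Type := {v : Fin n // G.owner v = some k}

/-- Of any two decision variables of one agent, the later one has the earlier one and all
the parents of the earlier one among its parents. -/
def PerfectRecall : Prop :=
  ∀ (k : Fin N) (v w : G.Decision k), v ≠ w →
    G.family v.1 ⊆ G.parents w.1 ∨ G.family w.1 ⊆ G.parents v.1

/-- The decision variables of agent `k` and their parents: the variables that agent `k` sees or
chooses in the course of the game. -/
def scope (k : Fin N) : Finset (Fin n) :=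
  (Finset.univ.filter fun v => G.owner v = some k).biUnion G.family

/-- The terminal sequences (owner, history of the owner at a leaf).  The history of agent `k` at
the leaf `z` lists the information sets (values of the parents) and actions at all decision
variables of `k`, that is, it is the restriction of `z` to `G.scope k`. -/
abbrev Seq : Type := (k : Fin N) × G.Assign (G.scope k)

/-- The terminal sequence of agent `k` at the leaf `z`. -/
def history (k : Fin N) (z : G.Outcome) : G.Seq := ⟨k, z.on (G.scope k)⟩

/-- A strategy of agent `k`: a decision rule for each of its decision variables. -/
structure Strategy (k : Fin N) where
  prob : ∀ v : G.Decision k, G.Assign (G.parents v.1) → Fin (G.card v.1) → ℝ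
  prob_nonneg : ∀ v pa x, 0 ≤ prob v pa x
  prob_sum : ∀ v pa, ∑ x, prob v pa x = 1

/-- `σ` is the profile of realization plans, in sequence form, of a profile of strategies: the
realization probability of a terminal sequence is the product of the probabilities
of the owner's actions along it. -/
def IsRealizationPlan (σ : G.Seq → ℝ) : Prop :=
  ∃ b : ∀ k, G.Strategy k, ∀ (k : Fin N) (z : G.Outcome),
    σ (G.history k z) = ∏ v : G.Decision k, (b k).prob v (z.on (G.parents v.1)) (z v.1)

/-- The payoff of agent `k` at the leaf `z`: the sum of its utilities. -/
def payoff (k : Fin N) (z : G.Outcome) : ℝ :=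
  ∑ j ∈ Finset.univ.filter (fun j => G.utilOwner j = k), G.utility j (z.on (G.utilParents j))

/-- The product of nature's probabilities along the path to the leaf `z`. -/
def nature (z : G.Outcome) : ℝ :=
  ∏ v : G.Chance, G.cpd v (z.on (G.parents v.1)) (z v.1)

/-- The deviation function: the entry at a sequence `p` of agent `k` is the sum, over the leaves
consistent with `p`, of the payoff of `k` times the realization probabilities of nature and of all
agents other than `k`. -/
noncomputable def deviation (σ : G.Seq → ℝ) (p : G.Seq) : ℝ :=
  ∑ z ∈ Finset.univ.filter (fun z : G.Outcome => G.history p.1 z = p),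
    G.payoff p.1 z * (G.nature z * ∏ k ∈ Finset.univ.erase p.1, σ (G.history k z))

/-- The deviation function is differentiable, so that its partial derivatives are genuine. -/
theorem differentiable_deviation (p : G.Seq) :
    Differentiable ℝ (fun σ : G.Seq → ℝ => G.deviation σ p) := by
  unfold deviation
  fun_prop

/-- The Jacobian of the deviation function: the entry at `(p, q)` is the partial derivative
at `σ` of the entry `p` with respect to the realization probability of `q`. -/
noncomputable def jacobian (σ : G.Seq → ℝ) (p q : G.Seq) : ℝ :=
  fderiv ℝ (fun s : G.Seq → ℝ => G.deviation s p) σ (Pi.single q 1)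

/-- All variables of the Bayesian network: chance and decision variables, utility variables. -/
abbrev Var (_ : MAID N n u) : Type := Fin n ⊕ Fin u

/-- The number of values of a variable; the domain of a utility variable is the set of
its possible utility values. -/
noncomputable def domCard : G.Var → ℕ
  | Sum.inl v => G.card v
  | Sum.inr j => (Set.range (G.utility j)).ncard

/-! Row-major (mixed radix) numbering of the joint assignments to a set of variables. -/

/-- The weight of the variable `w` in the numbering of the assignments to `S`. -/
def stride (S : Finset (Fin n)) (w : Fin n) : ℕ := ∏ x ∈ S.filter (· < w), G.card x

/-- The number of an assignment to `S`, from `0` to (number of assignments) `- 1`. -/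
def encode (S : Finset (Fin n)) (a : G.Assign S) : ℕ := ∑ w, (a w : ℕ) * G.stride S w.1

/-- An outcome whose restriction to `S` has the number `i`; for `i` beyond the number of assignments
to `S` the numbering starts again from `0`. -/
def decode (S : Finset (Fin n)) (i : ℕ) : G.Outcome := fun w =>
  ⟨i / G.stride S w % G.card w, Nat.mod_lt _ (G.card_pos w)⟩

/-! ### Clique trees -/

/-- A clique tree with cliques `Fin ℓ` for (the Bayesian networks on the graph of) `G`. -/
structure CliqueTree (ℓ : ℕ) where
  tree : SimpleGraph (Fin ℓ)
  isTree : tree.IsTree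
  clique : Fin ℓ → Finset G.Var
  /-- the clique to which the family of a variable is assigned -/
  home : G.Var → Fin ℓ
  /-- family preservation for the chance and decision variables -/
  family_subset : ∀ v x, x ∈ G.family v → Sum.inl x ∈ clique (home (Sum.inl v))
  /-- family preservation for the utility variables; only the parents have to be in the clique,
  the utility variable itself may or may not be -/
  utilParents_subset : ∀ j x, x ∈ G.utilParents j → Sum.inl x ∈ clique (home (Sum.inr j))
  /-- separation: what two cliques share belongs to every clique on the path between them -/
  separation : ∀ (i k : Fin ℓ) (p : tree.Walk i k), p.IsPath →
    ∀ j ∈ p.support, clique i ∩ clique k ⊆ clique j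

variable {G} in
/-- The number of entries of the potential of a clique. -/
noncomputable def CliqueTree.potentialSize {ℓ : ℕ} (T : G.CliqueTree ℓ) (i : Fin ℓ) : ℕ :=
  ∏ x ∈ T.clique i, G.domCard x

variable {G} in
/-- The number of entries of the largest clique potential. -/
noncomputable def CliqueTree.maxSize {ℓ : ℕ} (T : G.CliqueTree ℓ) : ℕ :=
  Finset.univ.sup T.potentialSize

end MAID

/-! ### A real random access machine with unit costs

The memory consists of arrays of natural numbers and arrays of real numbers.  The name of an array
is a constant of the program, so that a program uses finitely many arrays; the index into an array
is computed.  Every arithmetic operation, constant, memory access and comparison costs one step.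
There are no operations from reals to integers (rounding), no integer division and no real
constants other than `0` and `1`. -/

namespace RealRAM

structure State where
  nat : ℕ → ℕ → ℕ
  real : ℕ → ℕ → ℝ

/-- Write the natural number `x` into cell `i` of the array `a`. -/
def State.setNat (s : State) (a i x : ℕ) : State :=
  { s with nat := Function.update s.nat a (Function.update (s.nat a) i x) }

/-- Write the real number `x` into cell `i` of the array `a`. -/
noncomputable def State.setReal (s : State) (a i : ℕ) (x : ℝ) : State :=
  { s with real := Function.update s.real a (Function.update (s.real a) i x) }

inductive NatExp where
  | lit (c : ℕ)
  | get (a : ℕ) (i : NatExp)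
  | add (e f : NatExp)
  | sub (e f : NatExp)
  | mul (e f : NatExp)

inductive RealExp where
  | zero
  | one
  | get (a : ℕ) (i : NatExp)
  | add (e f : RealExp)
  | sub (e f : RealExp)
  | mul (e f : RealExp)
  | div (e f : RealExp)

inductive Test where
  | natLt (e f : NatExp)
  | natEq (e f : NatExp)
  | realLt (e f : RealExp)
  | realEq (e f : RealExp)
  | not (b : Test)
  | and (b c : Test)

inductive Program where
  | skip
  | setNat (a : ℕ) (i e : NatExp)
  | setReal (a : ℕ) (i : NatExp) (e : RealExp)
  | seq (p q : Program)
  | ite (b : Test) (p q : Program)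
  | while (b : Test) (p : Program)

/-- Value of an expression; subtraction is truncated. -/
def NatExp.eval (s : State) : NatExp → ℕ
  | lit c => c
  | get a i => s.nat a (i.eval s)
  | add e f => e.eval s + f.eval s
  | sub e f => e.eval s - f.eval s
  | mul e f => e.eval s * f.eval s

/-- Value of an expression; division by zero returns zero. -/
noncomputable def RealExp.eval (s : State) : RealExp → ℝ
  | zero => 0
  | one => 1
  | get a i => s.real a (i.eval s)
  | add e f => e.eval s + f.eval s
  | sub e f => e.eval s - f.eval s
  | mul e f => e.eval s * f.eval s
  | div e f => e.eval s / f.eval s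

def Test.Holds (s : State) : Test → Prop
  | natLt e f => e.eval s < f.eval s
  | natEq e f => e.eval s = f.eval s
  | realLt e f => e.eval s < f.eval s
  | realEq e f => e.eval s = f.eval s
  | not b => ¬ b.Holds s
  | and b c => b.Holds s ∧ c.Holds s

/-- Number of steps for the evaluation of an expression. -/
def NatExp.cost : NatExp → ℕ
  | lit _ => 1
  | get _ i => i.cost + 1
  | add e f => e.cost + f.cost + 1
  | sub e f => e.cost + f.cost + 1
  | mul e f => e.cost + f.cost + 1

/-- Number of steps for the evaluation of an expression. -/
def RealExp.cost : RealExp → ℕ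
  | zero => 1
  | one => 1
  | get _ i => i.cost + 1
  | add e f => e.cost + f.cost + 1
  | sub e f => e.cost + f.cost + 1
  | mul e f => e.cost + f.cost + 1
  | div e f => e.cost + f.cost + 1

/-- Number of steps for a test. -/
def Test.cost : Test → ℕ
  | natLt e f => e.cost + f.cost + 1
  | natEq e f => e.cost + f.cost + 1
  | realLt e f => e.cost + f.cost + 1
  | realEq e f => e.cost + f.cost + 1
  | not b => b.cost + 1
  | and b c => b.cost + c.cost + 1

/-- `Exec p s s' t`: started in the state `s`, the program `p` halts after exactly `t` steps, in
the state `s'`. -/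
inductive Exec : Program → State → State → ℕ → Prop
  | skip (s : State) : Exec .skip s s 1
  | setNat (a : ℕ) (i e : NatExp) (s : State) :
      Exec (.setNat a i e) s (s.setNat a (i.eval s) (e.eval s)) (i.cost + e.cost + 1)
  | setReal (a : ℕ) (i : NatExp) (e : RealExp) (s : State) :
      Exec (.setReal a i e) s (s.setReal a (i.eval s) (e.eval s)) (i.cost + e.cost + 1)
  | seq {p q : Program} {s₁ s₂ s₃ : State} {t₁ t₂ : ℕ} :
      Exec p s₁ s₂ t₁ → Exec q s₂ s₃ t₂ → Exec (.seq p q) s₁ s₃ (t₁ + t₂)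
  | ite_true {b : Test} {p q : Program} {s s' : State} {t : ℕ} :
      b.Holds s → Exec p s s' t → Exec (.ite b p q) s s' (b.cost + t + 1)
  | ite_false {b : Test} {p q : Program} {s s' : State} {t : ℕ} :
      ¬ b.Holds s → Exec q s s' t → Exec (.ite b p q) s s' (b.cost + t + 1)
  | while_true {b : Test} {p : Program} {s₁ s₂ s₃ : State} {t₁ t₂ : ℕ} :
      b.Holds s₁ → Exec p s₁ s₂ t₁ → Exec (.while b p) s₂ s₃ t₂ →
      Exec (.while b p) s₁ s₃ (b.cost + t₁ + t₂ + 1)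
  | while_false {b : Test} {p : Program} {s : State} :
      ¬ b.Holds s → Exec (.while b p) s s (b.cost + 1)

/-- A vector as an array, with zeros after its entries. -/
def natVector {k : ℕ} (f : Fin k → ℕ) (i : ℕ) : ℕ := if h : i < k then f ⟨i, h⟩ else 0

open Classical in
/-- A relation as a row-major matrix of zeros and ones, with zeros after its entries. -/
noncomputable def bitMatrix {k m : ℕ} (r : Fin k → Fin m → Prop) (i : ℕ) : ℕ :=
  if h : i / m < k ∧ i % m < m then (if r ⟨i / m, h.1⟩ ⟨i % m, h.2⟩ then 1 else 0) else 0

/-- A family of `k` real tables, the table number `x` starting at cell `x * d` and taking up at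
most `d` cells. -/
noncomputable def tables {k : ℕ} (d : ℕ) (f : Fin k → ℕ → ℝ) (i : ℕ) : ℝ :=
  if h : i / d < k then f ⟨i / d, h⟩ (i % d) else 0

end RealRAM

namespace MAID

open RealRAM

variable {N n u : ℕ} (G : MAID N n u) {ℓ : ℕ} (T : G.CliqueTree ℓ)

/-- The position of the terminal sequence `p` in the vector of all realization probabilities;
agent `k` has the positions from `k * d` to `k * d + d - 1`, not all of them in use. -/
def position (d : ℕ) (p : G.Seq) : ℕ := (p.1 : ℕ) * d + G.encode (G.scope p.1) p.2

/-- The input arrays of natural numbers: sizes, numbers of values, owners, parent relations,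
clique tree.  All other cells are zero. -/
noncomputable def inputNat : ℕ → ℕ → ℕ
  | 0 => natVector ![N, n, u, ℓ, T.maxSize]
  | 1 => natVector G.card
  | 2 => natVector fun v => (G.owner v).elim 0 fun k => (k : ℕ) + 1
  | 3 => bitMatrix fun v w => w ∈ G.parents v
  | 4 => natVector fun j => (G.utilOwner j : ℕ)
  | 5 => bitMatrix fun j w => w ∈ G.utilParents j
  | 6 => bitMatrix fun i j => T.tree.Adj i j
  | 7 => bitMatrix fun i v => Sum.inl v ∈ T.clique i
  | 8 => bitMatrix fun i j => Sum.inr j ∈ T.clique i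
  | 9 => natVector fun v => (T.home (Sum.inl v) : ℕ)
  | 10 => natVector fun j => (T.home (Sum.inr j) : ℕ)
  | _ => fun _ => 0

/-- The input arrays of real numbers: the conditional distributions of the chance variables
(tables over their families), the utility functions (tables over the parents) and
the realization plans (tables over the terminal sequences), all in the numbering `encode`.  A table
with fewer than `T.maxSize` entries is followed by repetitions of its entries up to the start of
the next table.  All other cells are zero. -/
noncomputable def inputReal (σ : G.Seq → ℝ) : ℕ → ℕ → ℝ
  | 0 => tables T.maxSize fun v i =>
      let z := G.decode (G.family v) i
      if h : G.owner v = none then G.cpd ⟨v, h⟩ (z.on (G.parents v)) (z v) else 0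
  | 1 => tables T.maxSize fun j i => G.utility j ((G.decode (G.utilParents j) i).on _)
  | 2 => tables T.maxSize fun k i => σ (G.history k (G.decode (G.scope k) i))
  | _ => fun _ => 0

/-- The initial memory: a MAID, a clique tree and a profile of realization plans. -/
noncomputable def input (σ : G.Seq → ℝ) : State := ⟨G.inputNat T, G.inputReal T σ⟩

/-- The real array number `3` holds the Jacobian at `σ` as a row-major matrix. -/
def OutputsJacobian (σ : G.Seq → ℝ) (s : State) : Prop :=
  ∀ p q : G.Seq,
    s.real 3 (G.position T.maxSize p * (N * T.maxSize) + G.position T.maxSize q) =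
      G.jacobian σ p q

end MAID

/-! ### Reasoning about programs -/

namespace RealRAM

variable {s s' s'' : State} {p q : Program} {Q : State → ℕ → Prop} {τ : ℕ}

/-! For distinct owners `i` and `k`, the deviation function is affine in each coordinate, and its
derivative at `(p, q)` is the sum, over the leaves consistent with `p` and `q`, of the payoff of `i`
times the chance probabilities and the realization probabilities of all agents other than `i` and
`k`. On these leaves the two missing factors are the constants `σ p` and `σ q`; being positive, they
can be inserted and divided out again (`jacobian_eq`). So the numerators of all entries are sums
over leaves of one global weight, nature times all realization probabilities, multiplied by a payoff
and by two indicators. For equal owners the entry is zero.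

By perfect recall the family of the last decision variable of an agent is its whole scope
(`scope_eq_family`). Hence the realization plan of an agent and the indicator of one of its terminal
sequences live on a single clique, as do each chance distribution and each utility. The global
weight is a product over cliques and the payoff is a sum over cliques. Dual numbers turn product
times sum into one product: `∏ a (1 + ε w) = (∏ a) (1 + ε ∑ w)` (`prod_dualNumber`). A numerator is
then the `ε` part of a sum of products of clique weights.

Assignments to a clique are numbers below `d`, and agreement of neighbouring cliques is a kernel of
zeros and ones on the edges of the rooted tree. By the separation property, the tuples of clique
assignments that agree along all edges are exactly the restrictions of outcomes
(`total_eq_sum_outcome`), so the sum can be computed by eliminating one node after the other, with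
`d²` operations per edge. The sum is linear in the weights of each single clique, and an upward and
a downward pass give the coefficients for all cliques at once (`total_update`). Therefore one pair
of passes for `p` serves all `q` (`entry_eq`).

Time: let `e` be the number of agents that receive some utility; the rows of the others vanish. The
passes and the output cost `e d (ℓ d² + N d²)` up to constants, and `e ≤ u`, `e ≤ N` give `e² ≤ u
N`, hence `e ℓ ≤ ℓ² + u N`. As every variable has two values or more, a clique has at most `L = log₂
d` variables, where `L² ≤ 2 d` and `n ≤ ℓ L`. This absorbs the preparation, in which digits of
assignment numbers are extracted by repeated subtraction (`cost_le`).

The program is verified with assertions `Tr` (final state and step bound), invariants for counting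
loops, and a syntactic frame property that carries untouched arrays along. -/

@[simp] theorem State.setNat_real (s : State) (a i x : ℕ) : (s.setNat a i x).real = s.real := rfl

@[simp] theorem State.setReal_nat (s : State) (a i : ℕ) (x : ℝ) :
    (s.setReal a i x).nat = s.nat := rfl

@[simp] theorem State.setNat_nat_self (s : State) (a i x : ℕ) :
    (s.setNat a i x).nat a = Function.update (s.nat a) i x := by simp [State.setNat]

@[simp] theorem State.setNat_nat_of_ne (s : State) {a b : ℕ} (i x : ℕ) (h : b ≠ a) :
    (s.setNat a i x).nat b = s.nat b := by simp [State.setNat, h]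

@[simp] theorem State.setReal_real_self (s : State) (a i : ℕ) (x : ℝ) :
    (s.setReal a i x).real a = Function.update (s.real a) i x := by simp [State.setReal]

@[simp] theorem State.setReal_real_of_ne (s : State) {a b : ℕ} (i : ℕ) (x : ℝ) (h : b ≠ a) :
    (s.setReal a i x).real b = s.real b := by simp [State.setReal, h]

attribute [simp] NatExp.eval RealExp.eval Test.Holds

/-- Started in the state `s` at time `τ`, the program halts in a state and at a time that
satisfy `Q`. -/
def WP (p : Program) (Q : State → ℕ → Prop) (s : State) (τ : ℕ) : Prop :=
  ∃ s' t, Exec p s s' t ∧ Q s' (τ + t)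

@[simp] theorem wp_skip : WP .skip Q s τ ↔ Q s (τ + 1) := by
  constructor
  · rintro ⟨s', t, h, hq⟩; cases h; exact hq
  · intro h; exact ⟨_, _, .skip s, h⟩

@[simp] theorem wp_setNat {a i e} : WP (.setNat a i e) Q s τ ↔
    Q (s.setNat a (i.eval s) (e.eval s)) (τ + (i.cost + e.cost + 1)) := by
  constructor
  · rintro ⟨s', t, h, hq⟩; cases h; exact hq
  · intro h; exact ⟨_, _, .setNat a i e s, h⟩

@[simp] theorem wp_setReal {a i e} : WP (.setReal a i e) Q s τ ↔
    Q (s.setReal a (i.eval s) (e.eval s)) (τ + (i.cost + e.cost + 1)) := by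
  constructor
  · rintro ⟨s', t, h, hq⟩; cases h; exact hq
  · intro h; exact ⟨_, _, .setReal a i e s, h⟩

@[simp] theorem wp_seq : WP (.seq p q) Q s τ ↔ WP p (WP q Q) s τ := by
  constructor
  · rintro ⟨s', t, h, hq⟩
    cases h with
    | seq h1 h2 => exact ⟨_, _, h1, _, _, h2, by rwa [Nat.add_assoc]⟩
  · rintro ⟨s1, t1, h1, s2, t2, h2, hq⟩
    exact ⟨_, _, .seq h1 h2, by rwa [← Nat.add_assoc]⟩

open Classical in
@[simp] theorem wp_ite {b : Test} : WP (.ite b p q) Q s τ ↔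
    if b.Holds s then WP p Q s (τ + (b.cost + 1)) else WP q Q s (τ + (b.cost + 1)) := by
  have key : ∀ t, τ + (b.cost + 1) + t = τ + (b.cost + t + 1) := fun t => by omega
  constructor
  · rintro ⟨s', t, h, hq⟩
    cases h with
    | ite_true hb h1 => rw [if_pos hb]; exact ⟨_, _, h1, by rwa [key]⟩
    | ite_false hb h1 => rw [if_neg hb]; exact ⟨_, _, h1, by rwa [key]⟩
  · split_ifs with hb
    · rintro ⟨s', t, h, hq⟩; exact ⟨_, _, .ite_true hb h, by rwa [← key]⟩
    · rintro ⟨s', t, h, hq⟩; exact ⟨_, _, .ite_false hb h, by rwa [← key]⟩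

theorem wp_while_true {b : Test} (hb : b.Holds s)
    (h : WP p (WP (.while b p) Q) s (τ + (b.cost + 1))) : WP (.while b p) Q s τ := by
  obtain ⟨s1, t1, h1, s2, t2, h2, hq⟩ := h
  exact ⟨_, _, .while_true hb h1 h2, by convert hq using 1; omega⟩

theorem wp_while_false {b : Test} (hb : ¬ b.Holds s) (h : Q s (τ + (b.cost + 1))) :
    WP (.while b p) Q s τ :=
  ⟨_, _, .while_false hb, h⟩

/-- The program does not write to the array `a` of natural numbers. -/
def Program.keepsNat (a : ℕ) : Program → Bool
  | .skip => true
  | .setNat b _ _ => b != a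
  | .setReal _ _ _ => true
  | .seq p q => p.keepsNat a && q.keepsNat a
  | .ite _ p q => p.keepsNat a && q.keepsNat a
  | .while _ p => p.keepsNat a

/-- The program does not write to the array `a` of real numbers. -/
def Program.keepsReal (a : ℕ) : Program → Bool
  | .skip => true
  | .setNat _ _ _ => true
  | .setReal b _ _ => b != a
  | .seq p q => p.keepsReal a && q.keepsReal a
  | .ite _ p q => p.keepsReal a && q.keepsReal a
  | .while _ p => p.keepsReal a

/-- The states agree on all arrays to which the program does not write. -/
structure Frame (p : Program) (s s' : State) : Prop where
  nat : ∀ a, p.keepsNat a = true → s'.nat a = s.nat a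
  real : ∀ a, p.keepsReal a = true → s'.real a = s.real a

theorem Frame.refl (p : Program) (s : State) : Frame p s s := ⟨fun _ _ => rfl, fun _ _ => rfl⟩

theorem Frame.trans (h : Frame p s s') (h' : Frame p s' s'') : Frame p s s'' :=
  ⟨fun a ha => (h'.nat a ha).trans (h.nat a ha), fun a ha => (h'.real a ha).trans (h.real a ha)⟩

theorem Frame.mono (h : Frame p s s') (hn : ∀ a, q.keepsNat a = true → p.keepsNat a = true)
    (hr : ∀ a, q.keepsReal a = true → p.keepsReal a = true) : Frame q s s' :=
  ⟨fun a ha => h.nat a (hn a ha), fun a ha => h.real a (hr a ha)⟩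

/-- Array names are constants of the program, so the arrays to which it may write can be read off
its syntax, and `keepsNat`, `keepsReal` evaluate by computation. Later on, mostly a bare `rfl` shows
that an array has survived a subprogram. -/
theorem Exec.frame {t : ℕ} (h : Exec p s s' t) : Frame p s s' := by
  induction h with
  | skip s => exact .refl _ s
  | setNat a i e s =>
    refine ⟨fun b hb => ?_, fun _ _ => rfl⟩
    simp only [Program.keepsNat, bne_iff_ne] at hb
    exact State.setNat_nat_of_ne _ _ _ hb.symm
  | setReal a i e s =>
    refine ⟨fun _ _ => rfl, fun b hb => ?_⟩
    simp only [Program.keepsReal, bne_iff_ne] at hb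
    exact State.setReal_real_of_ne _ _ _ hb.symm
  | seq h1 h2 ih1 ih2 =>
    refine (ih1.mono ?_ ?_).trans (ih2.mono ?_ ?_) <;>
      simp only [Program.keepsNat, Program.keepsReal, Bool.and_eq_true] <;> tauto
  | ite_true hb h ih =>
    refine ih.mono ?_ ?_ <;>
      simp only [Program.keepsNat, Program.keepsReal, Bool.and_eq_true] <;> tauto
  | ite_false hb h ih =>
    refine ih.mono ?_ ?_ <;>
      simp only [Program.keepsNat, Program.keepsReal, Bool.and_eq_true] <;> tauto
  | while_true hb h1 h2 ih1 ih2 =>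
    exact Frame.trans (ih1.mono (q := .while _ _) (fun _ h => h) fun _ h => h) ih2
  | while_false hb => exact .refl _ _

/-- Started in the state `s`, the program halts within `B` steps in a state that
satisfies `R`. -/
def Tr (p : Program) (s : State) (B : ℕ) (R : State → Prop) : Prop :=
  ∃ s' t, Exec p s s' t ∧ t ≤ B ∧ R s'

theorem Tr.of_wp {B : ℕ} {R : State → Prop} (h : WP p (fun s' t => t ≤ B ∧ R s') s 0) :
    Tr p s B R := by
  obtain ⟨s', t, h, hq⟩ := h
  exact ⟨s', t, h, by simpa using hq⟩

theorem Tr.wp {B : ℕ} {R : State → Prop} (h : Tr p s B R)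
    (k : ∀ s' t, Frame p s s' → R s' → t ≤ B → Q s' (τ + t)) : WP p Q s τ := by
  obtain ⟨s', t, h, hB, hR⟩ := h
  exact ⟨s', t, h, k s' t h.frame hR hB⟩

theorem Tr.mono {B B' : ℕ} {R R' : State → Prop} (h : Tr p s B R) (hB : B ≤ B')
    (hR : ∀ s', Frame p s s' → R s' → R' s') : Tr p s B' R' := by
  obtain ⟨s', t, h, ht, hr⟩ := h
  exact ⟨s', t, h, ht.trans hB, hR s' h.frame hr⟩

theorem Tr.seq {B B' : ℕ} {R R' : State → Prop} (h : Tr p s B R)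
    (h' : ∀ s', Frame p s s' → R s' → Tr q s' B' R') : Tr (.seq p q) s (B + B') R' := by
  obtain ⟨s1, t1, e1, b1, r1⟩ := h
  obtain ⟨s2, t2, e2, b2, r2⟩ := h' s1 e1.frame r1
  exact ⟨s2, _, .seq e1 e2, Nat.add_le_add b1 b2, r2⟩

/-- The body is executed for the values `0, 1, …` of the counter (cell `0` of the array `i`) as long
as the counter is less than the bound. -/
def forLoop (i : ℕ) (b : NatExp) (body : Program) : Program :=
  .seq (.setNat i (.lit 0) (.lit 0))
    (.while (.natLt (.get i (.lit 0)) b)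
      (.seq body (.setNat i (.lit 0) (.add (.get i (.lit 0)) (.lit 1)))))

/-- The bound `B j` may depend on the iteration; `tr_evaluate` needs this, as agents without
utilities are cheap. In each iteration the loop adds `b.cost + 4` steps for the test and 6 for the
increment of the counter; leaving the loop costs `b.cost + 4` and setting the counter 3. The
invariant refers to the state after the increment. -/
theorem Tr.forLoop_sum {i : ℕ} {b : NatExp} {body : Program} (m : ℕ) (B : ℕ → ℕ)
    (I : ℕ → State → Prop)
    (hk : body.keepsNat i = true)
    (hb : ∀ s', Frame (forLoop i b body) s s' → b.eval s' = m)
    (h0 : I 0 (s.setNat i 0 0))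
    (hstep : ∀ j < m, ∀ s', Frame (forLoop i b body) s s' → s'.nat i 0 = j → I j s' →
      Tr body s' (B j) fun s'' => I (j + 1) (s''.setNat i 0 (j + 1))) :
    Tr (forLoop i b body) s
      (∑ j ∈ Finset.range m, (B j + b.cost + 10) + b.cost + 7) (I m) := by
  -- Induction on the number `k` of iterations still to come; the frame back to `s` keeps the value
  -- of the loop bound equal to `m`.
  have main : ∀ k j s', k + j = m → Frame (forLoop i b body) s s' → s'.nat i 0 = j → I j s' →
      ∃ s'' t, Exec (.while (.natLt (.get i (.lit 0)) b)
        (.seq body (.setNat i (.lit 0) (.add (.get i (.lit 0)) (.lit 1))))) s' s'' t ∧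
        t ≤ ∑ j ∈ Finset.Ico j m, (B j + b.cost + 10) + b.cost + 4 ∧ I m s'' := by
    intro k
    induction k with
    | zero =>
      intro j s' hj f hc hI
      obtain rfl : j = m := by omega
      refine ⟨s', _, .while_false ?_, ?_, hI⟩
      · simp [hb s' f, hc]
      · simp [Test.cost, NatExp.cost]; omega
    | succ k ih =>
      intro j s' hj f hc hI
      obtain ⟨s1, t1, e1, b1, r1⟩ := hstep j (by omega) s' f hc hI
      have hi1 : s1.nat i 0 = j := by rw [e1.frame.nat i hk, hc]
      have e2 := Exec.seq e1 (.setNat i (.lit 0) (.add (.get i (.lit 0)) (.lit 1)) s1)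
      simp only [NatExp.eval, hi1, NatExp.cost] at e2
      have f2 : Frame (forLoop i b body) s' (s1.setNat i 0 (j + 1)) := by
        refine e2.frame.mono ?_ ?_ <;>
        simp only [forLoop, Program.keepsNat, Program.keepsReal, Bool.and_eq_true] <;> tauto
      obtain ⟨s2, t2, e3, b3, r3⟩ := ih (j + 1) _ (by omega) (f.trans f2) (by simp) r1
      refine ⟨s2, _, .while_true ?_ e2 e3, ?_, r3⟩
      · simp [hb s' f, hc]; omega
      · rw [Finset.sum_eq_sum_Ico_succ_bot (by omega : j < m)]
        simp [Test.cost, NatExp.cost]; omega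
  have f0 : Frame (forLoop i b body) s (s.setNat i 0 0) := by
    refine (Exec.setNat i (.lit 0) (.lit 0) s).frame.mono ?_ ?_ <;>
    simp only [forLoop, Program.keepsNat, Program.keepsReal, Bool.and_eq_true] <;> tauto
  obtain ⟨s2, t, e, bt, r⟩ := main m 0 (s.setNat i 0 0) (by omega) f0 (by simp) h0
  refine ⟨s2, _, .seq (.setNat i (.lit 0) (.lit 0) s) e, ?_, r⟩
  rw [Finset.range_eq_Ico]
  simp only [NatExp.cost]; omega

theorem Tr.forLoop {i : ℕ} {b : NatExp} {body : Program} (m B : ℕ)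
    (I : ℕ → State → Prop)
    (hk : body.keepsNat i = true)
    (hb : ∀ s', Frame (forLoop i b body) s s' → b.eval s' = m)
    (h0 : I 0 (s.setNat i 0 0))
    (hstep : ∀ j < m, ∀ s', Frame (RealRAM.forLoop i b body) s s' → s'.nat i 0 = j → I j s' →
      Tr body s' B fun s'' => I (j + 1) (s''.setNat i 0 (j + 1))) :
    Tr (RealRAM.forLoop i b body) s (m * (B + b.cost + 10) + b.cost + 7) (I m) := by
  have := Tr.forLoop_sum m (fun _ => B) I hk hb h0 hstep
  simpa using this

/-- A variable: cell `0` of an array. -/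
abbrev NatExp.var (a : ℕ) : NatExp := .get a (.lit 0)

/-- The sum of the values of an expression, in cell `0` of the array `acc`. -/
def sumLoop (i : ℕ) (b : NatExp) (acc : ℕ) (e : RealExp) : Program :=
  .seq (.setReal acc (.lit 0) .zero)
    (forLoop i b (.setReal acc (.lit 0) (.add (.get acc (.lit 0)) e)))

theorem Tr.sumLoop {i : ℕ} {b : NatExp} {acc : ℕ} {e : RealExp} (m : ℕ) (v : ℕ → ℝ)
    (hb : ∀ s', Frame (sumLoop i b acc e) s s' → b.eval s' = m)
    (he : ∀ j < m, ∀ s', Frame (RealRAM.sumLoop i b acc e) s s' → s'.nat i 0 = j →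
      e.eval s' = v j) :
    Tr (RealRAM.sumLoop i b acc e) s (m * (e.cost + b.cost + 15) + b.cost + 10)
      (fun s' => s'.real acc 0 = ∑ j ∈ Finset.range m, v j) := by
  apply Tr.of_wp
  rw [RealRAM.sumLoop, wp_seq, wp_setReal]
  have f0 : Frame (RealRAM.sumLoop i b acc e) s (s.setReal acc 0 0) := by
    refine (Exec.setReal acc (.lit 0) .zero s).frame.mono ?_ ?_ <;>
    simp only [RealRAM.sumLoop, Program.keepsNat, Program.keepsReal, Bool.and_eq_true] <;> tauto
  have f1 : ∀ s', Frame (RealRAM.forLoop i b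
      (.setReal acc (.lit 0) (.add (.get acc (.lit 0)) e))) (s.setReal acc 0 0) s' →
      Frame (RealRAM.sumLoop i b acc e) s s' := fun s' f =>
    f0.trans (f.mono (by simp only [RealRAM.sumLoop, Program.keepsNat, Bool.and_eq_true]; tauto)
      (by simp only [RealRAM.sumLoop, Program.keepsReal, Bool.and_eq_true]; tauto))
  refine (Tr.forLoop m (e.cost + 5)
    (fun j s' => s'.real acc 0 = ∑ j ∈ Finset.range j, v j) rfl (fun s' f => hb s' (f1 s' f))
    (by simp) ?_).wp ?_
  · intro j hj s' f hi hI
    apply Tr.of_wp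
    simp only [wp_setReal, NatExp.eval, RealExp.eval, State.setNat_real, State.setReal_real_self,
      Function.update_self, hI, Finset.sum_range_succ, he j hj s' (f1 s' f) hi, and_true]
    simp [NatExp.cost, RealExp.cost]; omega
  · intro s' t f hR ht
    refine ⟨?_, hR⟩
    have : m * (e.cost + 5 + b.cost + 10) = m * (e.cost + b.cost + 15) := by ring
    simp only [NatExp.cost, RealExp.cost]; omega

/-- Two cells of a table with rows of length `n` are the same if and only if they are in the same row
and column. -/
theorem row_major_inj {n c j c' j' : ℕ} (hj : j < n) (hj' : j' < n) :
    c * n + j = c' * n + j' ↔ c = c' ∧ j = j' := by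
  constructor
  · intro h
    have h1 : (c * n + j) / n = (c' * n + j') / n := by rw [h]
    have h2 : (c * n + j) % n = (c' * n + j') % n := by rw [h]
    have hn : 0 < n := by omega
    rw [Nat.mul_comm c, Nat.mul_comm c', Nat.mul_add_div hn, Nat.mul_add_div hn,
      Nat.div_eq_of_lt hj, Nat.div_eq_of_lt hj'] at h1
    rw [Nat.mul_comm c, Nat.mul_comm c', Nat.mul_add_mod, Nat.mul_add_mod,
      Nat.mod_eq_of_lt hj, Nat.mod_eq_of_lt hj'] at h2
    exact ⟨by simpa using h1, h2⟩
  · rintro ⟨rfl, rfl⟩; rfl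

end RealRAM

/-! ### Lists of the variables of each clique -/

namespace RealRAM

/-- The numbers `v < m` with `b v = 1`, in increasing order. -/
def members (b : ℕ → ℕ) (m : ℕ) : List ℕ := (List.range m).filter fun v => b v = 1

theorem members_succ (b : ℕ → ℕ) (m : ℕ) :
    members b (m + 1) = members b m ++ if b m = 1 then [m] else [] := by
  simp only [members, List.range_succ, List.filter_append]
  congr 1
  by_cases h : b m = 1 <;> simp [h]

theorem length_members_le (b : ℕ → ℕ) (m : ℕ) : (members b m).length ≤ m := by
  simpa [members] using List.length_filter_le (fun v => decide (b v = 1)) (List.range m)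

/-- For each clique, the list of its chance and decision variables in the array `11`, the length of
this list in the array `12` and the number of assignments to these variables in the array `13`. -/
def listCliques : Program :=
  forLoop 30 (.get 0 (.lit 3)) <|
    .seq (.setNat 12 (.var 30) (.lit 0)) <|
    .seq (.setNat 13 (.var 30) (.lit 1)) <|
    forLoop 31 (.get 0 (.lit 1)) <|
      .ite (.natEq (.get 7 (.add (.mul (.var 30) (.get 0 (.lit 1))) (.var 31))) (.lit 1))
        (.seq (.setNat 11 (.add (.mul (.var 30) (.get 0 (.lit 1))) (.get 12 (.var 30))) (.var 31)) <|
         .seq (.setNat 12 (.var 30) (.add (.get 12 (.var 30)) (.lit 1))) <|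
         .setNat 13 (.var 30) (.mul (.get 13 (.var 30)) (.get 1 (.var 31))))
        .skip

/-- The list and the number of assignments of the clique `c`, restricted to variables less than `m`. -/
structure Listed (n m : ℕ) (bit card list len size : ℕ → ℕ) (c : ℕ) : Prop where
  list_eq : (List.range (len c)).map (fun j => list (c * n + j)) =
    members (fun v => bit (c * n + v)) m
  size_eq : size c = ∏ v ∈ Finset.range m, if bit (c * n + v) = 1 then card v else 1

theorem Listed.len_le {n m : ℕ} {bit card list len size : ℕ → ℕ} {c : ℕ}
    (h : Listed n m bit card list len size c) : len c ≤ m := by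
  have := congrArg List.length h.list_eq
  simp only [List.length_map, List.length_range] at this
  exact this ▸ length_members_le _ _

theorem tr_listCliques {s : State} {n ℓ : ℕ} (hn : s.nat 0 1 = n) (hl : s.nat 0 3 = ℓ) :
    Tr listCliques s (ℓ * (n * 80 + 60) + 20) fun s' => ∀ c < ℓ,
      Listed n n (s.nat 7) (s.nat 1) (s'.nat 11) (s'.nat 12) (s'.nat 13) c := by
  refine (Tr.forLoop ℓ (n * 80 + 30) (fun j s' => ∀ c < j,
    Listed n n (s.nat 7) (s.nat 1) (s'.nat 11) (s'.nat 12) (s'.nat 13) c) rfl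
    (fun s' f => by simp [f.nat 0 rfl, hl]) (by simp) ?_).mono ?_ fun _ _ h => h
  · intro c hc s' f hcc hI
    apply Tr.of_wp
    have e0 := f.nat 0 rfl
    have e7 := f.nat 7 rfl
    have e1 := f.nat 1 rfl
    simp only [wp_seq, wp_setNat, NatExp.eval, hcc]
    refine (Tr.forLoop n 60 (fun v s' =>
      (∀ c' < c, Listed n n (s.nat 7) (s.nat 1) (s'.nat 11) (s'.nat 12) (s'.nat 13) c') ∧
      Listed n v (s.nat 7) (s.nat 1) (s'.nat 11) (s'.nat 12) (s'.nat 13) c) rfl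
      (fun s' f => by simp [f.nat 0 rfl, e0, hn]) ?_ ?_).wp ?_
    · refine ⟨fun c' hc' => ⟨?_, ?_⟩, ⟨?_, ?_⟩⟩
      · simpa [Function.update_of_ne hc'.ne, hcc] using (hI c' hc').list_eq
      · simpa [Function.update_of_ne hc'.ne, hcc] using (hI c' hc').size_eq
      · simp [members]
      · simp [hcc]
    · intro v hv s2 f2 hv2 hI2
      apply Tr.of_wp
      have e0' := f2.nat 0 rfl
      have e7' := f2.nat 7 rfl
      have e1' := f2.nat 1 rfl
      have e30 := f2.nat 30 rfl
      simp [e0, e7, e1, hcc] at e0' e7' e1' e30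
      have hlen := hI2.2.len_le
      by_cases hb : s.nat 7 (c * n + v) = 1
      · simp [e0', e7', e1', e30, hcc, hv2, hn, hb, NatExp.cost, Test.cost]
        refine ⟨fun c' hc' => ⟨?_, ?_⟩, ⟨?_, ?_⟩⟩
        · rw [← (hI2.1 c' hc').list_eq]
          simp only [ne_eq, hc'.ne, not_false_eq_true, Function.update_of_ne]
          -- The new entry is in row `c`; the list of an earlier clique has length at most `n` and
          -- stays within its own row.
          refine List.map_congr_left fun j hj => Function.update_of_ne ?_ _ _
          have := (hI2.1 c' hc').len_le
          rw [List.mem_range] at hj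
          rw [ne_eq, row_major_inj (by omega) (by omega)]
          omega
        · simp [Function.update_of_ne hc'.ne, (hI2.1 c' hc').size_eq]
        · rw [members_succ, if_pos hb, ← hI2.2.list_eq]
          simp only [Function.update_self, List.range_succ, List.map_append, List.map_cons,
            List.map_nil]
          congr 1
          refine List.map_congr_left fun j hj => Function.update_of_ne ?_ _ _
          rw [List.mem_range] at hj
          omega
        · simp [Finset.prod_range_succ, hb, hI2.2.size_eq]
      · simp [e0', e7', e30, hcc, hv2, hn, hb, NatExp.cost, Test.cost]
        refine ⟨hI2.1, ⟨?_, ?_⟩⟩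
        · rw [members_succ, if_neg hb, hI2.2.list_eq, List.append_nil]
        · simp [Finset.prod_range_succ, hb, hI2.2.size_eq]
    · intro s2 t f2 hI2 ht
      simp only [NatExp.cost] at ht ⊢
      refine ⟨by omega, fun c' hc' => ?_⟩
      simp
      rcases Nat.lt_succ_iff_lt_or_eq.1 hc' with h | rfl
      · exact hI2.1 _ h
      · exact hI2.2
  · simp [NatExp.cost]
    ring_nf; omega

end RealRAM

/-! ### Rooting the clique tree by breadth first search -/

namespace RealRAM

/-- The state of a breadth first search: `m` nodes have been visited, `ord` lists them, `pos` is its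
inverse, `par` gives the position of the node from which a node was reached. -/
structure Searched (ℓ : ℕ) (adj : ℕ → ℕ → Prop) (m : ℕ) (ord pos par vis : ℕ → ℕ) : Prop where
  one_le : 1 ≤ m
  ord_lt : ∀ t < m, ord t < ℓ
  pos_ord : ∀ t < m, pos (ord t) = t
  vis_ord : ∀ t < m, vis (ord t) ≠ 0
  pos_lt : ∀ b < ℓ, vis b ≠ 0 → pos b < m
  ord_pos : ∀ b < ℓ, vis b ≠ 0 → ord (pos b) = b
  ord_zero : ord 0 = 0
  par_zero : par 0 = 0
  par_lt : ∀ t < m, 0 < t → par t < t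
  adj_par : ∀ t < m, 0 < t → adj (ord (par t)) (ord t)

/-- The new node takes the place `m` beyond all old places, and it was not visited, so it differs
from all listed nodes. Hence none of the updates touches an old entry. -/
theorem Searched.push {ℓ : ℕ} {adj : ℕ → ℕ → Prop} {m : ℕ} {ord pos par vis : ℕ → ℕ}
    (h : Searched ℓ adj m ord pos par vis) {b t : ℕ} (hb : b < ℓ) (hv : vis b = 0) (ht : t < m)
    (ha : adj (ord t) b) :
    Searched ℓ adj (m + 1) (Function.update ord m b) (Function.update pos b m)
      (Function.update par m t) (Function.update vis b 1) := by
  have hne : ∀ k < m, ord k ≠ b := fun k hk hkb => h.vis_ord k hk (hkb ▸ hv)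
  have hlt : ∀ k < m, (Function.update ord m b) k = ord k := fun k hk =>
    Function.update_of_ne hk.ne _ _
  refine ⟨by omega, ?_, ?_, ?_, ?_, ?_, ?_, ?_, ?_, ?_⟩
  · intro k hk
    rcases Nat.lt_succ_iff_lt_or_eq.1 hk with hk | rfl
    · rw [hlt k hk]; exact h.ord_lt k hk
    · simpa using hb
  · intro k hk
    rcases Nat.lt_succ_iff_lt_or_eq.1 hk with hk | rfl
    · rw [hlt k hk, Function.update_of_ne (hne k hk)]; exact h.pos_ord k hk
    · simp
  · intro k hk
    rcases Nat.lt_succ_iff_lt_or_eq.1 hk with hk | rfl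
    · rw [hlt k hk, Function.update_of_ne (hne k hk)]; exact h.vis_ord k hk
    · simp
  · intro c hc hvc
    by_cases hcb : c = b
    · subst hcb; simp
    · rw [Function.update_of_ne hcb] at hvc ⊢
      exact (h.pos_lt c hc hvc).trans (Nat.lt_succ_self m)
  · intro c hc hvc
    by_cases hcb : c = b
    · subst hcb; simp
    · rw [Function.update_of_ne hcb] at hvc ⊢
      rw [hlt _ (h.pos_lt c hc hvc)]
      exact h.ord_pos c hc hvc
  · rw [hlt _ h.one_le, h.ord_zero]
  · rw [Function.update_of_ne (by have := h.one_le; omega), h.par_zero]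
  · intro k hk h0
    rcases Nat.lt_succ_iff_lt_or_eq.1 hk with hk | rfl
    · rw [Function.update_of_ne hk.ne]; exact h.par_lt k hk h0
    · simpa using ht
  · intro k hk h0
    rcases Nat.lt_succ_iff_lt_or_eq.1 hk with hk | rfl
    · rw [Function.update_of_ne hk.ne, hlt k hk, hlt _ ((h.par_lt k hk h0).trans hk)]
      exact h.adj_par k hk h0
    · simpa [hlt t ht] using ha

/-- An enumeration of the nodes of a connected graph such that every node but the first is adjacent to
an earlier one, its parent. -/
structure Rooted (ℓ : ℕ) (adj : ℕ → ℕ → Prop) (ord pos par : ℕ → ℕ) : Prop where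
  ord_lt : ∀ t < ℓ, ord t < ℓ
  pos_ord : ∀ t < ℓ, pos (ord t) = t
  pos_lt : ∀ b < ℓ, pos b < ℓ
  ord_pos : ∀ b < ℓ, ord (pos b) = b
  par_zero : par 0 = 0
  par_lt : ∀ t < ℓ, 0 < t → par t < t
  adj_par : ∀ t < ℓ, 0 < t → adj (ord (par t)) (ord t)

theorem Rooted.par_lt' {ℓ : ℕ} {adj : ℕ → ℕ → Prop} {ord pos par : ℕ → ℕ}
    (h : Rooted ℓ adj ord pos par) {t : ℕ} (ht : t < ℓ) : par t < ℓ := by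
  rcases Nat.eq_zero_or_pos t with rfl | h0
  · rwa [h.par_zero]
  · exact (h.par_lt t ht h0).trans ht

/-- `pos` embeds the `ℓ` nodes into the `m` places and `ord` embeds the places into the nodes, so `m
= ℓ`. -/
theorem Searched.rooted {ℓ : ℕ} {adj : ℕ → ℕ → Prop} {m : ℕ} {ord pos par vis : ℕ → ℕ}
    (h : Searched ℓ adj m ord pos par vis) (hv : ∀ b < ℓ, vis b ≠ 0) :
    Rooted ℓ adj ord pos par := by
  have hm : ℓ ≤ m := by
    have := Fintype.card_le_of_injective (α := Fin ℓ) (β := Fin m)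
      (fun b => ⟨pos b, h.pos_lt b b.2 (hv b b.2)⟩) fun b c hbc => by
        have h1 := h.ord_pos b b.2 (hv b b.2)
        have h2 := h.ord_pos c c.2 (hv c c.2)
        rw [Fin.mk.injEq] at hbc
        rw [hbc] at h1
        exact Fin.ext (h1.symm.trans h2)
    simpa using this
  have hm' : m ≤ ℓ := by
    have := Fintype.card_le_of_injective (α := Fin m) (β := Fin ℓ)
      (fun t => ⟨ord t, h.ord_lt t t.2⟩) fun t k htk => by
        have h1 := h.pos_ord t t.2
        have h2 := h.pos_ord k k.2
        rw [Fin.mk.injEq] at htk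
        rw [htk] at h1
        exact Fin.ext (h1.symm.trans h2)
    simpa using this
  obtain rfl := le_antisymm hm hm'
  exact ⟨h.ord_lt, h.pos_ord, fun b hb => h.pos_lt b hb (hv b hb),
    fun b hb => h.ord_pos b hb (hv b hb), h.par_zero, h.par_lt, h.adj_par⟩

/-- A breadth first search of the clique tree: the nodes in the order of the search in
the array `14`, their positions in the array `15`, the positions of their parents in the
array `16`. -/
def searchTree : Program :=
  .seq (.setNat 14 (.lit 0) (.lit 0)) <|
  .seq (.setNat 15 (.lit 0) (.lit 0)) <|
  .seq (.setNat 16 (.lit 0) (.lit 0)) <|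
  .seq (.setNat 17 (.lit 0) (.lit 1)) <|
  .seq (.setNat 18 (.lit 0) (.lit 1)) <|
  forLoop 30 (.get 0 (.lit 3)) <|
    .ite (.natLt (.var 30) (.var 18))
      (forLoop 31 (.get 0 (.lit 3)) <|
        .ite (.and (.natEq (.get 6 (.add (.mul (.get 14 (.var 30)) (.get 0 (.lit 3))) (.var 31)))
            (.lit 1)) (.natEq (.get 17 (.var 31)) (.lit 0)))
          (.seq (.setNat 14 (.var 18) (.var 31)) <|
           .seq (.setNat 15 (.var 31) (.var 18)) <|
           .seq (.setNat 16 (.var 18) (.var 30)) <|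
           .seq (.setNat 17 (.var 31) (.lit 1)) <|
           .setNat 18 (.lit 0) (.add (.var 18) (.lit 1)))
          .skip)
      .skip

/-- The list of visited nodes is also the queue. The invariant says that all neighbours of the nodes
at the scanned places have been visited. In the end every occupied place is scanned, so the visited
set contains the node `0` and is closed under adjacency; by `hconn` it is everything. -/
theorem tr_searchTree {s : State} {ℓ : ℕ} (hl : s.nat 0 3 = ℓ) (hl1 : 1 ≤ ℓ)
    (hvis : s.nat 17 = fun _ => 0)
    (hconn : ∀ P : ℕ → Prop, P 0 →
      (∀ a < ℓ, ∀ b < ℓ, P a → s.nat 6 (a * ℓ + b) = 1 → P b) → ∀ b < ℓ, P b) :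
    Tr searchTree s (ℓ * (ℓ * 100 + 100) + 100) fun s' =>
      Rooted ℓ (fun a b => s.nat 6 (a * ℓ + b) = 1) (s'.nat 14) (s'.nat 15) (s'.nat 16) := by
  set adj : ℕ → ℕ → Prop := fun a b => s.nat 6 (a * ℓ + b) = 1 with hadj
  apply Tr.of_wp
  simp only [searchTree, wp_seq, wp_setNat, NatExp.eval]
  refine (Tr.forLoop ℓ (ℓ * 100 + 50) (fun j s' =>
    Searched ℓ adj (s'.nat 18 0) (s'.nat 14) (s'.nat 15) (s'.nat 16) (s'.nat 17) ∧
    ∀ t < j, t < s'.nat 18 0 → ∀ b < ℓ, adj (s'.nat 14 t) b → s'.nat 17 b ≠ 0) rfl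
    (fun s' f => by simp [f.nat 0 rfl, hl]) ?_ ?_).wp ?_
  · refine ⟨⟨?_, ?_, ?_, ?_, ?_, ?_, ?_, ?_, ?_, ?_⟩, ?_⟩
    all_goals simp [hvis]
    · omega
    · intro b hb h
      by_cases h0 : b = 0
      · subst h0; simp
      · rw [Function.update_of_ne h0] at h
        exact absurd rfl h
    · intro b hb h
      by_cases h0 : b = 0
      · subst h0; simp
      · rw [Function.update_of_ne h0] at h
        exact absurd rfl h
  · intro h hh s1 f1 hc ⟨hS, hC⟩
    have e0 := f1.nat 0 rfl
    have e6 := f1.nat 6 rfl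
    simp at e0 e6
    apply Tr.of_wp
    by_cases hm : h < s1.nat 18 0
    · simp only [wp_ite, Test.Holds, NatExp.eval, hc, hm, if_true]
      refine (Tr.forLoop ℓ 80 (fun v s' =>
        Searched ℓ adj (s'.nat 18 0) (s'.nat 14) (s'.nat 15) (s'.nat 16) (s'.nat 17) ∧
        h < s'.nat 18 0 ∧
        (∀ t < h, t < s'.nat 18 0 → ∀ b < ℓ, adj (s'.nat 14 t) b → s'.nat 17 b ≠ 0) ∧
        ∀ b < v, adj (s'.nat 14 h) b → s'.nat 17 b ≠ 0) rfl
        (fun s' f => by simp [f.nat 0 rfl, e0, hl]) ?_ ?_).wp ?_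
      · simpa using ⟨hS, hm, hC⟩
      · intro v hv s2 f2 hv2 ⟨hS2, hm2, hC2, hD2⟩
        have e0' := f2.nat 0 rfl
        have e6' := f2.nat 6 rfl
        have e30 := f2.nat 30 rfl
        simp [e0, e6] at e0' e6'
        apply Tr.of_wp
        by_cases hb : s.nat 6 (s2.nat 14 h * ℓ + v) = 1 ∧ s2.nat 17 v = 0
        · simp [e0', e6', e30, hc, hl, hv2, hb.1, hb.2, NatExp.cost, Test.cost]
          refine ⟨hS2.push hv hb.2 hm2 hb.1, by omega, ?_, ?_⟩
          · intro t ht htm b hbl hab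
            rw [Function.update_of_ne (by omega)] at hab
            have := hC2 t ht (by omega) b hbl hab
            by_cases hbv : b = v
            · subst hbv; simp
            · rwa [Function.update_of_ne hbv]
          · intro b hbl hab
            rw [Function.update_of_ne (by omega)] at hab
            by_cases hbv : b = v
            · subst hbv; simp
            · rw [Function.update_of_ne hbv]; exact hD2 b (by omega) hab
        · simp [e0', e6', e30, hc, hl, hv2, hb, NatExp.cost, Test.cost]
          refine ⟨hS2, hm2, hC2, ?_⟩
          intro b hbl hab
          rcases hbl.lt_or_eq with hbl | rfl
          · exact hD2 b hbl hab
          · exact fun h0 => hb ⟨hab, h0⟩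
      · intro s2 t f2 ⟨hS2, hm2, hC2, hD2⟩ ht
        simp [NatExp.cost, Test.cost] at ht ⊢
        refine ⟨by omega, hS2, ?_⟩
        intro t ht htm b hbl hab
        rcases ht.lt_or_eq with ht | rfl
        · exact hC2 t ht htm b hbl hab
        · exact hD2 b hbl hab
    · simp [hc, hm, NatExp.cost, Test.cost]
      refine ⟨hS, ?_⟩
      intro t ht htm
      exact hC t (by omega) htm
  · intro s' t f ⟨hS, hC⟩ ht
    simp only [NatExp.cost] at ht ⊢
    -- Listed nodes are distinct, so there are at most `ℓ` occupied places and the `ℓ` rounds of the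
    -- outer loop have scanned them all.
    have hlm : s'.nat 18 0 ≤ ℓ := by
      have := Fintype.card_le_of_injective (α := Fin (s'.nat 18 0)) (β := Fin ℓ)
        (fun t => ⟨s'.nat 14 t, hS.ord_lt t t.2⟩) fun t k htk => by
          have h1 := hS.pos_ord t t.2
          have h2 := hS.pos_ord k k.2
          rw [Fin.mk.injEq] at htk
          rw [htk] at h1
          exact Fin.ext (h1.symm.trans h2)
      simpa using this
    refine ⟨?_, hS.rooted (hconn _ ?_ ?_)⟩
    · have : ℓ * (ℓ * 100 + 50 + (1 + 1) + 10) ≤ ℓ * (ℓ * 100 + 100) :=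
        Nat.mul_le_mul_left _ (by omega)
      omega
    · have := hS.vis_ord 0 hS.one_le
      rwa [hS.ord_zero] at this
    · intro a ha b hb hva hab
      have hp := hS.pos_lt a ha hva
      refine hC (s'.nat 15 a) (by omega) hp b hb ?_
      rwa [hS.ord_pos a ha hva]

end RealRAM

/-! ### Restriction of numbered assignments to subsets of variables -/

namespace RealRAM

/-- The product of the numbers `card w` for `w < v` with `b w = 1`. -/
def weight (card b : ℕ → ℕ) (v : ℕ) : ℕ := ∏ w ∈ Finset.range v, if b w = 1 then card w else 1

/-- If `x` numbers an assignment to the variables `v` with `b v = 1`, the number of the restriction of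
this assignment to the variables that also satisfy `e v = 1`. -/
def project (card b e : ℕ → ℕ) (n x : ℕ) : ℕ :=
  ∑ w ∈ Finset.range n, if b w = 1 ∧ e w = 1 then
    x / weight card b w % card w * weight card (fun w => b w * e w) w else 0

/-- Euclidean division by repeated subtraction: divides the variable `40` by the number of values of
the variable of the diagram whose index is in `44`. -/
def divLoop : Program :=
  .while (.not (.natLt (.var 40) (.get 1 (.var 44)))) <|
    .seq (.setNat 40 (.lit 0) (.sub (.var 40) (.get 1 (.var 44)))) <|
    .setNat 45 (.lit 0) (.add (.var 45) (.lit 1))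

/-- Every subtraction adds one to the quotient, so the time is proportional to the quotient. -/
theorem tr_divLoop {c : ℕ} (hc : 0 < c) (x : ℕ) : ∀ (s : State), s.nat 40 0 = x →
    s.nat 1 (s.nat 44 0) = c →
    Tr divLoop s (x / c * 30 + 10) fun s' =>
      s'.nat 40 0 = x % c ∧ s'.nat 45 0 = s.nat 45 0 + x / c := by
  induction x using Nat.strong_induction_on with
  | _ x ih =>
    intro s hx hs
    apply Tr.of_wp
    by_cases h : x < c
    · refine wp_while_false ?_ ?_
      · simp [hx, hs, h]
      · simp [Test.cost, NatExp.cost, hx, Nat.mod_eq_of_lt h, Nat.div_eq_of_lt h]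
    · push Not at h
      refine wp_while_true ?_ ?_
      · simp [hx, hs, h]
      · simp only [wp_seq, wp_setNat, NatExp.eval]
        refine (ih (x - c) (by omega) _ ?_ ?_).wp ?_
        · simp [hx, hs]
        · simp [hs]
        · rintro s' t f ⟨h1, h2⟩ ht
          have h3 : x / c = (x - c) / c + 1 := by
            conv_lhs => rw [show x = (x - c) + c by omega]
            exact Nat.add_div_right _ hc
          have h4 : (x - c) % c = x % c := (Nat.mod_eq_sub_mod h).symm
          simp [NatExp.cost, Test.cost] at h2 ⊢
          refine ⟨?_, ?_, ?_⟩
          · rw [h3]; omega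
          · rw [h1, h4]
          · rw [h2, h3]; omega

/-- One step in the computation of `project`. -/
def projectStep (card e : ℕ → ℕ) (q : ℕ × ℕ × ℕ) (v : ℕ) : ℕ × ℕ × ℕ :=
  (q.1 / card v, if e v = 1 then q.2.1 * card v else q.2.1,
    if e v = 1 then q.2.2 + q.1 % card v * q.2.1 else q.2.2)

/-- The fold keeps the part of `x` not yet divided off, the weight of the next digit in the target
numbering, and the number assembled so far. Successive division by the radices is division by their
product, which is the weight in the source numbering. -/
theorem foldl_projectStep (card b e : ℕ → ℕ) (x m : ℕ) :
    (members b m).foldl (projectStep card e) (x, 1, 0) =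
      (x / weight card b m, weight card (fun w => b w * e w) m, project card b e m x) := by
  induction m with
  | zero => simp [members, weight, project]
  | succ m ih =>
    rw [members_succ, List.foldl_append, ih]
    by_cases hb : b m = 1
    · by_cases he : e m = 1
      · simp [projectStep, weight, project, Finset.prod_range_succ, Finset.sum_range_succ, hb, he,
          Nat.div_div_eq_div_mul]
      · simp [projectStep, weight, project, Finset.prod_range_succ, Finset.sum_range_succ, hb, he,
          Nat.div_div_eq_div_mul]
    · simp [weight, project, Finset.prod_range_succ, Finset.sum_range_succ, hb]

/-- Stores in the variable `42` the value of `project` for the clique in the variable `46`,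
the assignment with the number in the variable `40`, and the set given by the bits of the array `a`
from the cell in the variable `47` on. -/
def projectOnto (a : ℕ) : Program :=
  .seq (.setNat 41 (.lit 0) (.lit 1)) <|
  .seq (.setNat 42 (.lit 0) (.lit 0)) <|
  forLoop 43 (.get 12 (.var 46)) <|
    .seq (.setNat 44 (.lit 0) (.get 11 (.add (.mul (.var 46) (.get 0 (.lit 1))) (.var 43)))) <|
    .seq (.setNat 45 (.lit 0) (.lit 0)) <|
    .seq divLoop <|
    .seq (.ite (.natEq (.get a (.add (.var 47) (.var 44))) (.lit 1))
      (.seq (.setNat 42 (.lit 0) (.add (.var 42) (.mul (.var 40) (.var 41)))) <|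
       .setNat 41 (.lit 0) (.mul (.var 41) (.get 1 (.var 44))))
      .skip) <|
    .setNat 40 (.lit 0) (.var 45)

/-- The bound on the number of steps of `projectOnto` for a list of length `k`. -/
def projectCost (k x : ℕ) : ℕ := k * (x * 30 + 100) + 20

/-- No quotient exceeds `x`, so at most `x` subtractions are spent on each of at most `m` digits;
this crude bound is good enough for the theorem. The condition `a < 30` keeps the array of bits
apart from the scratch variables. -/
theorem tr_projectOnto {a : ℕ} (ha : a < 30) {s : State} {n m c x : ℕ} {bit size : ℕ → ℕ}
    (hn : s.nat 0 1 = n) (hc : s.nat 46 0 = c) (hx : s.nat 40 0 = x)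
    (hL : Listed n n bit (s.nat 1) (s.nat 11) (s.nat 12) size c)
    (hm : s.nat 12 c ≤ m) (hpos : ∀ v < n, 0 < s.nat 1 v) :
    Tr (projectOnto a) s (projectCost m x) fun s' => s'.nat 42 0 =
      project (s.nat 1) (fun v => bit (c * n + v)) (fun v => s.nat a (s.nat 47 0 + v)) n x := by
  apply Tr.of_wp
  simp only [projectOnto, wp_seq, wp_setNat, NatExp.eval]
  set st := projectStep (s.nat 1) (fun v => s.nat a (s.nat 47 0 + v)) with hst
  refine (Tr.forLoop (s.nat 12 c) (x * 30 + 80) (fun j s' => s'.nat 40 0 ≤ x ∧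
    (s'.nat 40 0, s'.nat 41 0, s'.nat 42 0) =
      ((List.range j).map fun j => s.nat 11 (c * n + j)).foldl st (x, 1, 0)) rfl
    (fun s' f => ?_) ?_ ?_).wp ?_
  · simp [f.nat 46 rfl, f.nat 12 rfl, hc]
  · simp [hx]
  · intro j hj s1 f1 hj1 ⟨hle, hI⟩
    have ea := f1.nat a (by simp [forLoop, Program.keepsNat, divLoop]; omega)
    have e0 := f1.nat 0 rfl
    have e1 := f1.nat 1 rfl
    have e11 := f1.nat 11 rfl
    have e46 := f1.nat 46 rfl
    have e47 := f1.nat 47 rfl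
    simp [show a ≠ 41 by omega, show a ≠ 42 by omega] at ea e0 e1 e11 e46 e47
    apply Tr.of_wp
    simp only [wp_seq, wp_setNat, NatExp.eval]
    set v := s.nat 11 (c * n + j) with hv
    have hvn : v < n := by
      have : v ∈ members (fun v => bit (c * n + v)) n := by
        rw [← hL.list_eq]
        exact List.mem_map.2 ⟨j, List.mem_range.2 hj, rfl⟩
      simp only [members, List.mem_filter, List.mem_range] at this
      exact this.1
    refine (tr_divLoop (hpos v hvn) (s1.nat 40 0) _ (by simp) ?_).wp ?_
    · simp [e1, e11, e46, e0, hc, hn, hj1, hv]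
    · rintro s2 t f2 ⟨h40, h45⟩ ht
      have ea' := f2.nat a (by simp [Program.keepsNat, divLoop]; omega)
      have e1' := f2.nat 1 rfl
      have e41 := f2.nat 41 rfl
      have e42 := f2.nat 42 rfl
      have e47' := f2.nat 47 rfl
      have e44 := congrFun (f2.nat 44 rfl) 0
      simp [show a ≠ 44 by omega, show a ≠ 45 by omega, ea, e0, e1, e11, e46, e47, hc, hn, hj1,
        ← hv] at ea' e1' e41 e42 e47' e44 h45
      have hdle : s1.nat 40 0 / s.nat 1 v ≤ x := (Nat.div_le_self _ _).trans hle
      rw [List.range_succ, List.map_append, List.foldl_append, ← hI]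
      by_cases hb : s.nat a (s.nat 47 0 + v) = 1
      · simp [ea', e1', e41, e42, e47', e44, hb, h45, h40, NatExp.cost, Test.cost, hst, ← hv,
          projectStep, hdle]
        omega
      · simp [ea', e41, e42, e47', e44, hb, h45, NatExp.cost, Test.cost, hst, ← hv,
          projectStep, hdle]
        omega
  · rintro s1 t f1 ⟨-, hI⟩ ht
    rw [hL.list_eq, hst, foldl_projectStep, Prod.mk.injEq, Prod.mk.injEq] at hI
    refine ⟨?_, hI.2.2⟩
    simp only [NatExp.cost, projectCost] at ht ⊢
    have : s.nat 12 c * (x * 30 + 80 + (1 + 1 + 1) + 10) ≤ m * (x * 30 + 100) :=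
      Nat.mul_le_mul hm (by omega)
    omega

end RealRAM

/-! ### Filling tables; families and last decision variables -/

namespace RealRAM

/-- A loop that fills the cells `base + c`, for `c < C`, of one array. -/
theorem Tr.row {α : Type*} (g : State → ℕ → α) {i : ℕ} {b : NatExp} {body : Program} {s : State}
    (C B base : ℕ) (V : ℕ → α) (hk : body.keepsNat i = true)
    (hg : ∀ s x, g (s.setNat i 0 x) = g s)
    (hb : ∀ s', Frame (RealRAM.forLoop i b body) s s' → b.eval s' = C)
    (hstep : ∀ c < C, ∀ s', Frame (RealRAM.forLoop i b body) s s' → s'.nat i 0 = c →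
      g s' (base + c) = g s (base + c) →
      Tr body s' B fun s'' => g s'' = Function.update (g s') (base + c) (V c)) :
    Tr (RealRAM.forLoop i b body) s (C * (B + b.cost + 10) + b.cost + 7) fun s' =>
      (∀ c < C, g s' (base + c) = V c) ∧ ∀ t, (∀ c < C, t ≠ base + c) → g s' t = g s t := by
  refine Tr.forLoop C B (fun j s' =>
    (∀ c < j, g s' (base + c) = V c) ∧ ∀ t, (∀ c < j, t ≠ base + c) → g s' t = g s t)
    hk hb ?_ ?_
  · simp [hg]
  -- The body may use that the cell `base + c` still has its original value, so that rows can be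
  -- updated in place.
  · intro c hc s' f hi ⟨h1, h2⟩
    refine (hstep c hc s' f hi (h2 _ fun c' hc' => by omega)).mono le_rfl ?_
    intro s'' _ h
    rw [hg, h]
    refine ⟨fun c' hc' => ?_, fun t ht => ?_⟩
    · rcases Nat.lt_succ_iff_lt_or_eq.1 hc' with hc' | rfl
      · rw [Function.update_of_ne (by omega), h1 c' hc']
      · simp
    · rw [Function.update_of_ne (ht c (by omega))]
      exact h2 t fun c' hc' => ht c' (by omega)

/-- A loop that fills a table row by row. -/
theorem Tr.table_at {α : Type*} (g : State → ℕ → α) {i : ℕ} {b : NatExp} {body : Program}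
    {s : State} (R C B base : ℕ) (V : ℕ → ℕ → α) (hk : body.keepsNat i = true)
    (hg : ∀ s x, g (s.setNat i 0 x) = g s)
    (hb : ∀ s', Frame (RealRAM.forLoop i b body) s s' → b.eval s' = R)
    (hstep : ∀ r < R, ∀ s', Frame (RealRAM.forLoop i b body) s s' → s'.nat i 0 = r →
      Tr body s' B fun s'' => (∀ c < C, g s'' (base + (r * C + c)) = V r c) ∧
        ∀ t, (∀ c < C, t ≠ base + (r * C + c)) → g s'' t = g s' t) :
    Tr (RealRAM.forLoop i b body) s (R * (B + b.cost + 10) + b.cost + 7) fun s' =>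
      (∀ r < R, ∀ c < C, g s' (base + (r * C + c)) = V r c) ∧
      ∀ t, (∀ r < R, ∀ c < C, t ≠ base + (r * C + c)) → g s' t = g s t := by
  refine Tr.forLoop R B (fun j s' => (∀ r < j, ∀ c < C, g s' (base + (r * C + c)) = V r c) ∧
    ∀ t, (∀ r < j, ∀ c < C, t ≠ base + (r * C + c)) → g s' t = g s t) hk hb ?_ ?_
  · simp [hg]
  · intro r hr s' f hi ⟨h1, h2⟩
    refine (hstep r hr s' f hi).mono le_rfl ?_
    intro s'' _ h
    rw [hg]
    refine ⟨fun r' hr' c hc => ?_, fun t ht => ?_⟩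
    · rcases Nat.lt_succ_iff_lt_or_eq.1 hr' with hr' | rfl
      · rw [h.2 _ fun c' hc' => ?_, h1 r' hr' c hc]
        rw [ne_eq, Nat.add_left_cancel_iff, row_major_inj hc hc']
        omega
      · exact h.1 c hc
    · rw [h.2 t fun c hc => ht r (by omega) c hc]
      exact h2 t fun r' hr' c hc => ht r' (by omega) c hc

theorem Tr.table {α : Type*} (g : State → ℕ → α) {i : ℕ} {b : NatExp} {body : Program} {s : State}
    (R C B : ℕ) (V : ℕ → ℕ → α) (hk : body.keepsNat i = true)
    (hg : ∀ s x, g (s.setNat i 0 x) = g s)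
    (hb : ∀ s', Frame (RealRAM.forLoop i b body) s s' → b.eval s' = R)
    (hstep : ∀ r < R, ∀ s', Frame (RealRAM.forLoop i b body) s s' → s'.nat i 0 = r →
      Tr body s' B fun s'' => (∀ c < C, g s'' (r * C + c) = V r c) ∧
        ∀ t, (∀ c < C, t ≠ r * C + c) → g s'' t = g s' t) :
    Tr (RealRAM.forLoop i b body) s (R * (B + b.cost + 10) + b.cost + 7) fun s' =>
      ∀ r < R, ∀ c < C, g s' (r * C + c) = V r c := by
  refine (Tr.table_at g R C B 0 V hk hg hb ?_).mono le_rfl fun s' _ h => by simpa using h.1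
  simpa using hstep

theorem loop_cost_le {m B c B' K : ℕ} (hB : B + c + 10 ≤ B') (hK : c + 7 ≤ K) :
    m * (B + c + 10) + c + 7 ≤ m * B' + K := by
  have := Nat.mul_le_mul_left m hB
  omega

theorem projectCost_mono {k x x' : ℕ} (h : x ≤ x') : projectCost k x ≤ projectCost k x' := by
  simp only [projectCost]; gcongr

/-- The families of the variables, as bits in the array `19`. -/
def listFamilies : Program :=
  .seq (forLoop 30 (.mul (.get 0 (.lit 1)) (.get 0 (.lit 1))) <|
    .setNat 19 (.var 30) (.get 3 (.var 30))) <|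
  forLoop 30 (.get 0 (.lit 1)) <|
    .setNat 19 (.add (.mul (.var 30) (.get 0 (.lit 1))) (.var 30)) (.lit 1)

theorem tr_listFamilies {s : State} {n : ℕ} (hn : s.nat 0 1 = n) :
    Tr listFamilies s (n * n * 30 + n * 30 + 40) fun s' => ∀ v < n, ∀ w < n,
      s'.nat 19 (v * n + w) = if v = w then 1 else s.nat 3 (v * n + w) := by
  apply Tr.of_wp
  rw [listFamilies, wp_seq]
  refine (Tr.row (fun s => s.nat 19) (n * n) 10 0 (s.nat 3) rfl (by simp)
    (fun s' f => by simp [f.nat 0 rfl, hn]) ?_).wp ?_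
  · intro c hc s' f hi _
    apply Tr.of_wp
    simp [hi, f.nat 3 rfl, NatExp.cost]
  · rintro s1 t1 f1 ⟨h1, -⟩ ht1
    refine (Tr.forLoop n 15 (fun j s' => ∀ v < n, ∀ w < n, s'.nat 19 (v * n + w) =
      if v = w ∧ v < j then 1 else s.nat 3 (v * n + w)) rfl
      (fun s' f => by simp [f.nat 0 rfl, f1.nat 0 rfl, hn]) ?_ ?_).wp ?_
    · intro v hv w hw
      have : v * n + w < n * n := by nlinarith
      simpa using h1 _ this
    · intro j hj s2 f2 hi hI
      apply Tr.of_wp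
      simp [hi, f2.nat 0 rfl, f1.nat 0 rfl, hn, NatExp.cost]
      intro v hv w hw
      by_cases hvj : v = j
      · subst hvj
        by_cases hwv : w = v
        · subst hwv; simp
        · rw [Function.update_of_ne (by omega), hI v hv w hw, if_neg (by omega), if_neg (by omega)]
      · rw [Function.update_of_ne, hI v hv w hw]
        · congr 1; rw [eq_iff_iff]; omega
        · rw [ne_eq, row_major_inj hw hj]; omega
    · intro s' t f h ht
      refine ⟨?_, fun v hv w hw => ?_⟩
      · simp [NatExp.cost] at ht1 ht; omega
      · rw [h v hv w hw]
        congr 1; rw [eq_iff_iff]; omega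

/-- The entry of `last` for the owner of `v` is the successor of a decision variable of the same
owner that comes after `v` or is `v`. -/
structure LastDecision (n : ℕ) (owner par last : ℕ → ℕ) (v : ℕ) : Prop where
  ne_zero : last (owner v - 1) ≠ 0
  lt : last (owner v - 1) - 1 < n
  owner_eq : owner (last (owner v - 1) - 1) = owner v
  family_subset : ∀ x < n, x = v ∨ par (v * n + x) = 1 →
    x = last (owner v - 1) - 1 ∨ par ((last (owner v - 1) - 1) * n + x) = 1

/-- The successor of the index of the last decision variable of each agent in the array `20`. -/
def findLast : Program :=
  forLoop 30 (.get 0 (.lit 1)) <|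
    .ite (.natEq (.get 2 (.var 30)) (.lit 0)) .skip <|
    .ite (.natEq (.get 20 (.sub (.get 2 (.var 30)) (.lit 1))) (.lit 0))
      (.setNat 20 (.sub (.get 2 (.var 30)) (.lit 1)) (.add (.var 30) (.lit 1))) <|
    .ite (.natEq (.get 3 (.add (.mul (.var 30) (.get 0 (.lit 1)))
        (.sub (.get 20 (.sub (.get 2 (.var 30)) (.lit 1))) (.lit 1)))) (.lit 1))
      (.setNat 20 (.sub (.get 2 (.var 30)) (.lit 1)) (.add (.var 30) (.lit 1)))
      .skip

/-- For each agent a candidate for the last decision is kept, stored plus one so that `0` means that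
there is none yet; owners are shifted in the same way. By perfect recall the candidate and the next
decision variable of the agent are comparable, and the later of the two is kept. It has in its
family the families of all decision variables of the agent met so far. -/
theorem tr_findLast {s : State} {n : ℕ} (hn : s.nat 0 1 = n) (h20 : s.nat 20 = fun _ => 0)
    (hanti : ∀ v < n, ∀ w < n, s.nat 3 (v * n + w) = 1 → s.nat 3 (w * n + v) ≠ 1)
    (hrec : ∀ v < n, ∀ w < n, s.nat 2 v = s.nat 2 w → s.nat 2 v ≠ 0 → v ≠ w →
      (∀ x < n, x = v ∨ s.nat 3 (v * n + x) = 1 → s.nat 3 (w * n + x) = 1) ∨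
      (∀ x < n, x = w ∨ s.nat 3 (w * n + x) = 1 → s.nat 3 (v * n + x) = 1)) :
    Tr findLast s (n * 100 + 10) fun s' => ∀ v < n, s.nat 2 v ≠ 0 →
      LastDecision n (s.nat 2) (s.nat 3) (s'.nat 20) v := by
  refine (Tr.forLoop n 80 (fun j s' =>
    (∀ v < j, s.nat 2 v ≠ 0 → LastDecision n (s.nat 2) (s.nat 3) (s'.nat 20) v) ∧
    ∀ k, s'.nat 20 k ≠ 0 → s'.nat 20 k - 1 < j ∧ s.nat 2 (s'.nat 20 k - 1) = k + 1) rfl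
    (fun s' f => by simp [f.nat 0 rfl, hn]) ?_ ?_).mono ?_ fun _ _ h => h.1
  · simp [h20]
  · intro j hj s1 f1 hi ⟨h1, h2⟩
    have e0 := f1.nat 0 rfl
    have e2 := f1.nat 2 rfl
    have e3 := f1.nat 3 rfl
    have keep : (s.nat 2 j ≠ 0 → LastDecision n (s.nat 2) (s.nat 3) (s1.nat 20) j) →
        (∀ v < j + 1, s.nat 2 v ≠ 0 → LastDecision n (s.nat 2) (s.nat 3) (s1.nat 20) v) ∧
        ∀ k, s1.nat 20 k ≠ 0 → s1.nat 20 k - 1 < j + 1 ∧ s.nat 2 (s1.nat 20 k - 1) = k + 1 := by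
      intro h
      refine ⟨fun v hv => ?_, fun k hk => ⟨by have := (h2 k hk).1; omega, (h2 k hk).2⟩⟩
      rcases Nat.lt_succ_iff_lt_or_eq.1 hv with hv | rfl
      · exact h1 v hv
      · exact h
    have write : s.nat 2 j ≠ 0 → (∀ v < j, s.nat 2 v = s.nat 2 j →
          ∀ x < n, x = v ∨ s.nat 3 (v * n + x) = 1 → x = j ∨ s.nat 3 (j * n + x) = 1) →
        (∀ v < j + 1, s.nat 2 v ≠ 0 → LastDecision n (s.nat 2) (s.nat 3)
          (Function.update (s1.nat 20) (s.nat 2 j - 1) (j + 1)) v) ∧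
        ∀ k, Function.update (s1.nat 20) (s.nat 2 j - 1) (j + 1) k ≠ 0 →
          Function.update (s1.nat 20) (s.nat 2 j - 1) (j + 1) k - 1 < j + 1 ∧
          s.nat 2 (Function.update (s1.nat 20) (s.nat 2 j - 1) (j + 1) k - 1) = k + 1 := by
      intro hj0 h
      refine ⟨fun v hv hv0 => ?_, fun k hk => ?_⟩
      · by_cases hvj : s.nat 2 v = s.nat 2 j
        · refine ⟨?_, ?_, ?_, ?_⟩
          all_goals simp only [hvj, Function.update_self, Nat.add_sub_cancel]
          · omega
          · exact hj
          · rcases Nat.lt_succ_iff_lt_or_eq.1 hv with hv | rfl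
            · exact h v hv hvj
            · exact fun _ _ h => h
        · have hv' : v < j := by
            rcases Nat.lt_succ_iff_lt_or_eq.1 hv with hv | rfl
            · exact hv
            · exact absurd rfl hvj
          have hne : s.nat 2 v - 1 ≠ s.nat 2 j - 1 := by omega
          obtain ⟨a1, a2, a3, a4⟩ := h1 v hv' hv0
          refine ⟨?_, ?_, ?_, ?_⟩
          all_goals simp only [Function.update_of_ne hne]
          · exact a1
          · exact a2
          · exact a3
          · exact a4
      · by_cases hkj : k = s.nat 2 j - 1
        · subst hkj; simp; omega
        · rw [Function.update_of_ne hkj] at hk ⊢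
          exact ⟨by have := (h2 k hk).1; omega, (h2 k hk).2⟩
    apply Tr.of_wp
    by_cases hj0 : s.nat 2 j = 0
    · simp [hi, e2, hj0, NatExp.cost, Test.cost]
      simpa using keep (fun h => absurd hj0 h)
    · by_cases hl : s1.nat 20 (s.nat 2 j - 1) = 0
      · simp [hi, e2, hj0, hl, NatExp.cost, Test.cost]
        have := write hj0 fun v hv hvj => by
          have := (h1 v hv (by omega)).ne_zero
          rw [hvj] at this
          exact absurd hl this
        simpa using this
      · have hlt := h2 _ hl
        have hne : s1.nat 20 (s.nat 2 j - 1) - 1 ≠ j := by omega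
        have hown : s.nat 2 (s1.nat 20 (s.nat 2 j - 1) - 1) = s.nat 2 j := by omega
        have hr := hrec j hj _ (by omega) hown.symm hj0 hne.symm
        by_cases hp : s.nat 3 (j * n + (s1.nat 20 (s.nat 2 j - 1) - 1)) = 1
        · simp [hi, e2, e0, e3, hn, hj0, hl, hp, NatExp.cost, Test.cost]
          have := write hj0 fun v hv hvj x hx hxv => by
            have h4 := (h1 v hv (by omega)).family_subset x hx hxv
            rw [hvj] at h4
            -- The old candidate is a parent of `j` by `hp`. By acyclicity, in the form `hanti`, the
            -- variable `j` is not a parent of the candidate, which leaves one alternative of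
            -- perfect recall.
            rcases hr with hr | hr
            · exact absurd (hr j hj (.inl rfl)) (hanti _ hj _ (by omega) hp)
            · exact .inr (hr x hx h4)
          simpa using this
        · simp [hi, e2, e0, e3, hn, hj0, hl, hp, NatExp.cost, Test.cost]
          have := keep fun _ => ⟨hl, by omega, hown, fun x hx hxv => .inr <| by
            rcases hr with hr | hr
            · exact hr x hx hxv
            · exact absurd (hr _ (by omega) (.inl rfl)) hp⟩
          simpa using this
  · simp [NatExp.cost]; omega

end RealRAM

/-! ### Index tables, kernels on the edges and evidence matrices -/

namespace RealRAM

/-- For each variable `v`, the numbers of the restrictions of the assignments to the clique of `v` to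
the family of `v`, in the array `22`. -/
def indexFamilies : Program :=
  forLoop 30 (.get 0 (.lit 1)) <|
    .seq (.setNat 46 (.lit 0) (.get 9 (.var 30))) <|
    .seq (.setNat 47 (.lit 0) (.mul (.var 30) (.get 0 (.lit 1)))) <|
    forLoop 31 (.get 0 (.lit 4)) <|
      .seq (.setNat 40 (.lit 0) (.var 31)) <|
      .seq (projectOnto 19) <|
      .setNat 22 (.add (.mul (.var 30) (.get 0 (.lit 4))) (.var 31)) (.var 42)

theorem tr_indexFamilies {s : State} {n ℓ d m : ℕ} {bit size : ℕ → ℕ}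
    (hn : s.nat 0 1 = n) (hd : s.nat 0 4 = d) (hhome : ∀ v < n, s.nat 9 v < ℓ)
    (hL : ∀ c < ℓ, Listed n n bit (s.nat 1) (s.nat 11) (s.nat 12) size c)
    (hm : ∀ c < ℓ, s.nat 12 c ≤ m) (hpos : ∀ v < n, 0 < s.nat 1 v) :
    Tr indexFamilies s (n * (d * (projectCost m d + 50) + 50) + 20) fun s' =>
      ∀ v < n, ∀ x < d, s'.nat 22 (v * d + x) = project (s.nat 1)
        (fun w => bit (s.nat 9 v * n + w)) (fun w => s.nat 19 (v * n + w)) n x := by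
  refine (Tr.table (fun s => s.nat 22) n d (d * (projectCost m d + 50) + 30) (fun v x =>
    project (s.nat 1) (fun w => bit (s.nat 9 v * n + w)) (fun w => s.nat 19 (v * n + w)) n x)
    rfl (by simp) (fun s' f => by simp [f.nat 0 rfl, hn]) ?_).mono ?_ fun _ _ h => h
  · intro v hv s1 f1 hi
    have e0 := f1.nat 0 rfl
    have e1 := f1.nat 1 rfl
    have e9 := f1.nat 9 rfl
    have e11 := f1.nat 11 rfl
    have e12 := f1.nat 12 rfl
    have e19 := f1.nat 19 rfl
    apply Tr.of_wp
    simp only [wp_seq, wp_setNat, NatExp.eval]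
    refine (Tr.row (fun s => s.nat 22) d (projectCost m d + 30) (v * d) (fun x =>
      project (s.nat 1) (fun w => bit (s.nat 9 v * n + w)) (fun w => s.nat 19 (v * n + w)) n x)
      rfl (by simp) (fun s' f => by simp [f.nat 0 rfl, e0, hd]) ?_).wp ?_
    · intro x hx s2 f2 hi2 _
      have e0' := f2.nat 0 rfl
      have e1' := f2.nat 1 rfl
      have e11' := f2.nat 11 rfl
      have e12' := f2.nat 12 rfl
      have e19' := f2.nat 19 rfl
      have e30 := f2.nat 30 rfl
      have e46 := congrFun (f2.nat 46 rfl) 0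
      have e47 := congrFun (f2.nat 47 rfl) 0
      simp [e0, e1, e9, e11, e12, e19, hi, hn] at e0' e1' e11' e12' e19' e30 e46 e47
      apply Tr.of_wp
      simp only [wp_seq, wp_setNat, NatExp.eval]
      refine (tr_projectOnto (a := 19) (n := n) (m := m) (c := s.nat 9 v) (x := x) (bit := bit) (size := size)
        (by norm_num) (by simp [e0', hn]) (by simp [e46]) (by simp [hi2])
        (by simpa [e1', e11', e12'] using hL _ (hhome v hv))
        (by simpa [e12'] using hm _ (hhome v hv)) (by simpa [e1'] using hpos)).wp ?_
      intro s3 t f3 h3 ht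
      have e0'' := f3.nat 0 rfl
      have e22 := f3.nat 22 rfl
      have e30' := f3.nat 30 rfl
      have e31 := f3.nat 31 rfl
      simp [e0', e1', e19', e30, e47] at e0'' e30' h3 e22 e31
      have := projectCost_mono (k := m) hx.le
      simp [h3, e0'', e30', e31, e22, hi, hi2, hd, NatExp.cost]
      omega
    · intro s2 t f2 h2 ht
      simp [NatExp.cost] at ht h2 ⊢
      refine ⟨?_, h2⟩
      have : d * (projectCost m d + 30 + 2 + 10) ≤ d * (projectCost m d + 50) :=
        Nat.mul_le_mul_left _ (by omega)
      omega
  · exact loop_cost_le (by simp [NatExp.cost]) (by simp [NatExp.cost])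

/-- For each position of the search order but the first, the numbers of the restrictions of
the assignments to its clique and to the clique of its parent to the intersection of both,
in the arrays `23` and `24`. -/
def indexEdges : Program :=
  forLoop 30 (.get 0 (.lit 3)) <|
    forLoop 31 (.get 0 (.lit 4)) <|
      .seq (.setNat 46 (.lit 0) (.get 14 (.var 30))) <|
      .seq (.setNat 47 (.lit 0) (.mul (.get 14 (.get 16 (.var 30))) (.get 0 (.lit 1)))) <|
      .seq (.setNat 40 (.lit 0) (.var 31)) <|
      .seq (projectOnto 7) <|
      .seq (.setNat 23 (.add (.mul (.var 30) (.get 0 (.lit 4))) (.var 31)) (.var 42)) <|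
      .seq (.setNat 46 (.lit 0) (.get 14 (.get 16 (.var 30)))) <|
      .seq (.setNat 47 (.lit 0) (.mul (.get 14 (.var 30)) (.get 0 (.lit 1)))) <|
      .seq (.setNat 40 (.lit 0) (.var 31)) <|
      .seq (projectOnto 7) <|
      .setNat 24 (.add (.mul (.var 30) (.get 0 (.lit 4))) (.var 31)) (.var 42)

theorem tr_indexEdges {s : State} {n ℓ d m : ℕ} {size : ℕ → ℕ}
    (hn : s.nat 0 1 = n) (hl : s.nat 0 3 = ℓ) (hd : s.nat 0 4 = d)
    (hord : ∀ t < ℓ, s.nat 14 t < ℓ) (hpar : ∀ t < ℓ, s.nat 16 t < ℓ)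
    (hL : ∀ c < ℓ, Listed n n (s.nat 7) (s.nat 1) (s.nat 11) (s.nat 12) size c)
    (hm : ∀ c < ℓ, s.nat 12 c ≤ m) (hpos : ∀ v < n, 0 < s.nat 1 v) :
    Tr indexEdges s (ℓ * (d * (projectCost m d * 2 + 100) + 30) + 20) fun s' =>
      ∀ t < ℓ, ∀ x < d, (s'.nat 23 (t * d + x), s'.nat 24 (t * d + x)) =
        (project (s.nat 1) (fun w => s.nat 7 (s.nat 14 t * n + w))
          (fun w => s.nat 7 (s.nat 14 (s.nat 16 t) * n + w)) n x,
        project (s.nat 1) (fun w => s.nat 7 (s.nat 14 (s.nat 16 t) * n + w))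
          (fun w => s.nat 7 (s.nat 14 t * n + w)) n x) := by
  -- The two arrays are treated as one array of pairs, so that a single table argument covers both.
  refine (Tr.table (fun s i => (s.nat 23 i, s.nat 24 i)) ℓ d (d * (projectCost m d * 2 + 100) + 15)
    (fun t x => (project (s.nat 1) (fun w => s.nat 7 (s.nat 14 t * n + w))
          (fun w => s.nat 7 (s.nat 14 (s.nat 16 t) * n + w)) n x,
        project (s.nat 1) (fun w => s.nat 7 (s.nat 14 (s.nat 16 t) * n + w))
          (fun w => s.nat 7 (s.nat 14 t * n + w)) n x))
    rfl (by simp) (fun s' f => by simp [f.nat 0 rfl, hl]) ?_).mono ?_ fun _ _ h => h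
  · intro u hu s1 f1 hi
    refine (Tr.row (fun s i => (s.nat 23 i, s.nat 24 i)) d (projectCost m d * 2 + 80) (u * d)
      (fun x => _) rfl (by simp)
      (fun s' f => by simp [f.nat 0 rfl, f1.nat 0 rfl, hd]) ?_).mono ?_ fun _ _ h => h
    · intro x hx s2 f2 hi2 _
      have e0 := (f2.nat 0 rfl).trans (f1.nat 0 rfl)
      have e1 := (f2.nat 1 rfl).trans (f1.nat 1 rfl)
      have e7 := (f2.nat 7 rfl).trans (f1.nat 7 rfl)
      have e11 := (f2.nat 11 rfl).trans (f1.nat 11 rfl)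
      have e12 := (f2.nat 12 rfl).trans (f1.nat 12 rfl)
      have e14 := (f2.nat 14 rfl).trans (f1.nat 14 rfl)
      have e16 := (f2.nat 16 rfl).trans (f1.nat 16 rfl)
      have e30 := f2.nat 30 rfl
      apply Tr.of_wp
      simp only [wp_seq, wp_setNat, NatExp.eval]
      refine (tr_projectOnto (a := 7) (n := n) (m := m) (c := s.nat 14 u) (x := x) (bit := s.nat 7)
        (size := size)
        (by norm_num) (by simp [e0, hn]) (by simp [e14, e30, hi]) (by simp [hi2])
        (by simpa [e1, e11, e12] using hL _ (hord u hu))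
        (by simpa [e12] using hm _ (hord u hu)) (by simpa [e1] using hpos)).wp ?_
      intro s3 t3 f3 h3 ht3
      have g0 := f3.nat 0 rfl
      have g1 := f3.nat 1 rfl
      have g7 := f3.nat 7 rfl
      have g11 := f3.nat 11 rfl
      have g12 := f3.nat 12 rfl
      have g14 := f3.nat 14 rfl
      have g16 := f3.nat 16 rfl
      have g23 := f3.nat 23 rfl
      have g24 := f3.nat 24 rfl
      have g30 := f3.nat 30 rfl
      have g31 := f3.nat 31 rfl
      simp [e0, e1, e7, e11, e12, e14, e16, e30, hi, hn]
        at g0 g1 g7 g11 g12 g14 g16 g23 g24 g30 g31 h3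
      simp only [wp_seq, wp_setNat, NatExp.eval]
      refine (tr_projectOnto (a := 7) (n := n) (m := m) (c := s.nat 14 (s.nat 16 u)) (x := x)
        (bit := s.nat 7) (size := size)
        (by norm_num) (by simp [g0, hn]) (by simp [g14, g30, g16, hi]) (by simp [g31, hi2])
        (by simpa [g1, g11, g12] using hL _ (hord _ (hpar u hu)))
        (by simpa [g12] using hm _ (hord _ (hpar u hu))) (by simpa [g1] using hpos)).wp ?_
      intro s4 t4 f4 h4 ht4
      have k0 := f4.nat 0 rfl
      have k23 := f4.nat 23 rfl
      have k24 := f4.nat 24 rfl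
      have k30 := f4.nat 30 rfl
      have k31 := f4.nat 31 rfl
      simp [g0, g1, g7, g14, g30, g31, g23, g24, hi, hn, hi2, h3, hd] at k0 k23 k24 k30 k31 h4
      have := projectCost_mono (k := m) hx.le
      simp only [wp_setNat, NatExp.eval]
      refine ⟨?_, ?_⟩
      · simp [NatExp.cost]; omega
      · funext i
        simp only [State.setNat_nat_self, k0, k23, k24, k30, k31, hi, hi2, hd, h4,
          State.setNat_nat_of_ne, ne_eq, Nat.reduceEqDiff, not_false_eq_true, Function.update_apply]
        by_cases hi' : i = u * d + x <;> simp [hi']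
    · exact loop_cost_le (by simp [NatExp.cost]) (by simp [NatExp.cost])
  · exact loop_cost_le (by simp [NatExp.cost]) (by simp [NatExp.cost])

/-- The matrices of zeros and ones that tell whether an assignment to a clique and an assignment to
the clique of its parent agree, in the real array `5`. -/
def tabulateKernel : Program :=
  forLoop 30 (.get 0 (.lit 3)) <|
    forLoop 31 (.get 0 (.lit 4)) <|
      forLoop 32 (.get 0 (.lit 4)) <|
        .ite (.natEq (.get 23 (.add (.mul (.var 30) (.get 0 (.lit 4))) (.var 31)))
            (.get 24 (.add (.mul (.var 30) (.get 0 (.lit 4))) (.var 32))))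
          (.setReal 5 (.add (.mul (.var 30) (.mul (.get 0 (.lit 4)) (.get 0 (.lit 4))))
            (.add (.mul (.var 31) (.get 0 (.lit 4))) (.var 32))) .one)
          (.setReal 5 (.add (.mul (.var 30) (.mul (.get 0 (.lit 4)) (.get 0 (.lit 4))))
            (.add (.mul (.var 31) (.get 0 (.lit 4))) (.var 32))) .zero)

theorem add_lt_mul_self {x y d : ℕ} (hx : x < d) (hy : y < d) : x * d + y < d * d := by nlinarith

theorem tr_tabulateKernel {s : State} {ℓ d : ℕ} (hl : s.nat 0 3 = ℓ) (hd : s.nat 0 4 = d) :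
    Tr tabulateKernel s (ℓ * (d * (d * 80 + 30) + 30) + 10) fun s' =>
      ∀ t < ℓ, ∀ x < d, ∀ y < d, s'.real 5 (t * (d * d) + (x * d + y)) =
        if s.nat 23 (t * d + x) = s.nat 24 (t * d + y) then 1 else 0 := by
  refine (Tr.forLoop ℓ (d * (d * 80 + 30) + 10) (fun j s' => ∀ t < j, ∀ x < d, ∀ y < d,
    s'.real 5 (t * (d * d) + (x * d + y)) =
        if s.nat 23 (t * d + x) = s.nat 24 (t * d + y) then 1 else 0) rfl
    (fun s' f => by simp [f.nat 0 rfl, hl]) (by simp) ?_).mono ?_ fun _ _ h => h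
  · intro t ht s1 f1 hi hI
    have e0 := f1.nat 0 rfl
    refine (Tr.table_at (fun s => s.real 5) d d (d * 80 + 15) (t * (d * d))
      (fun x y => if s.nat 23 (t * d + x) = s.nat 24 (t * d + y) then (1 : ℝ) else 0) rfl (by simp)
      (fun s' f => by simp [f.nat 0 rfl, e0, hd]) ?_).mono ?_ ?_
    · intro x hx s2 f2 hi2
      refine (Tr.row (fun s => s.real 5) d 65 (t * (d * d) + x * d)
        (fun y => if s.nat 23 (t * d + x) = s.nat 24 (t * d + y) then (1 : ℝ) else 0) rfl (by simp)
        (fun s' f => by simp [f.nat 0 rfl, f2.nat 0 rfl, e0, hd]) ?_).mono ?_ ?_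
      · intro y hy s3 f3 hi3 _
        have e0' := (f3.nat 0 rfl).trans <| (f2.nat 0 rfl).trans <| f1.nat 0 rfl
        have e23 := (f3.nat 23 rfl).trans <| (f2.nat 23 rfl).trans <| f1.nat 23 rfl
        have e24 := (f3.nat 24 rfl).trans <| (f2.nat 24 rfl).trans <| f1.nat 24 rfl
        have e30 := (f3.nat 30 rfl).trans (f2.nat 30 rfl)
        have e31 := f3.nat 31 rfl
        apply Tr.of_wp
        by_cases h : s.nat 23 (t * d + x) = s.nat 24 (t * d + y) <;>
        simp [e0', e23, e24, e30, e31, hi, hi2, hi3, hd, h, NatExp.cost, RealExp.cost, Test.cost,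
          Nat.add_assoc]
      · simp [NatExp.cost]; omega
      · intro s3 f3 h
        simpa only [Nat.add_assoc] using h
    · exact loop_cost_le (by simp [NatExp.cost]) (by simp [NatExp.cost])
    · intro s2 f2 h t' ht' x hx y hy
      rw [State.setNat_real]
      rcases Nat.lt_succ_iff_lt_or_eq.1 ht' with ht' | rfl
      · rw [h.2, hI t' ht' x hx y hy]
        intro x' hx' y' hy'
        rw [ne_eq, row_major_inj (add_lt_mul_self hx hy) (add_lt_mul_self hx' hy')]
        omega
      · exact h.1 x hx y hy
  · exact loop_cost_le (by simp [NatExp.cost]) (by simp [NatExp.cost])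

/-- The matrices of zeros and ones that tell whether the restriction of an assignment to the clique of
a variable to the family of this variable has a given number, in the real array `6`. -/
def tabulateEvidence : Program :=
  forLoop 30 (.mul (.get 0 (.lit 1)) (.get 0 (.lit 4))) <|
    forLoop 31 (.get 0 (.lit 4)) <|
      .ite (.natEq (.get 22 (.var 30)) (.var 31))
        (.setReal 6 (.add (.mul (.var 30) (.get 0 (.lit 4))) (.var 31)) .one)
        (.setReal 6 (.add (.mul (.var 30) (.get 0 (.lit 4))) (.var 31)) .zero)

theorem tr_tabulateEvidence {s : State} {n d : ℕ} (hn : s.nat 0 1 = n) (hd : s.nat 0 4 = d) :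
    Tr tabulateEvidence s (n * d * (d * 50 + 40) + 20) fun s' =>
      ∀ r < n * d, ∀ h < d, s'.real 6 (r * d + h) = if s.nat 22 r = h then 1 else 0 := by
  refine (Tr.table (fun s => s.real 6) (n * d) d (d * 50 + 20)
    (fun r h => if s.nat 22 r = h then (1 : ℝ) else 0) rfl (by simp)
    (fun s' f => by simp [f.nat 0 rfl, hn, hd]) ?_).mono ?_ fun _ _ h => h
  · intro r hr s1 f1 hi
    refine (Tr.row (fun s => s.real 6) d 35 (r * d)
      (fun h => if s.nat 22 r = h then (1 : ℝ) else 0) rfl (by simp)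
      (fun s' f => by simp [f.nat 0 rfl, f1.nat 0 rfl, hd]) ?_).mono ?_ fun _ _ h => h
    · intro h hh s2 f2 hi2 _
      have e0 := (f2.nat 0 rfl).trans (f1.nat 0 rfl)
      have e22 := (f2.nat 22 rfl).trans (f1.nat 22 rfl)
      have e30 := f2.nat 30 rfl
      apply Tr.of_wp
      by_cases h' : s.nat 22 r = h <;>
      simp [e0, e22, e30, hi, hi2, hd, h', NatExp.cost, RealExp.cost, Test.cost]
    · simp [NatExp.cost]; omega
  · simp [NatExp.cost]
    have : n * d * (d * 50 + 20 + 5 + 10) ≤ n * d * (d * 50 + 40) :=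
      Nat.mul_le_mul_left _ (by omega)
    omega

end RealRAM

/-! ### Clique potentials: chance distributions and realization plans -/

namespace RealRAM

/-- Sets the real array `4` to the indicators of the numbers of assignments to the cliques. -/
def initPotentials : Program :=
  forLoop 30 (.get 0 (.lit 3)) <|
    forLoop 31 (.get 0 (.lit 4)) <|
      .ite (.natLt (.var 31) (.get 13 (.get 14 (.var 30))))
        (.setReal 4 (.add (.mul (.var 30) (.get 0 (.lit 4))) (.var 31)) .one)
        (.setReal 4 (.add (.mul (.var 30) (.get 0 (.lit 4))) (.var 31)) .zero)

theorem tr_initPotentials {s : State} {ℓ d : ℕ} (hl : s.nat 0 3 = ℓ) (hd : s.nat 0 4 = d) :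
    Tr initPotentials s (ℓ * (d * 60 + 40) + 20) fun s' => ∀ t < ℓ, ∀ x < d,
      s'.real 4 (t * d + x) = if x < s.nat 13 (s.nat 14 t) then 1 else 0 := by
  refine (Tr.table (fun s => s.real 4) ℓ d (d * 60 + 15)
    (fun t x => if x < s.nat 13 (s.nat 14 t) then (1 : ℝ) else 0) rfl (by simp)
    (fun s' f => by simp [f.nat 0 rfl, hl]) ?_).mono
    (loop_cost_le (by simp [NatExp.cost]) (by simp [NatExp.cost])) fun _ _ h => h
  intro t ht s1 f1 hi
  refine (Tr.row (fun s => s.real 4) d 45 (t * d)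
    (fun x => if x < s.nat 13 (s.nat 14 t) then (1 : ℝ) else 0) rfl (by simp)
    (fun s' f => by simp [f.nat 0 rfl, f1.nat 0 rfl, hd]) ?_).mono
    (loop_cost_le (by simp [NatExp.cost]) (by simp [NatExp.cost])) fun _ _ h => h
  intro x hx s2 f2 hi2 _
  have e0 := (f2.nat 0 rfl).trans (f1.nat 0 rfl)
  have e13 := (f2.nat 13 rfl).trans (f1.nat 13 rfl)
  have e14 := (f2.nat 14 rfl).trans (f1.nat 14 rfl)
  have e30 := f2.nat 30 rfl
  apply Tr.of_wp
  by_cases h' : x < s.nat 13 (s.nat 14 t) <;>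
  simp [e0, e13, e14, e30, hi, hi2, hd, h', NatExp.cost, RealExp.cost, Test.cost]

/-- The multiplication of the row with the number in the variable `46` of the table in the real array
`4` by the values of an expression. -/
def scaleRow (e : RealExp) : Program :=
  forLoop 31 (.get 0 (.lit 4)) <|
    .setReal 4 (.add (.mul (.var 46) (.get 0 (.lit 4))) (.var 31))
      (.mul (.get 4 (.add (.mul (.var 46) (.get 0 (.lit 4))) (.var 31))) e)

theorem tr_scaleRow {s : State} {e : RealExp} {d p : ℕ} (v : ℕ → ℝ) (hd : s.nat 0 4 = d)
    (hp : s.nat 46 0 = p)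
    (he : ∀ x < d, ∀ s', Frame (scaleRow e) s s' → s'.nat 31 0 = x → e.eval s' = v x) :
    Tr (scaleRow e) s (d * (e.cost + 50) + 20) fun s' => ∀ t, ∀ x < d,
      s'.real 4 (t * d + x) = if t = p then s.real 4 (t * d + x) * v x
        else s.real 4 (t * d + x) := by
  refine (Tr.row (fun s => s.real 4) d (e.cost + 35) (p * d)
    (fun x => s.real 4 (p * d + x) * v x) rfl (by simp)
    (fun s' f => by simp [f.nat 0 rfl, hd]) ?_).mono
    (loop_cost_le (by simp [NatExp.cost]) (by simp [NatExp.cost])) ?_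
  · intro x hx s1 f1 hi hold
    have e0 := f1.nat 0 rfl
    have e46 := f1.nat 46 rfl
    have hev := he x hx s1 f1 hi
    apply Tr.of_wp
    simp [e0, e46, hi, hd, hp, hev, hold, NatExp.cost, RealExp.cost]
    omega
  · intro s' f ⟨h1, h2⟩ t x hx
    split_ifs with h
    · subst h; exact h1 x hx
    · refine h2 _ fun c hc => ?_
      rw [ne_eq, row_major_inj hx hc]; tauto

/-- Multiplies the conditional distributions of the chance variables into the potentials. -/
def multiplyChance : Program :=
  forLoop 30 (.get 0 (.lit 1)) <|
    .ite (.natEq (.get 2 (.var 30)) (.lit 0))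
      (.seq (.setNat 46 (.lit 0) (.get 15 (.get 9 (.var 30)))) <|
        scaleRow (.get 0 (.add (.mul (.var 30) (.get 0 (.lit 4)))
          (.get 22 (.add (.mul (.var 30) (.get 0 (.lit 4))) (.var 31))))))
      .skip

theorem tr_multiplyChance {s : State} {n d : ℕ} (hn : s.nat 0 1 = n) (hd : s.nat 0 4 = d) :
    Tr multiplyChance s (n * (d * 80 + 60) + 20) fun s' => ∀ t, ∀ x < d,
      s'.real 4 (t * d + x) = s.real 4 (t * d + x) * ∏ v ∈ Finset.range n,
        if s.nat 2 v = 0 ∧ s.nat 15 (s.nat 9 v) = t then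
          s.real 0 (v * d + s.nat 22 (v * d + x)) else 1 := by
  refine (Tr.forLoop n (d * 80 + 40) (fun j s' => ∀ t, ∀ x < d,
      s'.real 4 (t * d + x) = s.real 4 (t * d + x) * ∏ v ∈ Finset.range j,
        if s.nat 2 v = 0 ∧ s.nat 15 (s.nat 9 v) = t then
          s.real 0 (v * d + s.nat 22 (v * d + x)) else 1) rfl
    (fun s' f => by simp [f.nat 0 rfl, hn]) (by simp) ?_).mono
    (loop_cost_le (by simp [NatExp.cost]) (by simp [NatExp.cost])) fun _ _ h => h
  intro v hv s1 f1 hi hI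
  have e0 := f1.nat 0 rfl
  have e2 := f1.nat 2 rfl
  have e9 := f1.nat 9 rfl
  have e15 := f1.nat 15 rfl
  have e22 := f1.nat 22 rfl
  have r0 := f1.real 0 rfl
  apply Tr.of_wp
  by_cases hv0 : s.nat 2 v = 0
  · simp only [wp_ite, Test.Holds, NatExp.eval, hi, e2, hv0, if_true, wp_seq, wp_setNat]
    refine (tr_scaleRow (fun x => s.real 0 (v * d + s.nat 22 (v * d + x)))
      (p := s.nat 15 (s.nat 9 v)) (by simpa [e0] using hd) (by simp [e9, e15]) ?_).wp ?_
    · intro x hx s2 f2 hi2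
      simp [f2.nat 0 rfl, f2.nat 22 rfl, f2.nat 30 rfl, f2.real 0 rfl, e0, e22, r0, hi, hi2, hd]
    · intro s2 t2 f2 h2 ht2
      refine ⟨?_, fun t x hx => ?_⟩
      · simp [NatExp.cost, RealExp.cost, Test.cost] at ht2 ⊢; omega
      · rw [State.setNat_real, h2 t x hx, State.setNat_real, hI t x hx, Finset.prod_range_succ]
        by_cases htp : t = s.nat 15 (s.nat 9 v)
        · rw [if_pos htp, if_pos ⟨hv0, htp.symm⟩, mul_assoc]
        · rw [if_neg htp, if_neg fun h => htp h.2.symm, mul_one]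
  · simp [hi, e2, hv0, NatExp.cost, Test.cost, Finset.prod_range_succ]
    exact hI

/-- Multiplies the realization probabilities into the potentials. -/
def multiplyPlans : Program :=
  forLoop 30 (.get 0 (.lit 0)) <|
    .seq (.setNat 48 (.lit 0) (.sub (.get 20 (.var 30)) (.lit 1))) <|
    .seq (.setNat 46 (.lit 0) (.get 15 (.get 9 (.var 48)))) <|
    scaleRow (.get 2 (.add (.mul (.var 30) (.get 0 (.lit 4)))
      (.get 22 (.add (.mul (.var 48) (.get 0 (.lit 4))) (.var 31)))))

/-- A realization plan is a table over the scope of the agent. This is the family of its last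
decision variable, so the plan enters as a single factor, at the clique of that variable, and not
decision by decision. -/
theorem tr_multiplyPlans {s : State} {N d : ℕ} (hN : s.nat 0 0 = N) (hd : s.nat 0 4 = d) :
    Tr multiplyPlans s (N * (d * 80 + 60) + 20) fun s' => ∀ t, ∀ x < d,
      s'.real 4 (t * d + x) = s.real 4 (t * d + x) * ∏ k ∈ Finset.range N,
        if s.nat 15 (s.nat 9 (s.nat 20 k - 1)) = t then
          s.real 2 (k * d + s.nat 22 ((s.nat 20 k - 1) * d + x)) else 1 := by
  refine (Tr.forLoop N (d * 80 + 40) (fun j s' => ∀ t, ∀ x < d,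
      s'.real 4 (t * d + x) = s.real 4 (t * d + x) * ∏ k ∈ Finset.range j,
        if s.nat 15 (s.nat 9 (s.nat 20 k - 1)) = t then
          s.real 2 (k * d + s.nat 22 ((s.nat 20 k - 1) * d + x)) else 1) rfl
    (fun s' f => by simp [f.nat 0 rfl, hN]) (by simp) ?_).mono
    (loop_cost_le (by simp [NatExp.cost]) (by simp [NatExp.cost])) fun _ _ h => h
  intro k hk s1 f1 hi hI
  have e0 := f1.nat 0 rfl
  have e20 := f1.nat 20 rfl
  have e9 := f1.nat 9 rfl
  have e15 := f1.nat 15 rfl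
  have e22 := f1.nat 22 rfl
  have r2 := f1.real 2 rfl
  apply Tr.of_wp
  simp only [NatExp.eval, hi, wp_seq, wp_setNat]
  refine (tr_scaleRow (fun x => s.real 2 (k * d + s.nat 22 ((s.nat 20 k - 1) * d + x)))
    (p := s.nat 15 (s.nat 9 (s.nat 20 k - 1))) (by simpa [e0] using hd)
    (by simp [e9, e15, e20]) ?_).wp ?_
  · intro x hx s2 f2 hi2
    simp [f2.nat 0 rfl, f2.nat 22 rfl, f2.nat 30 rfl, f2.nat 48 rfl, f2.real 2 rfl, e0, e22, e20,
      r2, hi, hi2, hd]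
  · intro s2 t2 f2 h2 ht2
    refine ⟨?_, fun t x hx => ?_⟩
    · simp [NatExp.cost, RealExp.cost] at ht2 ⊢; omega
    · rw [State.setNat_real, h2 t x hx, State.setNat_real, State.setNat_real, hI t x hx,
        Finset.prod_range_succ]
      by_cases htp : t = s.nat 15 (s.nat 9 (s.nat 20 k - 1))
      · rw [if_pos htp, if_pos htp.symm, mul_assoc]
      · rw [if_neg htp, if_neg fun h => htp h.symm, mul_one]

end RealRAM

/-! ### Sums of products over a tree -/

namespace TreeSum

variable {R : Type*} [CommRing R] (d : ℕ) (K : ℕ → ℕ → ℕ → R) (par : ℕ → ℕ)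

/-- The message of the node `s` to its parent. -/
def message (A : ℕ → ℕ → R) (s y : ℕ) : R := ∑ x ∈ Finset.range d, K s x y * A s x

/-- The weights of the nodes after the node `s` has been merged into its parent. -/
def absorb (A : ℕ → ℕ → R) (s : ℕ) : ℕ → ℕ → R := fun c y =>
  if c = par s then A c y * message d K A s y else A c y

/-- The sum over all assignments of numbers less than `d` to the nodes `0, …, m` of the product of
the node weights and the kernels on the edges, by successive elimination of the nodes. -/
def total : ℕ → (ℕ → ℕ → R) → R
  | 0, A => ∑ y ∈ Finset.range d, A 0 y
  | m + 1, A => total m (absorb d K par A (m + 1))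

/-- The partial derivatives of `total` with respect to the node weights. -/
def deriv : ℕ → (ℕ → ℕ → R) → ℕ → ℕ → R
  | 0, _ => fun _ _ => 1
  | m + 1, A => fun c y =>
    if c = m + 1 then ∑ z ∈ Finset.range d, K (m + 1) y z * (A (par (m + 1)) z *
      deriv m (absorb d K par A (m + 1)) (par (m + 1)) z)
    else if c = par (m + 1) then
      deriv m (absorb d K par A (m + 1)) c y * message d K A (m + 1) y
    else deriv m (absorb d K par A (m + 1)) c y

variable {d K par}

/-- Cells with `y ≥ d` and nodes beyond `m` are irrelevant. In `total_update` this identifies the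
absorbed form of updated weights with an update of the absorbed weights on the nodes that remain. -/
theorem total_congr (m : ℕ) (hpar : ∀ t ≤ m, 0 < t → par t < t) {A A' : ℕ → ℕ → R}
    (h : ∀ c ≤ m, ∀ y < d, A c y = A' c y) : total d K par m A = total d K par m A' := by
  induction m generalizing A A' with
  | zero => exact Finset.sum_congr rfl fun y hy => h 0 le_rfl y (Finset.mem_range.1 hy)
  | succ m ih =>
    refine ih (fun t ht => hpar t (by omega)) fun c hc y hy => ?_
    have : message d K A (m + 1) y = message d K A' (m + 1) y :=
      Finset.sum_congr rfl fun x hx => by rw [h (m + 1) le_rfl x (Finset.mem_range.1 hx)]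
    simp only [absorb, this, h c (by omega) y hy]

/-- The sum is linear in the weights of each node, and `deriv` gives the coefficients; replacing the
weights of the node `c` by `e` evaluates this linear form at `e`. In the elimination of the last
node, `c` can be this node, its parent, or a node not involved. -/
theorem total_update (m : ℕ) (hpar : ∀ t ≤ m, 0 < t → par t < t) (A : ℕ → ℕ → R) {c : ℕ}
    (hc : c ≤ m) (e : ℕ → R) :
    total d K par m (Function.update A c e) =
      ∑ y ∈ Finset.range d, deriv d K par m A c y * e y := by
  induction m generalizing A c e with
  | zero =>
    obtain rfl : c = 0 := by omega
    simp [total, deriv]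
  | succ m ih =>
    have hp := hpar (m + 1) le_rfl (by omega)
    have ih' := fun {c : ℕ} => @ih (fun t ht => hpar t (by omega)) (absorb d K par A (m + 1)) c
    have hcongr := fun {A A' : ℕ → ℕ → R} => total_congr (d := d) (K := K) (A := A) (A' := A') m
      (fun t ht => hpar t (by omega))
    rw [total]
    by_cases hcm : c = m + 1
    · subst hcm
      -- The weights of the eliminated node act on the remaining sum only through its message, that
      -- is, through the row of its parent.
      rw [hcongr (A' := Function.update (absorb d K par A (m + 1)) (par (m + 1)) fun z =>
        A (par (m + 1)) z * ∑ x ∈ Finset.range d, K (m + 1) x z * e x), ih' (by omega)]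
      · simp only [deriv, if_true, Finset.mul_sum, Finset.sum_mul]
        rw [Finset.sum_comm]
        refine Finset.sum_congr rfl fun x _ => Finset.sum_congr rfl fun y _ => ?_
        ring
      · intro k hk y _
        by_cases hkp : k = par (m + 1)
        · subst hkp
          simp [absorb, message, Function.update_of_ne hp.ne]
        · simp [absorb, hkp, Function.update_of_ne (show k ≠ m + 1 by omega)]
    · have hcm' : c ≤ m := by omega
      by_cases hcp : c = par (m + 1)
      · subst hcp
        rw [hcongr (A' := Function.update (absorb d K par A (m + 1)) (par (m + 1)) fun z =>
          message d K A (m + 1) z * e z), ih' (by omega)]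
        · simp only [deriv, if_neg hcm, if_true]
          exact Finset.sum_congr rfl fun x _ => by ring
        · intro k hk y _
          by_cases hkp : k = par (m + 1)
          · subst hkp
            simp [absorb, message, Function.update_of_ne hp.ne', mul_comm]
          · simp [absorb, hkp]
      · rw [hcongr (A' := Function.update (absorb d K par A (m + 1)) c e), ih' hcm']
        · simp [deriv, hcm, hcp]
        · intro k hk y _
          by_cases hkc : k = c
          · subst hkc
            simp [absorb, hcp]
          · simp [absorb, message, hkc, Function.update_of_ne (Ne.symm hcm)]

/-- The value of `total` as a sum over tuples. -/
theorem total_eq_sum (m : ℕ) (hpar : ∀ t ≤ m, 0 < t → par t < t) (A : ℕ → ℕ → R) :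
    total d K par m A = ∑ x ∈ Fintype.piFinset fun _ : Fin (m + 1) => Finset.range d,
      (∏ c : Fin (m + 1), A c (x c)) *
      ∏ t : Fin m, K (t + 1) (x t.succ) (x (Fin.ofNat (m + 1) (par (t + 1)))) := by
  induction m generalizing A with
  | zero =>
    simp only [total]
    refine Finset.sum_bij' (fun y _ => fun _ => y) (fun x _ => x 0) ?_ ?_ ?_ ?_ ?_
    · simp
    · intro x hx
      simpa using hx
    · simp
    · intro x _
      funext i
      rw [show i = 0 from Fin.fin_one_eq_zero i]
    · simp
  | succ m ih =>
    rw [total, ih (fun t ht => hpar t (by omega))]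
    have hp := hpar (m + 1) le_rfl (by omega)
    -- Splits off the last coordinate of a tuple, which is the summation variable of the message
    -- that is eliminated.
    have hsum : ∀ f : (Fin (m + 2) → ℕ) → R,
        ∑ x ∈ Fintype.piFinset fun _ : Fin (m + 2) => Finset.range d, f x =
        ∑ x ∈ Fintype.piFinset fun _ : Fin (m + 1) => Finset.range d,
          ∑ y ∈ Finset.range d, f (Fin.snoc x y) := by
      intro f
      rw [Finset.sum_sigma']
      refine Finset.sum_bij' (fun x _ => ⟨Fin.init x, x (Fin.last _)⟩)
        (fun p _ => Fin.snoc (α := fun _ => ℕ) p.1 p.2) ?_ ?_ ?_ ?_ ?_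
      · intro x hx
        simp only [Fintype.mem_piFinset, Finset.mem_range, Finset.mem_sigma] at hx ⊢
        exact ⟨fun i => hx _, hx _⟩
      · intro p hp
        simp only [Fintype.mem_piFinset, Finset.mem_range, Finset.mem_sigma] at hp ⊢
        intro i
        refine Fin.lastCases ?_ (fun i => ?_) i
        · simpa using hp.2
        · simpa using hp.1 i
      · intro x _; simp
      · intro p _; simp
      · intro x _; simp
    rw [hsum]
    refine Finset.sum_congr rfl fun x _ => ?_
    -- `Fin.ofNat` reduces modulo the number of nodes; since parents precede their children, nothing
    -- is reduced and the indices of both tuple lengths match.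
    have hofNat : ∀ t : Fin m, Fin.ofNat (m + 2) (par (t + 1)) =
        (Fin.ofNat (m + 1) (par (t + 1))).castSucc := by
      intro t
      have := hpar (t + 1) (by omega) (by omega)
      ext
      simp [Fin.ofNat, Nat.mod_eq_of_lt (show par (t + 1) < m + 1 by omega),
        Nat.mod_eq_of_lt (show par (t + 1) < m + 2 by omega)]
    have hlast : Fin.ofNat (m + 2) (par (m + 1)) = (Fin.ofNat (m + 1) (par (m + 1))).castSucc := by
      ext
      simp [Fin.ofNat, Nat.mod_eq_of_lt hp, Nat.mod_eq_of_lt (hp.trans (Nat.lt_succ_self _))]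
    have hval : ((Fin.ofNat (m + 1) (par (m + 1)) : Fin (m + 1)) : ℕ) = par (m + 1) := by
      simp [Fin.ofNat, Nat.mod_eq_of_lt hp]
    -- Merging the last node changes only the factor of its parent, which is multiplied by the
    -- message.
    have habs : ∏ c : Fin (m + 1), absorb d K par A (m + 1) c (x c) =
        (∏ c : Fin (m + 1), A c (x c)) *
          message d K A (m + 1) (x (Fin.ofNat (m + 1) (par (m + 1)))) := by
      rw [← Finset.prod_erase_mul _ _ (Finset.mem_univ (Fin.ofNat (m + 1) (par (m + 1)))),
        ← Finset.prod_erase_mul Finset.univ (fun c : Fin (m + 1) => A c (x c))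
          (Finset.mem_univ (Fin.ofNat (m + 1) (par (m + 1))))]
      rw [mul_assoc]
      congr 1
      · refine Finset.prod_congr rfl fun c hc => ?_
        have hne : (c : ℕ) ≠ par (m + 1) := fun h =>
          (Finset.mem_erase.1 hc).1 (Fin.ext (h.trans hval.symm))
        simp [absorb, hne]
      · simp only [absorb, hval, if_true]
    rw [habs]
    simp only [Fin.prod_univ_castSucc (n := m + 1), Fin.prod_univ_castSucc (n := m),
      Fin.snoc_castSucc, Fin.snoc_last, Fin.succ_last, Fin.val_last, hlast, message,
      Fin.val_castSucc, hofNat, Fin.succ_castSucc, Finset.mul_sum, Finset.sum_mul]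
    refine Finset.sum_congr rfl fun y _ => ?_
    ring

end TreeSum

/-! ### Message passing with dual numbers -/

namespace TreeSum

variable {R : Type*} [CommRing R] (d : ℕ) (K : ℕ → ℕ → ℕ → R) (par : ℕ → ℕ)

/-- The weights of the nodes after the last `j` of the nodes `0, …, m` have been eliminated. -/
def level (m : ℕ) (A : ℕ → ℕ → R) : ℕ → ℕ → ℕ → R
  | 0 => A
  | j + 1 => absorb d K par (level m A j) (m - j)

end TreeSum

namespace RealRAM

open TreeSum

/-- The dual number with the given real and infinitesimal part. -/
def dualNumber (x y : ℝ) : DualNumber ℝ := (x, y)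

@[simp] theorem fst_dualNumber (x y : ℝ) : (dualNumber x y).fst = x := rfl

@[simp] theorem snd_dualNumber (x y : ℝ) : (dualNumber x y).snd = y := rfl

/-- An array of dual numbers, stored in two arrays of real numbers. -/
def State.dual (s : State) (a b i : ℕ) : DualNumber ℝ := dualNumber (s.real a i) (s.real b i)

theorem dual_ext {x y : DualNumber ℝ} (h1 : x.fst = y.fst) (h2 : x.snd = y.snd) : x = y :=
  TrivSqZeroExt.ext h1 h2

@[simp] theorem State.dual_setNat (s : State) (c i x a b : ℕ) :
    (s.setNat c i x).dual a b = s.dual a b := rfl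

theorem Frame.dual {p : Program} {s s' : State} (h : Frame p s s') (a b : ℕ)
    (ha : p.keepsReal a = true) (hb : p.keepsReal b = true) : s'.dual a b = s.dual a b := by
  funext i; simp [State.dual, h.real a ha, h.real b hb]

/-- The cell of the kernel array for the node in the variable `50`, the assignment to its clique in
the variable `x` and the assignment to the clique of its parent in the variable `y`. -/
def kernelCell (x y : ℕ) : NatExp :=
  .add (.mul (.var 50) (.mul (.get 0 (.lit 4)) (.get 0 (.lit 4))))
    (.add (.mul (.var x) (.get 0 (.lit 4))) (.var y))

/-- The cell in the row of the variable `a` and the column of the variable `b`. -/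
def cell (a b : ℕ) : NatExp := .add (.mul (.var a) (.get 0 (.lit 4))) (.var b)

/-- The kernel array as matrices over the dual numbers. -/
noncomputable def State.kernel (s : State) (d t x y : ℕ) : DualNumber ℝ :=
  dualNumber (s.real 5 (t * (d * d) + (x * d + y))) 0

/-- The message of the node in the variable `50`, and a copy of the weights of its parent, which is
in the variable `51`. -/
def sendMessage : Program :=
  forLoop 36 (.get 0 (.lit 4)) <|
    .seq (sumLoop 37 (.get 0 (.lit 4)) 18
      (.mul (.get 5 (kernelCell 37 36)) (.get 10 (cell 50 37)))) <|
    .seq (sumLoop 37 (.get 0 (.lit 4)) 19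
      (.mul (.get 5 (kernelCell 37 36)) (.get 11 (cell 50 37)))) <|
    .seq (.setReal 12 (cell 50 36) (.get 18 (.lit 0))) <|
    .seq (.setReal 13 (cell 50 36) (.get 19 (.lit 0))) <|
    .seq (.setReal 14 (cell 50 36) (.get 10 (cell 51 36))) <|
    .setReal 15 (cell 50 36) (.get 11 (cell 51 36))

/-- The kernel is real, so the real and the infinitesimal part of a message are two separate real
sums. The weights of the parent are copied before the message is multiplied into them, because the
derivative at the child involves the parent's weights without this message. -/
theorem tr_sendMessage {s : State} {d t p : ℕ} (hd : s.nat 0 4 = d) (ht : s.nat 50 0 = t)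
    (hp : s.nat 51 0 = p) :
    Tr sendMessage s (d * (d * 150 + 150) + 10) fun s' =>
      (∀ y < d, (s'.dual 12 13 (t * d + y), s'.dual 14 15 (t * d + y)) =
        (message d (s.kernel d) (fun c y => s.dual 10 11 (c * d + y)) t y,
          s.dual 10 11 (p * d + y))) ∧
      ∀ i, (∀ y < d, i ≠ t * d + y) →
        (s'.dual 12 13 i, s'.dual 14 15 i) = (s.dual 12 13 i, s.dual 14 15 i) := by
  refine (Tr.row (fun s i => (s.dual 12 13 i, s.dual 14 15 i)) d (d * 150 + 130) (t * d)
    (fun y => (message d (s.kernel d) (fun c y => s.dual 10 11 (c * d + y)) t y,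
          s.dual 10 11 (p * d + y))) rfl (by simp)
    (fun s' f => by simp [f.nat 0 rfl, hd]) ?_).mono
    (loop_cost_le (by simp [NatExp.cost]) (by simp [NatExp.cost])) fun _ _ h => h
  intro y hy s1 f1 hi _
  have e0 := f1.nat 0 rfl
  have e50 := f1.nat 50 rfl
  have e51 := f1.nat 51 rfl
  have r5 := f1.real 5 rfl
  have r10 := f1.real 10 rfl
  have r11 := f1.real 11 rfl
  apply Tr.of_wp
  simp only [wp_seq]
  refine (Tr.sumLoop d (fun x => s.real 5 (t * (d * d) + (x * d + y)) * s.real 10 (t * d + x))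
    (fun s' f => by simp [f.nat 0 rfl, e0, hd]) ?_).wp ?_
  · intro x hx s2 f2 hi2
    simp [kernelCell, cell, f2.nat 0 rfl, f2.nat 50 rfl, f2.real 5 rfl, f2.real 10 rfl,
      f2.nat 36 rfl, e0, e50, r5, r10, hi, hi2, hd, ht]
  intro s2 t2 f2 h18 ht2
  have e0' := (f2.nat 0 rfl).trans e0
  have e50' := (f2.nat 50 rfl).trans e50
  have e51' := (f2.nat 51 rfl).trans e51
  have e36 := f2.nat 36 rfl
  have r5' := (f2.real 5 rfl).trans r5
  have r10' := (f2.real 10 rfl).trans r10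
  have r11' := (f2.real 11 rfl).trans r11
  simp only [wp_seq]
  refine (Tr.sumLoop d (fun x => s.real 5 (t * (d * d) + (x * d + y)) * s.real 11 (t * d + x))
    (fun s' f => by simp [f.nat 0 rfl, e0', hd]) ?_).wp ?_
  · intro x hx s3 f3 hi3
    simp [kernelCell, cell, f3.nat 0 rfl, f3.nat 50 rfl, f3.real 5 rfl, f3.real 11 rfl,
      f3.nat 36 rfl, e0', e50', e36, r5', r11', hi, hi3, hd, ht]
  intro s3 t3 f3 h19 ht3
  have g18 := congrFun (f3.real 18 rfl) 0
  simp only [wp_seq, wp_setReal]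
  constructor
  · simp [NatExp.cost, RealExp.cost, kernelCell, cell] at ht2 ht3 ⊢
    omega
  · funext i
    simp only [cell, NatExp.eval, RealExp.eval, State.setReal_nat, f3.nat 0 rfl, e0',
      f3.nat 50 rfl, e50', ht, hd, f3.nat 36 rfl, e36, hi, f3.nat 51 rfl, e51', hp]
    by_cases h : i = t * d + y
    · subst h
      simp only [Function.update_self, Prod.mk.injEq]
      constructor
      · refine dual_ext ?_ ?_
        · simp [State.dual, g18, h18, message, State.kernel, TrivSqZeroExt.fst_sum]
        · simp [State.dual, h19, message, State.kernel, TrivSqZeroExt.snd_sum]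
      · refine dual_ext ?_ ?_
        · simp [State.dual, f3.real 10 rfl, r10']
        · simp [State.dual, f3.real 11 rfl, r11']
    · simp only [Function.update_of_ne h]
      simp [State.dual, h, f3.real 12 rfl, f3.real 13 rfl, f3.real 14 rfl, f3.real 15 rfl,
        f2.real 12 rfl, f2.real 13 rfl, f2.real 14 rfl, f2.real 15 rfl]

/-- Multiplies the row of the node in the variable `51` of a table of dual numbers, in the real arrays
`a` and `b`, by the message of the node in the variable `50`. -/
def multiplyMessage (a b : ℕ) : Program :=
  forLoop 36 (.get 0 (.lit 4)) <|
    .seq (.setReal b (cell 51 36) (.add (.mul (.get a (cell 51 36)) (.get 13 (cell 50 36)))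
      (.mul (.get b (cell 51 36)) (.get 12 (cell 50 36))))) <|
    .setReal a (cell 51 36) (.mul (.get a (cell 51 36)) (.get 12 (cell 50 36)))

/-- The infinitesimal part is written first, since the product rule needs the old real part. The
messages, in the arrays `12` and `13`, must be disjoint from the table. -/
theorem tr_multiplyMessage {a b : ℕ} (hab : a ≠ b) (ha12 : 12 ≠ a) (hb12 : 12 ≠ b) (ha13 : 13 ≠ a)
    (hb13 : 13 ≠ b) {s : State} {d t p : ℕ} (hd : s.nat 0 4 = d)
    (ht : s.nat 50 0 = t) (hp : s.nat 51 0 = p) :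
    Tr (multiplyMessage a b) s (d * 150 + 10) fun s' => ∀ c, ∀ y < d, s'.dual a b (c * d + y) =
      if c = p then s.dual a b (c * d + y) * s.dual 12 13 (t * d + y)
      else s.dual a b (c * d + y) := by
  refine (Tr.row (fun s => s.dual a b) d 130 (p * d)
    (fun y => s.dual a b (p * d + y) * s.dual 12 13 (t * d + y)) rfl (by simp)
    (fun s' f => by simp [f.nat 0 rfl, hd]) ?_).mono
    (loop_cost_le (by simp [NatExp.cost]) (by simp [NatExp.cost])) ?_
  · intro y hy s1 f1 hi hold
    have e0 := f1.nat 0 rfl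
    have e50 := f1.nat 50 rfl
    have e51 := f1.nat 51 rfl
    have r12 := f1.real 12 (by simp [forLoop, Program.keepsReal, ha12.symm, hb12.symm])
    have r13 := f1.real 13 (by simp [forLoop, Program.keepsReal, ha13.symm, hb13.symm])
    have h1 : s1.real a (p * d + y) = s.real a (p * d + y) := congrArg TrivSqZeroExt.fst hold
    have h2 : s1.real b (p * d + y) = s.real b (p * d + y) := congrArg TrivSqZeroExt.snd hold
    apply Tr.of_wp
    simp only [wp_seq, wp_setReal]
    constructor
    · simp [NatExp.cost, RealExp.cost, cell]
    · funext i
      simp only [cell, NatExp.eval, RealExp.eval, State.setReal_nat, e0, e50, e51, ht, hd, hi, hp]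
      by_cases h : i = p * d + y
      · subst h
        rw [Function.update_self]
        refine dual_ext ?_ ?_
        · simp [State.dual, hab, hb12, r12, h1]
        · simp [State.dual, hab.symm, r12, r13, h1, h2]
      · rw [Function.update_of_ne h]
        simp [State.dual, hab, hab.symm, h]
  · intro s' f ⟨h1, h2⟩ c y hy
    split_ifs with h
    · subst h; exact h1 y hy
    · refine h2 _ fun c' hc' => ?_
      rw [ne_eq, row_major_inj hy hc']; tauto

/-- Elimination of all nodes but the root, from the last to the first. -/
def upwardPass : Program :=
  forLoop 35 (.sub (.get 0 (.lit 3)) (.lit 1)) <|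
    .seq (.setNat 50 (.lit 0) (.sub (.sub (.get 0 (.lit 3)) (.lit 1)) (.var 35))) <|
    .seq (.setNat 51 (.lit 0) (.get 16 (.var 50))) <|
    .seq sendMessage <|
    multiplyMessage 10 11

/-- Round `j` eliminates the node `m - j`. Its message and the copy of its parent's weights belong
to level `j`, and later rounds write to other rows, so in the end the data of all levels are
available for the downward pass. -/
theorem tr_upwardPass {s : State} {m d : ℕ} {A : ℕ → ℕ → DualNumber ℝ} (hl : s.nat 0 3 = m + 1)
    (hd : s.nat 0 4 = d)
    (hpar : ∀ t ≤ m, 0 < t → s.nat 16 t < t)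
    (hA : ∀ c ≤ m, ∀ y < d, s.dual 10 11 (c * d + y) = A c y) :
    Tr upwardPass s (m * (d * (d * 150 + 350) + 100) + 20) fun s' =>
      ∀ j < m, ∀ y < d,
        s'.dual 12 13 ((m - j) * d + y) =
          message d (s.kernel d) (level d (s.kernel d) (s.nat 16) m A j) (m - j) y ∧
        s'.dual 14 15 ((m - j) * d + y) =
          level d (s.kernel d) (s.nat 16) m A j (s.nat 16 (m - j)) y := by
  set lev := level d (s.kernel d) (s.nat 16) m A with hlev
  refine (Tr.forLoop m (d * (d * 150 + 300) + 60) (fun j s' =>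
    (∀ i < j, ∀ y < d, s'.dual 12 13 ((m - i) * d + y) =
          message d (s.kernel d) (lev i) (m - i) y ∧
        s'.dual 14 15 ((m - i) * d + y) = lev i (s.nat 16 (m - i)) y) ∧
    ∀ c ≤ m, ∀ y < d, s'.dual 10 11 (c * d + y) = lev j c y) rfl
    (fun s' f => by simp [f.nat 0 rfl, hl]) ?_ ?_).mono
    ?_ fun _ _ h => h.1
  · simpa [hlev, level] using hA
  · intro j hj s1 f1 hi ⟨h1, h2⟩
    have e0 := f1.nat 0 rfl
    have e16 := f1.nat 16 rfl
    have hker : s1.kernel d = s.kernel d := by funext; simp [State.kernel, f1.real 5 rfl]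
    have hpj := hpar (m - j) (by omega) (by omega)
    apply Tr.of_wp
    simp only [wp_seq, wp_setNat, NatExp.eval]
    refine (tr_sendMessage (t := m - j) (p := s.nat 16 (m - j)) (by simpa [e0] using hd)
      (by simp [e0, hl, hi]) (by simp [e16, e0, hl, hi])).wp ?_
    intro s2 t2 f2 ⟨h3, h4⟩ ht2
    refine (tr_multiplyMessage (t := m - j) (p := s.nat 16 (m - j)) (by norm_num) (by norm_num)
      (by norm_num) (by norm_num) (by norm_num) (by simpa [f2.nat 0 rfl, e0] using hd)
      (by simp [f2.nat 50 rfl, e0, hl, hi]) (by simp [f2.nat 51 rfl, e0, e16, hl, hi])).wp ?_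
    intro s3 t3 f3 h5 ht3
    have hmsg : ∀ y, y < d → message d (s.kernel d) (fun c y => s1.dual 10 11 (c * d + y)) (m - j) y =
        message d (s.kernel d) (lev j) (m - j) y := fun y _ =>
      Finset.sum_congr rfl fun x hx => by dsimp only; rw [h2 _ (by omega) x (Finset.mem_range.1 hx)]
    have h3' : ∀ y < d, s2.dual 12 13 ((m - j) * d + y) =
        message d (s.kernel d) (lev j) (m - j) y ∧
        s2.dual 14 15 ((m - j) * d + y) = lev j (s.nat 16 (m - j)) y := by
      intro y hy
      have := h3 y hy
      rw [Prod.mk.injEq] at this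
      refine ⟨this.1.trans ?_, this.2.trans (h2 _ (by omega) y hy)⟩
      rw [← hmsg y hy, ← hker]; rfl
    have k12 := f3.dual 12 13 rfl rfl
    have k14 := f3.dual 14 15 rfl rfl
    refine ⟨?_, ?_, ?_⟩
    · simp [NatExp.cost] at ht2 ht3 ⊢
      have : d * (d * 150 + 300) = d * (d * 150 + 150) + d * 150 := by ring
      omega
    · intro i hij y hy
      rw [State.dual_setNat, State.dual_setNat, k12, k14]
      rcases Nat.lt_succ_iff_lt_or_eq.1 hij with hij | rfl
      · have := h4 ((m - i) * d + y) fun y' hy' => by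
          rw [ne_eq, row_major_inj hy hy']; omega
        rw [Prod.mk.injEq] at this
        rw [this.1, this.2]
        exact h1 i hij y hy
      · exact h3' y hy
    · intro c hc y hy
      rw [State.dual_setNat, h5 c y hy, (h3' y hy).1, f2.dual 10 11 rfl rfl]
      simp only [State.dual_setNat, h2 c hc y hy]
      rfl
  · refine loop_cost_le ?_ (by simp [NatExp.cost])
    simp [NatExp.cost]
    nlinarith

/-- The derivatives with respect to the weights of the node in the variable `50`. -/
def pullBack : Program :=
  forLoop 36 (.get 0 (.lit 4)) <|
    .seq (sumLoop 37 (.get 0 (.lit 4)) 18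
      (.mul (.get 5 (kernelCell 36 37)) (.mul (.get 14 (cell 50 37)) (.get 16 (cell 51 37))))) <|
    .seq (sumLoop 37 (.get 0 (.lit 4)) 19
      (.mul (.get 5 (kernelCell 36 37)) (.add (.mul (.get 14 (cell 50 37)) (.get 17 (cell 51 37)))
        (.mul (.get 15 (cell 50 37)) (.get 16 (cell 51 37)))))) <|
    .seq (.setReal 16 (cell 50 36) (.get 18 (.lit 0))) <|
    .setReal 17 (cell 50 36) (.get 19 (.lit 0))

/-- The derivatives are written in place. Because of `p ≠ t` the row of the parent, from which they
are computed, does not change meanwhile. -/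
theorem tr_pullBack {s : State} {d t p : ℕ} (hd : s.nat 0 4 = d) (ht : s.nat 50 0 = t)
    (hp : s.nat 51 0 = p) (htp : p ≠ t) :
    Tr pullBack s (d * (d * 200 + 150) + 10) fun s' => ∀ c, ∀ x < d, s'.dual 16 17 (c * d + x) =
      if c = t then ∑ y ∈ Finset.range d, s.kernel d t x y *
        (s.dual 14 15 (t * d + y) * s.dual 16 17 (p * d + y))
      else s.dual 16 17 (c * d + x) := by
  have key : ∀ x < d, ∀ s1, Frame pullBack s s1 → s1.nat 36 0 = x →
      (∀ y < d, s1.dual 16 17 (p * d + y) = s.dual 16 17 (p * d + y)) →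
      WP (.seq (sumLoop 37 (.get 0 (.lit 4)) 18
      (.mul (.get 5 (kernelCell 36 37)) (.mul (.get 14 (cell 50 37)) (.get 16 (cell 51 37))))) <|
    .seq (sumLoop 37 (.get 0 (.lit 4)) 19
      (.mul (.get 5 (kernelCell 36 37)) (.add (.mul (.get 14 (cell 50 37)) (.get 17 (cell 51 37)))
        (.mul (.get 15 (cell 50 37)) (.get 16 (cell 51 37)))))) <|
    .seq (.setReal 16 (cell 50 36) (.get 18 (.lit 0))) <|
    .setReal 17 (cell 50 36) (.get 19 (.lit 0))) (fun s' T => T ≤ d * 200 + 130 ∧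
      s'.dual 16 17 = Function.update (s1.dual 16 17) (t * d + x)
        (∑ y ∈ Finset.range d, s.kernel d t x y *
        (s.dual 14 15 (t * d + y) * s.dual 16 17 (p * d + y)))) s1 0 := by
    intro x hx s1 f1 hi hold
    have e0 := f1.nat 0 rfl
    have e50 := f1.nat 50 rfl
    have e51 := f1.nat 51 rfl
    have r5 := f1.real 5 rfl
    have r14 := f1.real 14 rfl
    have r15 := f1.real 15 rfl
    have h16 : ∀ y < d, s1.real 16 (p * d + y) = s.real 16 (p * d + y) := fun y hy =>
      congrArg TrivSqZeroExt.fst (hold y hy)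
    have h17 : ∀ y < d, s1.real 17 (p * d + y) = s.real 17 (p * d + y) := fun y hy =>
      congrArg TrivSqZeroExt.snd (hold y hy)
    simp only [wp_seq]
    refine (Tr.sumLoop d (fun y => s.real 5 (t * (d * d) + (x * d + y)) *
      (s.real 14 (t * d + y) * s.real 16 (p * d + y)))
      (fun s' f => by simp [f.nat 0 rfl, e0, hd]) ?_).wp ?_
    · intro y hy s2 f2 hi2
      simp [kernelCell, cell, f2.nat 0 rfl, f2.nat 50 rfl, f2.nat 51 rfl, f2.real 5 rfl,
        f2.real 14 rfl, f2.real 16 rfl,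
        f2.nat 36 rfl, e0, e50, e51, r5, r14, hi, hi2, hd, ht, hp, h16 y hy]
    intro s2 t2 f2 h18 ht2
    have e0' := (f2.nat 0 rfl).trans e0
    have e50' := (f2.nat 50 rfl).trans e50
    have e51' := (f2.nat 51 rfl).trans e51
    have e36 := f2.nat 36 rfl
    have r5' := (f2.real 5 rfl).trans r5
    have r14' := (f2.real 14 rfl).trans r14
    have r15' := (f2.real 15 rfl).trans r15
    have r16' := f2.real 16 rfl
    have r17' := f2.real 17 rfl
    simp only [wp_seq]
    refine (Tr.sumLoop d (fun y => s.real 5 (t * (d * d) + (x * d + y)) *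
      (s.real 14 (t * d + y) * s.real 17 (p * d + y) +
        s.real 15 (t * d + y) * s.real 16 (p * d + y)))
      (fun s' f => by simp [f.nat 0 rfl, e0', hd]) ?_).wp ?_
    · intro y hy s3 f3 hi3
      simp [kernelCell, cell, f3.nat 0 rfl, f3.nat 50 rfl, f3.nat 51 rfl, f3.real 5 rfl,
        f3.real 14 rfl, f3.real 15 rfl, f3.real 16 rfl, f3.real 17 rfl, f3.nat 36 rfl,
        e0', e50', e51', e36, r5', r14', r15', r16', r17', hi, hi3, hd, ht, hp, h16 y hy, h17 y hy]
    intro s3 t3 f3 h19 ht3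
    have g18 := congrFun (f3.real 18 rfl) 0
    simp only [wp_seq, wp_setReal]
    constructor
    · simp [NatExp.cost, RealExp.cost, kernelCell, cell] at ht2 ht3 ⊢
      omega
    · funext i
      simp only [cell, NatExp.eval, RealExp.eval, State.setReal_nat, f3.nat 0 rfl, e0',
        f3.nat 50 rfl, e50', ht, hd, f3.nat 36 rfl, e36, hi]
      by_cases h : i = t * d + x
      · subst h
        rw [Function.update_self]
        refine dual_ext ?_ ?_
        · simp [State.dual, g18, h18, State.kernel, TrivSqZeroExt.fst_sum]
        · simp [State.dual, h19, State.kernel, TrivSqZeroExt.snd_sum]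
      · rw [Function.update_of_ne h]
        simp [State.dual, h, f3.real 16 rfl, f3.real 17 rfl, r16', r17']
  refine (Tr.forLoop d (d * 200 + 130) (fun j s' => ∀ c, ∀ x < d, s'.dual 16 17 (c * d + x) =
      if c = t ∧ x < j then ∑ y ∈ Finset.range d, s.kernel d t x y *
        (s.dual 14 15 (t * d + y) * s.dual 16 17 (p * d + y))
      else s.dual 16 17 (c * d + x)) rfl
    (fun s' f => by simp [f.nat 0 rfl, hd]) (by simp) ?_).mono
    (loop_cost_le (by simp [NatExp.cost]) (by simp [NatExp.cost])) ?_
  · intro x hx s1 f1 hi hI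
    apply Tr.of_wp
    obtain ⟨s2, t2, e, hT, h⟩ := key x hx s1 f1 hi fun y hy => by
      rw [hI p y hy, if_neg fun h => htp h.1]
    refine ⟨s2, t2, e, hT, fun c y hy => ?_⟩
    rw [State.dual_setNat, h, Function.update_apply]
    by_cases hc : c = t ∧ y = x
    · obtain ⟨rfl, rfl⟩ := hc
      simp
    · rw [if_neg (by rwa [row_major_inj hy hx]), hI c y hy]
      congr 1
      rw [eq_iff_iff]; omega
  · intro s' f h c x hx
    rw [h c x hx]
    simp [hx]

/-- Computation of the derivatives with respect to all node weights, from the root to the leaves. -/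
def downwardPass : Program :=
  .seq (forLoop 35 (.get 0 (.lit 4)) <|
    .seq (.setReal 16 (.var 35) .one) <|
    .setReal 17 (.var 35) .zero) <|
  forLoop 35 (.sub (.get 0 (.lit 3)) (.lit 1)) <|
    .seq (.setNat 50 (.lit 0) (.add (.var 35) (.lit 1))) <|
    .seq (.setNat 51 (.lit 0) (.get 16 (.var 50))) <|
    .seq pullBack <|
    multiplyMessage 16 17

/-- The recursion for `deriv` is run from the root. After `j` rounds the rows `0, …, j` hold the
derivatives for the tree on these nodes with the weights of level `m - j`. When the node `j + 1` is
added, its row is computed from the row of its parent, and only then is the parent's row multiplied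
by the message. -/
theorem tr_downwardPass {s : State} {m d : ℕ} {A : ℕ → ℕ → DualNumber ℝ} (hl : s.nat 0 3 = m + 1)
    (hd : s.nat 0 4 = d) (hpar : ∀ t ≤ m, 0 < t → s.nat 16 t < t)
    (hA : ∀ j < m, ∀ y < d,
        s.dual 12 13 ((m - j) * d + y) =
          message d (s.kernel d) (level d (s.kernel d) (s.nat 16) m A j) (m - j) y ∧
        s.dual 14 15 ((m - j) * d + y) =
          level d (s.kernel d) (s.nat 16) m A j (s.nat 16 (m - j)) y) :
    Tr downwardPass s (m * (d * (d * 200 + 350) + 100) + d * 50 + 50) fun s' =>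
      ∀ c ≤ m, ∀ y < d, s'.dual 16 17 (c * d + y) =
        TreeSum.deriv d (s.kernel d) (s.nat 16) m A c y := by
  set lev := level d (s.kernel d) (s.nat 16) m A with hlev
  apply Tr.of_wp
  rw [downwardPass, wp_seq]
  refine (Tr.row (fun s => s.dual 16 17) d 30 0 (fun _ => 1) rfl (by simp)
    (fun s' f => by simp [f.nat 0 rfl, hd]) ?_).wp ?_
  · intro c hc s1 f1 hi _
    apply Tr.of_wp
    simp only [wp_seq, wp_setReal]
    refine ⟨by simp [NatExp.cost, RealExp.cost], ?_⟩
    funext i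
    simp only [NatExp.eval, RealExp.eval, State.setReal_nat, hi, Nat.zero_add]
    by_cases h : i = c
    · subst h
      rw [Function.update_self]
      refine dual_ext ?_ ?_ <;> simp [State.dual]
    · rw [Function.update_of_ne h]
      simp [State.dual, h]
  rintro s0 t0 f0 ⟨h0, -⟩ ht0
  have k0 := f0.nat 0 rfl
  have k16 := f0.nat 16 rfl
  have k12 := f0.dual 12 13 rfl rfl
  have k14 := f0.dual 14 15 rfl rfl
  have hker0 : s0.kernel d = s.kernel d := by funext; simp [State.kernel, f0.real 5 rfl]
  refine (Tr.forLoop m (d * (d * 200 + 300) + 60) (fun j s' =>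
    ∀ c ≤ j, ∀ y < d, s'.dual 16 17 (c * d + y) =
      TreeSum.deriv d (s.kernel d) (s.nat 16) j (lev (m - j)) c y) rfl
    (fun s' f => by simp [f.nat 0 rfl, k0, hl]) ?_ ?_).wp ?_
  · intro c hc y hy
    obtain rfl : c = 0 := by omega
    simpa [TreeSum.deriv] using h0 y hy
  · intro j hj s1 f1 hi hI
    have e0 := (f1.nat 0 rfl).trans k0
    have e16 := (f1.nat 16 rfl).trans k16
    have e12 := (f1.dual 12 13 rfl rfl).trans k12
    have e14 := (f1.dual 14 15 rfl rfl).trans k14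
    have hker : s1.kernel d = s.kernel d := by
      rw [← hker0]; funext; simp [State.kernel, f1.real 5 rfl]
    have hpj := hpar (j + 1) (by omega) (by omega)
    have hA' := hA (m - (j + 1)) (by omega)
    rw [show m - (m - (j + 1)) = j + 1 by omega] at hA'
    -- The levels count eliminated nodes and the rounds count restored ones: round `j` undoes the
    -- elimination of the node `j + 1`.
    have hlevs : lev (m - j) =
        absorb d (s.kernel d) (s.nat 16) (lev (m - (j + 1))) (j + 1) := by
      rw [show m - j = (m - (j + 1)) + 1 by omega, hlev, level,
        show m - (m - (j + 1)) = j + 1 by omega]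
    apply Tr.of_wp
    simp only [wp_seq, wp_setNat, NatExp.eval]
    refine (tr_pullBack (t := j + 1) (p := s.nat 16 (j + 1)) (by simpa [e0] using hd)
      (by simp [hi]) (by simp [e16, hi]) hpj.ne).wp ?_
    intro s2 t2 f2 h2 ht2
    refine (tr_multiplyMessage (t := j + 1) (p := s.nat 16 (j + 1)) (by norm_num) (by norm_num)
      (by norm_num) (by norm_num) (by norm_num) (by simpa [f2.nat 0 rfl, e0] using hd)
      (by simp [f2.nat 50 rfl, hi]) (by simp [f2.nat 51 rfl, e16, hi])).wp ?_
    intro s3 t3 f3 h3 ht3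
    refine ⟨?_, fun c hc y hy => ?_⟩
    · simp [NatExp.cost] at ht2 ht3 ⊢
      have : d * (d * 200 + 300) = d * (d * 200 + 150) + d * 150 := by ring
      omega
    · rw [State.dual_setNat, h3 c y hy, h2 c y hy, TreeSum.deriv]
      simp only [State.dual_setNat, f2.dual 12 13 rfl rfl, e12, e14, ← hlevs, (hA' y hy).1]
      by_cases hcj : c = j + 1
      · subst hcj
        rw [if_neg hpj.ne', if_pos rfl, if_pos rfl]
        refine Finset.sum_congr rfl fun z hz => ?_
        have hz' := Finset.mem_range.1 hz
        rw [(hA' z hz').2, hI _ (by omega) z hz', ← hker]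
        rfl
      · simp only [if_neg hcj, hI c (by omega) y hy]
  · intro s1 t1 f1 h1 ht1
    refine ⟨?_, by simpa [hlev, level] using h1⟩
    simp [NatExp.cost] at ht1 ht0 ⊢
    have : m * (d * (d * 200 + 300) + 60 + 4 + 10) ≤ m * (d * (d * 200 + 350) + 100) :=
      Nat.mul_le_mul_left _ (by nlinarith)
    omega

end RealRAM

/-! ### Utilities, initial weights and rows of the Jacobian -/

namespace RealRAM

open TreeSum

/-- The sums of the utilities of the agent in the variable `33` that are assigned to each clique, in
the real array `7`; the variable `54` tells whether there are any. -/
def gatherUtilities : Program :=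
  .seq (forLoop 30 (.mul (.get 0 (.lit 3)) (.get 0 (.lit 4))) (.setReal 7 (.var 30) .zero)) <|
  .seq (.setNat 54 (.lit 0) (.lit 0)) <|
  forLoop 30 (.get 0 (.lit 2)) <|
    .ite (.natEq (.get 4 (.var 30)) (.var 33))
      (.seq (.setNat 54 (.lit 0) (.lit 1)) <|
       .seq (.setNat 46 (.lit 0) (.get 10 (.var 30))) <|
       .seq (.setNat 55 (.lit 0) (.get 15 (.var 46))) <|
       .seq (.setNat 47 (.lit 0) (.mul (.var 30) (.get 0 (.lit 1)))) <|
       forLoop 31 (.get 0 (.lit 4)) <|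
         .seq (.setNat 40 (.lit 0) (.var 31)) <|
         .seq (projectOnto 5) <|
         .setReal 7 (cell 55 31) (.add (.get 7 (cell 55 31))
           (.get 1 (.add (.mul (.var 30) (.get 0 (.lit 4))) (.var 42)))))
      .skip

/-- The sum of the utilities of the agent `i` that are assigned to the clique with the position
`t`, as computed from the memory. -/
noncomputable def State.utilitySum (s : State) (n u d i t x : ℕ) : ℝ :=
  ∑ j ∈ Finset.range u, if s.nat 4 j = i ∧ s.nat 15 (s.nat 10 j) = t then
    s.real 1 (j * d + project (s.nat 1) (fun w => s.nat 7 (s.nat 10 j * n + w))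
      (fun w => s.nat 5 (j * n + w)) n x) else 0

/-- Utilities add up where the other factors multiply, so they need a table of their own, starting
from zeros. The flag allows the expensive passes to be skipped for agents without utilities, which
is essential for the time bound. -/
theorem tr_gatherUtilities {s : State} {n u ℓ d m i : ℕ} {size : ℕ → ℕ} (hn : s.nat 0 1 = n)
    (hu : s.nat 0 2 = u) (hl : s.nat 0 3 = ℓ) (hd : s.nat 0 4 = d) (hi : s.nat 33 0 = i)
    (hhome : ∀ j < u, s.nat 10 j < ℓ)
    (hL : ∀ c < ℓ, Listed n n (s.nat 7) (s.nat 1) (s.nat 11) (s.nat 12) size c)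
    (hm : ∀ c < ℓ, s.nat 12 c ≤ m) (hpos : ∀ v < n, 0 < s.nat 1 v) :
    Tr gatherUtilities s (ℓ * d * 30 + u * (d * (projectCost m d + 80) + 100) + 50) fun s' =>
      (∀ t < ℓ, ∀ x < d, s'.real 7 (t * d + x) = s.utilitySum n u d i t x) ∧
      (s'.nat 54 0 = 0 ↔ ∀ j < u, s.nat 4 j ≠ i) := by
  apply Tr.of_wp
  rw [gatherUtilities, wp_seq]
  refine (Tr.row (fun s => s.real 7) (ℓ * d) 10 0 (fun _ => 0) rfl (by simp)
    (fun s' f => by simp [f.nat 0 rfl, hl, hd]) ?_).wp ?_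
  · intro c hc s1 f1 hc1 _
    apply Tr.of_wp
    simp [hc1, NatExp.cost, RealExp.cost]
  rintro s0 t0 f0 ⟨h0, -⟩ ht0
  have k0 := f0.nat 0 rfl
  have k1 := f0.nat 1 rfl
  have k4 := f0.nat 4 rfl
  have k5 := f0.nat 5 rfl
  have k7 := f0.nat 7 rfl
  have k10 := f0.nat 10 rfl
  have k11 := f0.nat 11 rfl
  have k12 := f0.nat 12 rfl
  have k15 := f0.nat 15 rfl
  have k33 := f0.nat 33 rfl
  have q1 := f0.real 1 rfl
  simp only [wp_seq, wp_setNat, NatExp.eval]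
  refine (Tr.forLoop u (d * (projectCost m d + 80) + 70) (fun j s' =>
      (∀ t < ℓ, ∀ x < d, s'.real 7 (t * d + x) = s.utilitySum n j d i t x) ∧
      (s'.nat 54 0 = 0 ↔ ∀ k < j, s.nat 4 k ≠ i)) rfl
    (fun s' f => by simp [f.nat 0 rfl, k0, hu]) ?_ ?_).wp ?_
  · refine ⟨fun t ht x hx => ?_, by simp⟩
    have : t * d + x < ℓ * d := by nlinarith
    simpa [State.utilitySum] using h0 _ this
  · intro j hj s1 f1 hj1 ⟨hI1, hI2⟩
    have e0 := f1.nat 0 rfl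
    have e1 := f1.nat 1 rfl
    have e4 := f1.nat 4 rfl
    have e5 := f1.nat 5 rfl
    have e7 := f1.nat 7 rfl
    have e10 := f1.nat 10 rfl
    have e11 := f1.nat 11 rfl
    have e12 := f1.nat 12 rfl
    have e15 := f1.nat 15 rfl
    have e33 := f1.nat 33 rfl
    have r1 := f1.real 1 rfl
    simp [k0, k1, k4, k5, k7, k10, k11, k12, k15, k33, q1] at e0 e1 e4 e5 e7 e10 e11 e12 e15 e33 r1
    apply Tr.of_wp
    by_cases hji : s.nat 4 j = i
    · simp only [wp_ite, Test.Holds, NatExp.eval, hj1, e4, e33, hi, hji, if_true, wp_seq, wp_setNat]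
      refine (Tr.row (fun s => s.real 7) d (projectCost m d + 60) (s.nat 15 (s.nat 10 j) * d)
        (fun x => s1.real 7 (s.nat 15 (s.nat 10 j) * d + x) + s.real 1 (j * d +
          project (s.nat 1) (fun w => s.nat 7 (s.nat 10 j * n + w))
          (fun w => s.nat 5 (j * n + w)) n x)) rfl (by simp)
        (fun s' f => by simp [f.nat 0 rfl, e0, hd]) ?_).wp ?_
      · intro x hx s2 f2 hx2 hold
        have g0 := f2.nat 0 rfl
        have g1 := f2.nat 1 rfl
        have g5 := f2.nat 5 rfl
        have g11 := f2.nat 11 rfl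
        have g12 := f2.nat 12 rfl
        have g30 := f2.nat 30 rfl
        have g46 := congrFun (f2.nat 46 rfl) 0
        have g47 := congrFun (f2.nat 47 rfl) 0
        have g55 := congrFun (f2.nat 55 rfl) 0
        have p1 := f2.real 1 rfl
        simp [e0, e1, e5, e11, e12, hj1, e10, hn, e15, r1] at g0 g1 g5 g11 g12 g30 g46 g47 g55 p1
        simp only [State.setNat_real] at hold
        apply Tr.of_wp
        simp only [wp_seq, wp_setNat, NatExp.eval]
        refine (tr_projectOnto (a := 5) (n := n) (m := m) (c := s.nat 10 j) (x := x) (bit := s.nat 7)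
          (size := size)
          (by norm_num) (by simp [g0, hn]) (by simp [g46]) (by simp [hx2])
          (by simpa [g1, g11, g12] using hL _ (hhome j hj))
          (by simpa [g12] using hm _ (hhome j hj)) (by simpa [g1] using hpos)).wp ?_
        intro s3 t3 f3 h3 ht3
        have l0 := f3.nat 0 rfl
        have l30 := f3.nat 30 rfl
        have l31 := f3.nat 31 rfl
        have l55 := f3.nat 55 rfl
        simp [g0, g1, g5, g30, g47] at l0 l30 l31 l55 h3
        have := projectCost_mono (k := m) hx.le
        simp [cell, l0, l30, l31, l55, h3, g55, hx2, hd, hj1, f3.real 1 rfl, p1, f3.real 7 rfl, hold,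
          NatExp.cost, RealExp.cost]
        omega
      · intro s2 t2 f2 ⟨h2, h2'⟩ ht2
        have l54 := congrFun (f2.nat 54 rfl) 0
        simp at l54 h2 h2'
        refine ⟨?_, fun t ht x hx => ?_, ?_⟩
        · simp [NatExp.cost, Test.cost] at ht2 ⊢
          have : d * (projectCost m d + 60 + 2 + 10) ≤ d * (projectCost m d + 80) :=
            Nat.mul_le_mul_left _ (by omega)
          omega
        · rw [State.setNat_real, State.utilitySum, Finset.sum_range_succ, ← State.utilitySum,
            ← hI1 t ht x hx]
          by_cases htp : s.nat 15 (s.nat 10 j) = t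
          · subst htp
            rw [if_pos ⟨hji, rfl⟩, h2 x hx]
          · rw [if_neg fun h => htp h.2, add_zero]
            refine h2' _ fun c hc => ?_
            rw [row_major_inj hx hc]; tauto
        · simp [l54]
          exact ⟨j, le_rfl, hji⟩
    · simp [hj1, e4, e33, hi, hji, NatExp.cost, Test.cost]
      refine ⟨fun t ht x hx => ?_, ?_⟩
      · rw [hI1 t ht x hx, State.utilitySum, State.utilitySum, Finset.sum_range_succ,
          if_neg fun h => hji h.1, add_zero]
      · rw [hI2]
        refine ⟨fun h k hk => ?_, fun h k hk => h k (by omega)⟩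
        rcases hk.lt_or_eq with hk | rfl
        · exact h k hk
        · exact hji
  · intro s2 t2 f2 h2 ht2
    refine ⟨?_, h2⟩
    simp [NatExp.cost] at ht0 ht2 ⊢
    have : u * (d * (projectCost m d + 80) + 70 + 2 + 10) ≤
      u * (d * (projectCost m d + 80) + 100) := Nat.mul_le_mul_left _ (by omega)
    omega

/-- The initial weights, dual numbers in the real arrays `8`, `9` and once more in the real
arrays `10`, `11`, for the terminal sequence with the number in the variable `34` of the agent whose
last decision variable is in the variable `52`; the position of its clique is in
the variable `53`. -/
def initWeights : Program :=
  .seq (forLoop 35 (.mul (.get 0 (.lit 3)) (.get 0 (.lit 4))) (.setReal 8 (.var 35)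
    (.get 4 (.var 35)))) <|
  .seq (forLoop 35 (.get 0 (.lit 4)) (.setReal 8 (cell 53 35) (.mul (.get 8 (cell 53 35))
    (.get 6 (.add (.mul (cell 52 35) (.get 0 (.lit 4))) (.var 34)))))) <|
  forLoop 35 (.mul (.get 0 (.lit 3)) (.get 0 (.lit 4))) <|
    .seq (.setReal 9 (.var 35) (.mul (.get 8 (.var 35)) (.get 7 (.var 35)))) <|
    .seq (.setReal 10 (.var 35) (.get 8 (.var 35))) <|
    .setReal 11 (.var 35) (.get 9 (.var 35))

/-- The weights for the sequence `h` of the agent whose last decision variable is `v`. -/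
noncomputable def nodeWeight (φ W E : ℕ → ℝ) (d v r h c x : ℕ) : DualNumber ℝ :=
  dualNumber (φ (c * d + x) * if c = r then E ((v * d + x) * d + h) else 1)
    ((φ (c * d + x) * if c = r then E ((v * d + x) * d + h) else 1) * W (c * d + x))

/-- The weights have the form `a (1 + ε W)` with the utilities as `W`. There are two copies: the
upward pass overwrites the one in `10`, `11`, while `writeRow` needs the original weights. -/
theorem tr_initWeights {s : State} {ℓ d v r h : ℕ} (hl : s.nat 0 3 = ℓ) (hd : s.nat 0 4 = d)
    (hv : s.nat 52 0 = v) (hr : s.nat 53 0 = r) (hh : s.nat 34 0 = h) :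
    Tr initWeights s (ℓ * d * 120 + d * 100 + 50) fun s' => ∀ c < ℓ, ∀ x < d,
      s'.dual 8 9 (c * d + x) = nodeWeight (s.real 4) (s.real 7) (s.real 6) d v r h c x ∧
      s'.dual 10 11 (c * d + x) = nodeWeight (s.real 4) (s.real 7) (s.real 6) d v r h c x := by
  apply Tr.of_wp
  simp only [initWeights, wp_seq]
  refine (Tr.row (fun s => s.real 8) (ℓ * d) 15 0 (fun t => s.real 4 t) rfl (by simp)
    (fun s' f => by simp [f.nat 0 rfl, hl, hd]) ?_).wp ?_
  · intro c hc s1 f1 hc1 _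
    apply Tr.of_wp
    simp [hc1, f1.real 4 rfl, NatExp.cost, RealExp.cost]
  rintro s1 t1 f1 ⟨h1, -⟩ ht1
  simp only [wp_seq]
  refine (Tr.row (fun s => s.real 8) d 80 (r * d)
    (fun x => s1.real 8 (r * d + x) * s.real 6 ((v * d + x) * d + h)) rfl (by simp)
    (fun s' f => by simp [f.nat 0 rfl, f1.nat 0 rfl, hd]) ?_).wp ?_
  · intro x hx s2 f2 hx2 hold
    apply Tr.of_wp
    have e0 := (f2.nat 0 rfl).trans (f1.nat 0 rfl)
    simp [cell, hx2, e0, f2.nat 34 rfl, f2.nat 52 rfl, f2.nat 53 rfl, f1.nat 34 rfl, f1.nat 52 rfl,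
      f1.nat 53 rfl, f2.real 6 rfl, f1.real 6 rfl, hd, hv, hr, hh, hold, NatExp.cost, RealExp.cost]
  rintro s2 t2 f2 ⟨h2, h2'⟩ ht2
  refine (Tr.row (fun s t => (s.dual 8 9 t, s.dual 10 11 t)) (ℓ * d) 50 0
    (fun t => (dualNumber (s2.real 8 t) (s2.real 8 t * s.real 7 t),
      dualNumber (s2.real 8 t) (s2.real 8 t * s.real 7 t))) rfl (by simp)
    (fun s' f => by simp [f.nat 0 rfl, f2.nat 0 rfl, f1.nat 0 rfl, hl, hd]) ?_).wp ?_
  · intro t ht s3 f3 ht3 _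
    apply Tr.of_wp
    simp only [wp_seq, wp_setReal]
    refine ⟨by simp [NatExp.cost, RealExp.cost], ?_⟩
    have r7 := ((f3.real 7 rfl).trans (f2.real 7 rfl)).trans (f1.real 7 rfl)
    funext i
    by_cases hit : i = t
    · subst hit
      simp [ht3, State.dual, f3.real 8 rfl, r7]
    · simp [ht3, State.dual, hit]
  rintro s3 t3 f3 ⟨h3, -⟩ ht3
  refine ⟨?_, fun c hc x hx => ?_⟩
  · simp [NatExp.cost] at ht1 ht2 ht3 ⊢
    omega
  · have hlt : c * d + x < ℓ * d := by nlinarith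
    have hw : dualNumber (s2.real 8 (c * d + x)) (s2.real 8 (c * d + x) * s.real 7 (c * d + x)) =
        nodeWeight (s.real 4) (s.real 7) (s.real 6) d v r h c x := by
      have h8 : s2.real 8 (c * d + x) =
          s.real 4 (c * d + x) * if c = r then s.real 6 ((v * d + x) * d + h) else 1 := by
        have h1' := h1 _ hlt
        simp only [Nat.zero_add] at h1'
        split_ifs with hcr
        · subst hcr; rw [h2 x hx, h1']
        · rw [h2' _ fun c' hc' => by rw [ne_eq, row_major_inj hx hc']; tauto, h1', mul_one]
      rw [nodeWeight, h8]
    have := h3 _ hlt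
    simp only [Nat.zero_add, Prod.mk.injEq, hw] at this
    exact this

/-- The row of the Jacobian for the sequence with the number in the variable `34` of the agent in
the variable `33`. -/
def writeRow : Program :=
  forLoop 35 (.get 0 (.lit 0)) <|
    .seq (.setNat 48 (.lit 0) (.sub (.get 20 (.var 35)) (.lit 1))) <|
    .seq (.setNat 46 (.lit 0) (.get 15 (.get 9 (.var 48)))) <|
    forLoop 36 (.get 0 (.lit 4)) <|
      .seq (sumLoop 37 (.get 0 (.lit 4)) 18
        (.mul (.get 6 (.add (.mul (cell 48 37) (.get 0 (.lit 4))) (.var 36)))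
          (.add (.mul (.get 8 (cell 46 37)) (.get 17 (cell 46 37)))
            (.mul (.get 9 (cell 46 37)) (.get 16 (cell 46 37)))))) <|
      .ite (.natEq (.var 33) (.var 35))
        (.setReal 3 (.add (.mul (cell 33 34) (.mul (.get 0 (.lit 0)) (.get 0 (.lit 4))))
          (cell 35 36)) .zero)
        (.setReal 3 (.add (.mul (cell 33 34) (.mul (.get 0 (.lit 0)) (.get 0 (.lit 4))))
          (cell 35 36)) (.div (.get 18 (.lit 0))
            (.mul (.get 2 (cell 33 34)) (.get 2 (cell 35 36)))))

/-- For a fixed clique, weight times derivative is the contribution of one clique assignment to the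
total. Summing over the assignments that match the column sequence inserts its indicator afterwards,
at a cost of `d` per column. -/
theorem tr_writeRow {s : State} {N d i h : ℕ} (hN : s.nat 0 0 = N) (hd : s.nat 0 4 = d)
    (hi : s.nat 33 0 = i) (hh : s.nat 34 0 = h) :
    Tr writeRow s (N * (d * (d * 100 + 200) + 100) + 10) fun s' =>
      (∀ k < N, ∀ y < d, s'.real 3 ((i * d + h) * (N * d) + (k * d + y)) =
        if i = k then 0 else (∑ x ∈ Finset.range d,
          s.real 6 (((s.nat 20 k - 1) * d + x) * d + y) *
          (s.dual 8 9 (s.nat 15 (s.nat 9 (s.nat 20 k - 1)) * d + x) *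
            s.dual 16 17 (s.nat 15 (s.nat 9 (s.nat 20 k - 1)) * d + x)).snd) /
          (s.real 2 (i * d + h) * s.real 2 (k * d + y))) ∧
      ∀ t, (∀ k < N, ∀ y < d, t ≠ (i * d + h) * (N * d) + (k * d + y)) →
        s'.real 3 t = s.real 3 t := by
  refine (Tr.table_at (fun s => s.real 3) N d (d * (d * 100 + 200) + 80) ((i * d + h) * (N * d)) _
    rfl (by simp) (fun s' f => by simp [f.nat 0 rfl, hN]) ?_).mono
    (loop_cost_le (by simp [NatExp.cost]) (by simp [NatExp.cost])) fun _ _ h => h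
  intro k hk s1 f1 hk1
  have e0 := f1.nat 0 rfl
  have e20 := f1.nat 20 rfl
  have e15 := f1.nat 15 rfl
  have e9 := f1.nat 9 rfl
  have e33 := f1.nat 33 rfl
  have e34 := f1.nat 34 rfl
  have r2 := f1.real 2 rfl
  have r6 := f1.real 6 rfl
  have r8 := f1.real 8 rfl
  have r9 := f1.real 9 rfl
  have r16 := f1.real 16 rfl
  have r17 := f1.real 17 rfl
  apply Tr.of_wp
  simp only [wp_seq, wp_setNat, NatExp.eval]
  refine (Tr.row (fun s => s.real 3) d (d * 100 + 180) ((i * d + h) * (N * d) + k * d)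
    (fun y => if i = k then 0 else (∑ x ∈ Finset.range d,
          s.real 6 (((s.nat 20 k - 1) * d + x) * d + y) *
          (s.dual 8 9 (s.nat 15 (s.nat 9 (s.nat 20 k - 1)) * d + x) *
            s.dual 16 17 (s.nat 15 (s.nat 9 (s.nat 20 k - 1)) * d + x)).snd) /
          (s.real 2 (i * d + h) * s.real 2 (k * d + y)))
    rfl (by simp) (fun s' f => by simp [f.nat 0 rfl, e0, hd]) ?_).wp ?_
  · intro y hy s2 f2 hy2 _
    have g0 := f2.nat 0 rfl
    have g33 := f2.nat 33 rfl
    have g34 := f2.nat 34 rfl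
    have g35 := f2.nat 35 rfl
    have g46 := congrFun (f2.nat 46 rfl) 0
    have g48 := congrFun (f2.nat 48 rfl) 0
    have p2 := (f2.real 2 rfl).trans r2
    have p6 := (f2.real 6 rfl).trans r6
    have p8 := (f2.real 8 rfl).trans r8
    have p9 := (f2.real 9 rfl).trans r9
    have p16 := (f2.real 16 rfl).trans r16
    have p17 := (f2.real 17 rfl).trans r17
    simp [e0, e20, e15, e9, e33, e34, hk1] at g0 g33 g34 g35 g46 g48
    apply Tr.of_wp
    simp only [wp_seq]
    refine (Tr.sumLoop d (fun x => s.real 6 (((s.nat 20 k - 1) * d + x) * d + y) *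
          (s.dual 8 9 (s.nat 15 (s.nat 9 (s.nat 20 k - 1)) * d + x) *
            s.dual 16 17 (s.nat 15 (s.nat 9 (s.nat 20 k - 1)) * d + x)).snd)
      (fun s' f => by simp [f.nat 0 rfl, g0, hd]) ?_).wp ?_
    · intro x hx s3 f3 hx3
      simp [cell, f3.nat 0 rfl, f3.nat 46 rfl, f3.nat 48 rfl, f3.nat 36 rfl, f3.real 6 rfl,
        f3.real 8 rfl, f3.real 9 rfl, f3.real 16 rfl, f3.real 17 rfl, g0, g46, g48, hx3, hy2, hd,
        p6, p8, p9, p16, p17, State.dual]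
    · intro s3 t3 f3 h18 ht3
      by_cases hik : i = k
      · simp [cell, f3.nat 0 rfl, f3.nat 33 rfl, f3.nat 34 rfl, f3.nat 35 rfl, f3.nat 36 rfl,
          f3.real 3 rfl, g0, g33, g34, g35, hk1, hy2, hd, hN, hi, hh, hik, Nat.add_assoc,
          NatExp.cost, RealExp.cost, Test.cost] at ht3 ⊢
        omega
      · simp [cell, f3.nat 0 rfl, f3.nat 33 rfl, f3.nat 34 rfl, f3.nat 35 rfl, f3.nat 36 rfl,
          f3.real 3 rfl, f3.real 2 rfl, p2, g0, g33, g34, g35, hk1, hy2, hd, hN, hi, hh, hik, h18,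
          Nat.add_assoc, NatExp.cost, RealExp.cost, Test.cost] at ht3 ⊢
        omega
  · intro s2 t2 f2 h2 ht2
    refine ⟨?_, by simpa only [Nat.add_assoc, State.setNat_real] using h2⟩
    simp [NatExp.cost] at ht2 ⊢
    have : d * (d * 100 + 180 + 2 + 10) ≤ d * (d * 100 + 200) := Nat.mul_le_mul_left _ (by omega)
    omega

end RealRAM

/-! ### Evaluation for all agents and terminal sequences -/

namespace RealRAM

open TreeSum

/-- The rows of the Jacobian for the agent in the variable `33`. -/
def agentPass : Program :=
  .seq gatherUtilities <|
  .ite (.natEq (.var 54) (.lit 0)) .skip <|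
    .seq (.setNat 52 (.lit 0) (.sub (.get 20 (.var 33)) (.lit 1))) <|
    .seq (.setNat 53 (.lit 0) (.get 15 (.get 9 (.var 52)))) <|
    forLoop 34 (.get 0 (.lit 4)) <|
      .seq initWeights <| .seq upwardPass <| .seq downwardPass writeRow

/-- The weights for the sequence `h` of the agent `i`, as computed from the memory. -/
noncomputable def State.agentWeight (s : State) (n u d i h c x : ℕ) : DualNumber ℝ :=
  dualNumber (s.real 4 (c * d + x) * if c = s.nat 15 (s.nat 9 (s.nat 20 i - 1)) then
      s.real 6 (((s.nat 20 i - 1) * d + x) * d + h) else 1)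
    ((s.real 4 (c * d + x) * if c = s.nat 15 (s.nat 9 (s.nat 20 i - 1)) then
      s.real 6 (((s.nat 20 i - 1) * d + x) * d + h) else 1) * s.utilitySum n u d i c x)

/-- The entry of the Jacobian for the sequences `h` of the agent `i` and `y` of the agent `k`, as
computed from the memory. -/
noncomputable def State.entry (s : State) (n u m d i h k y : ℕ) : ℝ :=
  if i = k ∨ ∀ j < u, s.nat 4 j ≠ i then 0 else (∑ x ∈ Finset.range d,
    s.real 6 (((s.nat 20 k - 1) * d + x) * d + y) *
    (s.agentWeight n u d i h (s.nat 15 (s.nat 9 (s.nat 20 k - 1))) x *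
      TreeSum.deriv d (s.kernel d) (s.nat 16) m (s.agentWeight n u d i h)
        (s.nat 15 (s.nat 9 (s.nat 20 k - 1))) x).snd) /
    (s.real 2 (i * d + h) * s.real 2 (k * d + y))

/-- The preprocessed data on which the computation of the Jacobian relies. -/
structure Prepared (s : State) (N n u m d L : ℕ) (size : ℕ → ℕ) : Prop where
  size_agents : s.nat 0 0 = N
  size_vars : s.nat 0 1 = n
  size_utils : s.nat 0 2 = u
  size_cliques : s.nat 0 3 = m + 1
  size_max : s.nat 0 4 = d
  util_home : ∀ j < u, s.nat 10 j < m + 1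
  listed : ∀ c < m + 1, Listed n n (s.nat 7) (s.nat 1) (s.nat 11) (s.nat 12) size c
  len_le : ∀ c < m + 1, s.nat 12 c ≤ L
  card_pos : ∀ v < n, 0 < s.nat 1 v
  par_lt : ∀ t ≤ m, 0 < t → s.nat 16 t < t
  pos_le : ∀ k < N, s.nat 15 (s.nat 9 (s.nat 20 k - 1)) ≤ m

/-- A bound for the number of steps of the computation for one terminal sequence. -/
def sequenceCost (N m d : ℕ) : ℕ :=
  (m + 1) * d * 120 + m * (d * (d * 350 + 700) + 200) + N * (d * (d * 100 + 200) + 100) + d * 150 + 150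

/-- The case distinction in the bound separates the gathering of utilities, paid by every agent,
from the `d` pairs of passes, paid only by agents with utilities. The last clause keeps the rows of
other agents intact. -/
theorem tr_agentPass {s : State} {N n u m d L i : ℕ} {size : ℕ → ℕ}
    (H : Prepared s N n u m d L size) (hi : s.nat 33 0 = i) :
    Tr agentPass s ((m + 1) * d * 30 + u * (d * (projectCost L d + 80) + 100) + 100 +
      if ∀ j < u, s.nat 4 j ≠ i then 0 else d * (sequenceCost N m d + 20)) fun s' =>
      (∀ h < d, ∀ k < N, ∀ y < d, (∃ j < u, s.nat 4 j = i) →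
        s'.real 3 ((i * d + h) * (N * d) + (k * d + y)) = s.entry n u m d i h k y) ∧
      ((∀ j < u, s.nat 4 j ≠ i) → s'.real 3 = s.real 3) ∧
      ∀ t, (∀ h < d, ∀ k < N, ∀ y < d, t ≠ (i * d + h) * (N * d) + (k * d + y)) →
        s'.real 3 t = s.real 3 t := by
  apply Tr.of_wp
  rw [agentPass, wp_seq]
  refine (tr_gatherUtilities H.size_vars H.size_utils H.size_cliques H.size_max hi H.util_home
    H.listed H.len_le H.card_pos).wp ?_
  intro s1 t1 f1 ⟨h7, h54⟩ ht1
  by_cases hu : ∀ j < u, s.nat 4 j ≠ i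
  · have h0 := h54.2 hu
    have e3 := f1.real 3 rfl
    simp [h0, e3, NatExp.cost, Test.cost]
    refine ⟨by omega, ?_⟩
    intro h _ k _ y _ j hj hji
    exact absurd hji (hu j hj)
  have h0 : s1.nat 54 0 ≠ 0 := fun h => hu (h54.1 h)
  have e0 := f1.nat 0 rfl
  have e9 := f1.nat 9 rfl
  have e15 := f1.nat 15 rfl
  have e16 := f1.nat 16 rfl
  have e20 := f1.nat 20 rfl
  have e33 := f1.nat 33 rfl
  have r2 := f1.real 2 rfl
  have r3 := f1.real 3 rfl
  have r4 := f1.real 4 rfl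
  have r5 := f1.real 5 rfl
  have r6 := f1.real 6 rfl
  simp only [wp_ite, Test.Holds, NatExp.eval, h0, if_false, hu, wp_seq, wp_setNat]
  refine (Tr.forLoop d (sequenceCost N m d) (fun j s' =>
      (∀ h < j, ∀ k < N, ∀ y < d,
        s'.real 3 ((i * d + h) * (N * d) + (k * d + y)) = s.entry n u m d i h k y) ∧
      ∀ t, (∀ h < j, ∀ k < N, ∀ y < d, t ≠ (i * d + h) * (N * d) + (k * d + y)) →
        s'.real 3 t = s.real 3 t) rfl
    (fun s' f => by simp [f.nat 0 rfl, e0, H.size_max]) (by simp [r3]) ?_).wp ?_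
  · intro h hh s2 f2 hh2 ⟨hI1, hI2⟩
    have g0 := f2.nat 0 rfl
    have g9 := f2.nat 9 rfl
    have g15 := f2.nat 15 rfl
    have g16 := f2.nat 16 rfl
    have g20 := f2.nat 20 rfl
    have g33 := f2.nat 33 rfl
    have g52 := congrFun (f2.nat 52 rfl) 0
    have g53 := congrFun (f2.nat 53 rfl) 0
    have p2 := f2.real 2 rfl
    have p4 := f2.real 4 rfl
    have p5 := f2.real 5 rfl
    have p6 := f2.real 6 rfl
    have p7 := f2.real 7 rfl
    simp [e0, e9, e15, e16, e20, e33, r2, r4, r5, r6, hi] at g0 g9 g15 g16 g20 g33 g52 g53 p2 p4 p5 p6 p7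
    apply Tr.of_wp
    simp only [wp_seq]
    refine (tr_initWeights (ℓ := m + 1) (d := d) (by rw [g0]; exact H.size_cliques)
      (by rw [g0]; exact H.size_max) g52 g53 hh2).wp ?_
    intro s3 t3 f3 h3 ht3
    rw [p4, p6, p7] at h3
    have hw : ∀ c ≤ m, ∀ x < d, nodeWeight (s.real 4) (s1.real 7) (s.real 6) d (s.nat 20 i - 1)
        (s.nat 15 (s.nat 9 (s.nat 20 i - 1))) h c x = s.agentWeight n u d i h c x := by
      intro c hc x hx
      rw [nodeWeight, State.agentWeight, h7 c (by omega) x hx]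
    have k0 := (f3.nat 0 rfl).trans g0
    have k16 := (f3.nat 16 rfl).trans g16
    have hker : s3.kernel d = s.kernel d := by
      funext; simp [State.kernel, (f3.real 5 rfl).trans p5]
    simp only [wp_seq]
    refine (tr_upwardPass (m := m) (d := d) (A := s.agentWeight n u d i h) (by rw [k0]; exact H.size_cliques)
      (by rw [k0]; exact H.size_max) (by rw [k16]; exact H.par_lt)
      fun c hc y hy => by rw [(h3 c (by omega) y hy).2, hw c hc y hy]).wp ?_
    intro s4 t4 f4 h4 ht4
    have l0 := (f4.nat 0 rfl).trans k0
    have l16 := (f4.nat 16 rfl).trans k16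
    have hker4 : s4.kernel d = s.kernel d := by
      rw [← hker]; funext; simp [State.kernel, f4.real 5 rfl]
    rw [hker, k16] at h4
    simp only [wp_seq]
    refine (tr_downwardPass (m := m) (d := d) (A := s.agentWeight n u d i h) (by rw [l0]; exact H.size_cliques)
      (by rw [l0]; exact H.size_max) (by rw [l16]; exact H.par_lt)
      (by rw [hker4, l16]; exact h4)).wp ?_
    intro s5 t5 f5 h5 ht5
    rw [hker4, l16] at h5
    have n0 := (f5.nat 0 rfl).trans l0
    refine (tr_writeRow (N := N) (d := d) (i := i) (h := h) (by rw [n0]; exact H.size_agents)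
      (by rw [n0]; exact H.size_max)
      (by rw [f5.nat 33 rfl, f4.nat 33 rfl, f3.nat 33 rfl, g33]; exact hi)
      (by rw [f5.nat 34 rfl, f4.nat 34 rfl, f3.nat 34 rfl]; exact hh2)).wp ?_
    intro s6 t6 f6 ⟨h6, h6'⟩ ht6
    have b20 : s5.nat 20 = s.nat 20 := by rw [f5.nat 20 rfl, f4.nat 20 rfl, f3.nat 20 rfl, g20]
    have b15 : s5.nat 15 = s.nat 15 := by rw [f5.nat 15 rfl, f4.nat 15 rfl, f3.nat 15 rfl, g15]
    have b9 : s5.nat 9 = s.nat 9 := by rw [f5.nat 9 rfl, f4.nat 9 rfl, f3.nat 9 rfl, g9]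
    have c6 : s5.real 6 = s.real 6 := by rw [f5.real 6 rfl, f4.real 6 rfl, f3.real 6 rfl, p6]
    have c2 : s5.real 2 = s.real 2 := by rw [f5.real 2 rfl, f4.real 2 rfl, f3.real 2 rfl, p2]
    have c3 : s5.real 3 = s2.real 3 := by rw [f5.real 3 rfl, f4.real 3 rfl, f3.real 3 rfl]
    have c8 : s5.dual 8 9 = s3.dual 8 9 := by
      rw [f5.dual 8 9 rfl rfl, f4.dual 8 9 rfl rfl]
    rw [b20, b15, b9, c6, c2, c8] at h6
    refine ⟨?_, fun h' hh' k hk y hy => ?_, fun t ht => ?_⟩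
    · simp only [sequenceCost]
      have : m * (d * (d * 350 + 700) + 200) = m * (d * (d * 150 + 350) + 100) +
        m * (d * (d * 200 + 350) + 100) := by ring
      omega
    · rw [State.setNat_real]
      rcases Nat.lt_succ_iff_lt_or_eq.1 hh' with hh' | rfl
      · rw [h6', c3, hI1 h' hh' k hk y hy]
        intro k' hk' y' hy'
        have hlt : ∀ {k y : ℕ}, k < N → y < d → k * d + y < N * d := fun hk hy => by nlinarith
        rw [ne_eq, row_major_inj (hlt hk hy) (hlt hk' hy'),
          row_major_inj (hh'.trans hh) hh]
        omega
      · rw [h6 k hk y hy, State.entry]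
        by_cases hik : i = k
        · simp [hik]
        · rw [if_neg hik, if_neg (by tauto)]
          congr 1
          refine Finset.sum_congr rfl fun x hx => ?_
          have hx' := Finset.mem_range.1 hx
          have hp := H.pos_le k hk
          rw [(h3 _ (by omega) x hx').1, hw _ hp x hx', h5 _ hp x hx']
    · rw [State.setNat_real, h6' t (ht h (by omega)), c3]
      exact hI2 t fun h' hh' => ht h' (by omega)
  · intro s2 t2 f2 ⟨h2, h2'⟩ ht2
    refine ⟨?_, fun h hh k hk y hy _ => h2 h hh k hk y hy, fun h => h.elim, h2'⟩
    simp [NatExp.cost, Test.cost] at ht2 ⊢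
    have : d * (sequenceCost N m d + 2 + 10) ≤ d * (sequenceCost N m d + 20) :=
      Nat.mul_le_mul_left _ (by omega)
    omega

/-- The computation of the Jacobian from the preprocessed data. -/
def evaluate : Program := forLoop 33 (.get 0 (.lit 0)) agentPass

/-- Only the agents that receive a utility contribute to the term with `sequenceCost`; counting
them, rather than all `N` agents, makes the term `ℓ² d³` possible. -/
theorem tr_evaluate {s : State} {N n u m d L : ℕ} {size : ℕ → ℕ}
    (H : Prepared s N n u m d L size) (h3 : s.real 3 = fun _ => 0) :
    Tr evaluate s (N * ((m + 1) * d * 30 + u * (d * (projectCost L d + 80) + 100) + 120) +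
      ((Finset.range N).filter fun i => ∃ j < u, s.nat 4 j = i).card *
        (d * (sequenceCost N m d + 20)) + 10) fun s' =>
      ∀ i < N, ∀ h < d, ∀ k < N, ∀ y < d,
        s'.real 3 ((i * d + h) * (N * d) + (k * d + y)) = s.entry n u m d i h k y := by
  refine (Tr.forLoop_sum N (fun i => (m + 1) * d * 30 + u * (d * (projectCost L d + 80) + 100) + 100 +
      if ∀ j < u, s.nat 4 j ≠ i then 0 else d * (sequenceCost N m d + 20))
    (fun j s' => (∀ i < j, ∀ h < d, ∀ k < N, ∀ y < d,
        s'.real 3 ((i * d + h) * (N * d) + (k * d + y)) = s.entry n u m d i h k y) ∧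
      ∀ t, (∀ i < j, ∀ h < d, ∀ k < N, ∀ y < d, t ≠ (i * d + h) * (N * d) + (k * d + y)) →
        s'.real 3 t = 0) rfl (fun s' f => by simp [f.nat 0 rfl, H.size_agents])
    (by simp [h3]) ?_).mono ?_ fun _ _ h => h.1
  · intro i hi s1 f1 hi1 ⟨hI1, hI2⟩
    have e0 := f1.nat 0 rfl
    have e1 := f1.nat 1 rfl
    have e4 := f1.nat 4 rfl
    have e5 := f1.nat 5 rfl
    have e7 := f1.nat 7 rfl
    have e9 := f1.nat 9 rfl
    have e10 := f1.nat 10 rfl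
    have e11 := f1.nat 11 rfl
    have e12 := f1.nat 12 rfl
    have e15 := f1.nat 15 rfl
    have e16 := f1.nat 16 rfl
    have e20 := f1.nat 20 rfl
    have r1 := f1.real 1 rfl
    have r2 := f1.real 2 rfl
    have r4 := f1.real 4 rfl
    have r5 := f1.real 5 rfl
    have r6 := f1.real 6 rfl
    have H1 : Prepared s1 N n u m d L size := by
      constructor <;> simp only [e0, e1, e7, e9, e10, e11, e12, e15, e16, e20]
      exacts [H.size_agents, H.size_vars, H.size_utils, H.size_cliques, H.size_max, H.util_home,
        H.listed, H.len_le, H.card_pos, H.par_lt, H.pos_le]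
    have hent : ∀ h k y, s1.entry n u m d i h k y = s.entry n u m d i h k y := by
      intro h k y
      have hker : s1.kernel d = s.kernel d := by funext; simp [State.kernel, r5]
      have hsum : ∀ c x, s1.utilitySum n u d i c x = s.utilitySum n u d i c x := by
        intro c x; simp only [State.utilitySum, e4, e15, e10, r1, e1, e7, e5]
      have hwt : s1.agentWeight n u d i h = s.agentWeight n u d i h := by
        funext c x; simp only [State.agentWeight, hsum, r4, r6, e15, e9, e20]
      simp only [State.entry, hker, hwt, e4, r6, r2, e15, e9, e20, e16]
    have hinj : ∀ {i h k y i' h' k' y' : ℕ}, h < d → k < N → y < d → h' < d → k' < N → y' < d →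
        (i * d + h) * (N * d) + (k * d + y) = (i' * d + h') * (N * d) + (k' * d + y') →
        i = i' := by
      intro i h k y i' h' k' y' hh hk hy hh' hk' hy' heq
      have hlt : ∀ {k y : ℕ}, k < N → y < d → k * d + y < N * d := fun hk hy => by nlinarith
      rw [row_major_inj (hlt hk hy) (hlt hk' hy'), row_major_inj hh hh'] at heq
      exact heq.1.1
    refine (tr_agentPass H1 hi1).mono (by simp only [e4]; exact le_rfl) ?_
    rw [e4]
    intro s2 f2 ⟨h2, h2', h2''⟩
    refine ⟨fun i' hi' h hh k hk y hy => ?_, fun t ht => ?_⟩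
    · rw [State.setNat_real]
      rcases Nat.lt_succ_iff_lt_or_eq.1 hi' with hi' | rfl
      · rw [h2'' _ fun h'' hh'' k'' hk'' y'' hy'' heq => ?_, hI1 i' hi' h hh k hk y hy]
        exact hi'.ne (hinj hh hk hy hh'' hk'' hy'' heq)
      · by_cases hu : ∃ j < u, s.nat 4 j = i'
        · rw [h2 h hh k hk y hy hu, hent]
        · push Not at hu
          -- No row is written for an agent without utilities; its cells still hold the zeros of the
          -- initial memory.
          rw [h2' hu, hI2, State.entry, if_pos (.inr hu)]
          intro i'' hi'' h'' hh'' k'' hk'' y'' hy'' heq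
          exact hi''.ne' (hinj hh hk hy hh'' hk'' hy'' heq)
    · rw [State.setNat_real, h2'' t (ht i (by omega))]
      exact hI2 t fun i' hi' => ht i' (by omega)
  · simp only [NatExp.cost, Finset.sum_add_distrib, Finset.sum_const, Finset.card_range,
      smul_eq_mul]
    have : ∀ i, (if ∀ j < u, s.nat 4 j ≠ i then 0 else d * (sequenceCost N m d + 20)) =
        if ∃ j < u, s.nat 4 j = i then d * (sequenceCost N m d + 20) else 0 := by
      intro i
      by_cases h : ∃ j < u, s.nat 4 j = i
      · rw [if_pos h, if_neg (by push Not; exact h)]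
      · rw [if_neg h, if_pos (by push Not at h; exact h)]
    simp only [this]
    rw [← Finset.sum_filter, Finset.sum_const, smul_eq_mul]
    have : N * ((m + 1) * d * 30 + u * (d * (projectCost L d + 80) + 100) + 120) =
      N * ((m + 1) * d * 30) + N * (u * (d * (projectCost L d + 80) + 100)) + N * 100 + N * 20 := by
      ring
    omega

end RealRAM

/-! ### Mixed radix numbers -/

namespace RealRAM

/-- The number of the digits `a w` for `w < m` with `b w = 1`, in the mixed radix system `card`. -/
def encodeDigits (card b a : ℕ → ℕ) (m : ℕ) : ℕ :=
  ∑ w ∈ Finset.range m, if b w = 1 then a w * weight card b w else 0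

theorem weight_succ (card b : ℕ → ℕ) (m : ℕ) :
    weight card b (m + 1) = weight card b m * if b m = 1 then card m else 1 :=
  Finset.prod_range_succ _ _

theorem weight_congr {card b b' : ℕ → ℕ} {m : ℕ} (h : ∀ w < m, b w = 1 ↔ b' w = 1) :
    weight card b m = weight card b' m :=
  Finset.prod_congr rfl fun w hw => by simp only [h w (Finset.mem_range.1 hw)]

theorem project_congr {card b b' e e' : ℕ → ℕ} {n : ℕ} (h : ∀ w < n, b w = b' w)
    (h' : ∀ w < n, e w = e' w) (x : ℕ) : project card b e n x = project card b' e' n x := by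
  refine Finset.sum_congr rfl fun w hw => ?_
  have hw := Finset.mem_range.1 hw
  rw [h w hw, h' w hw, weight_congr (b := b) (b' := b') fun v hv => by rw [h v (by omega)],
    weight_congr (b := fun w => b w * e w) (b' := fun w => b' w * e' w) fun v hv => by
      rw [h v (by omega), h' v (by omega)]]

theorem encodeDigits_lt {card b a : ℕ → ℕ} {m : ℕ} (h : ∀ w < m, a w < card w) :
    encodeDigits card b a m < weight card b m := by
  induction m with
  | zero => simp [encodeDigits, weight]
  | succ m ih =>
    have ih := ih fun w hw => h w (by omega)
    rw [weight_succ, encodeDigits, Finset.sum_range_succ, ← encodeDigits]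
    have := h m (by omega)
    split_ifs with hb
    · nlinarith
    · simpa using ih

/-- The weight of each digit above `v` is a multiple of the weight of `v` times `card v`. The lower
digits add up to less than the weight of `v`, so division and remainder isolate the digit at `v`. -/
theorem exists_encodeDigits_eq {card b a : ℕ → ℕ} {v n : ℕ} (hv : v < n) (hb : b v = 1) :
    ∃ r, encodeDigits card b a n = encodeDigits card b a v + weight card b v * (a v + card v * r) := by
  induction n with
  | zero => omega
  | succ n ih =>
    rw [encodeDigits, Finset.sum_range_succ, ← encodeDigits]
    rcases Nat.lt_succ_iff_lt_or_eq.1 hv with hv | rfl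
    · obtain ⟨r, hr⟩ := ih hv
      have hdvd : weight card b (v + 1) ∣ weight card b n :=
        Finset.prod_dvd_prod_of_subset _ _ _ (Finset.range_mono hv)
      obtain ⟨q, hq⟩ := hdvd
      rw [weight_succ, if_pos hb] at hq
      rw [hr, hq]
      split_ifs
      · exact ⟨r + a n * q, by ring⟩
      · exact ⟨r, by ring⟩
    · exact ⟨0, by rw [if_pos hb]; ring⟩

theorem encodeDigits_digit {card b a : ℕ → ℕ} {v n : ℕ} (h : ∀ w < n, a w < card w) (hv : v < n)
    (hb : b v = 1) : encodeDigits card b a n / weight card b v % card v = a v := by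
  obtain ⟨r, hr⟩ := exists_encodeDigits_eq (card := card) (a := a) hv hb
  have hlt := encodeDigits_lt (b := b) fun w (hw : w < v) => h w (by omega)
  rw [hr, Nat.add_mul_div_left _ _ (by omega), Nat.div_eq_of_lt hlt, zero_add,
    Nat.add_mul_mod_self_left, Nat.mod_eq_of_lt (h v hv)]

/-- The digits read off by division are the original ones, and `project` puts them together again
with the weights for the smaller set. -/
theorem project_encodeDigits {card b e a : ℕ → ℕ} {n : ℕ} (h : ∀ w < n, a w < card w)
    (hb : ∀ w < n, b w ≤ 1) (he : ∀ w < n, e w ≤ 1) :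
    project card b e n (encodeDigits card b a n) =
      encodeDigits card (fun w => b w * e w) a n := by
  refine Finset.sum_congr rfl fun w hw => ?_
  have hw := Finset.mem_range.1 hw
  have hiff : b w * e w = 1 ↔ b w = 1 ∧ e w = 1 := by
    have := hb w hw
    have := he w hw
    rcases Nat.le_one_iff_eq_zero_or_eq_one.1 (hb w hw) with h1 | h1 <;> simp [h1]
  simp only [hiff]
  split_ifs with hbe
  · rw [encodeDigits_digit h hw hbe.1]
  · rfl

/-- Reassembling the digits of a number gives it back modulo the number of assignments. Hence every
number in range is attained, which is the basis of `encode_decode`. -/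
theorem encodeDigits_mod {card b : ℕ → ℕ} {m : ℕ} (x : ℕ) :
    encodeDigits card b (fun w => x / weight card b w % card w) m = x % weight card b m := by
  induction m with
  | zero => simp [encodeDigits, weight, Nat.mod_one]
  | succ m ih =>
    rw [encodeDigits, Finset.sum_range_succ, ← encodeDigits, ih, weight_succ]
    split_ifs
    · rw [Nat.mod_mul, mul_comm]
    · simp

end RealRAM

/-! ### Numbered assignments, and outcomes as compatible families of clique assignments -/

namespace MAID

open RealRAM

variable {N n u : ℕ} (G : MAID N n u)

/-- The bits of a set of variables. -/
def bits (S : Finset (Fin n)) (w : ℕ) : ℕ := if ∃ h : w < n, (⟨w, h⟩ : Fin n) ∈ S then 1 else 0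

theorem bits_le (S : Finset (Fin n)) (w : ℕ) : bits S w ≤ 1 := by
  unfold bits; split_ifs <;> simp

@[simp] theorem bits_val (S : Finset (Fin n)) (w : Fin n) : bits S w = if w ∈ S then 1 else 0 := by
  simp [bits]

theorem bits_mul (S S' : Finset (Fin n)) (w : ℕ) : bits S w * bits S' w = bits (S ∩ S') w := by
  unfold bits
  by_cases hw : w < n <;> simp [hw]
  split_ifs <;> simp_all

variable {G} in
/-- The values of the variables under an outcome. -/
def Outcome.digits (z : G.Outcome) (w : ℕ) : ℕ := if h : w < n then z ⟨w, h⟩ else 0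

variable {G} in
@[simp] theorem Outcome.digits_val (z : G.Outcome) (w : Fin n) : z.digits w = z w := by
  simp [Outcome.digits]

variable {G} in
theorem Outcome.digits_lt (z : G.Outcome) {w : ℕ} (hw : w < n) :
    z.digits w < natVector G.card w := by
  simp [Outcome.digits, natVector, hw]

theorem weight_bits (S : Finset (Fin n)) (w : Fin n) :
    weight (natVector G.card) (bits S) w = G.stride S w := by
  unfold weight stride
  have h1 : ∏ v ∈ Finset.range (w : ℕ), (if bits S v = 1 then natVector G.card v else 1) =
      ∏ v : Fin n, if v < w ∧ v ∈ S then G.card v else 1 := by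
    rw [← Finset.prod_subset (s₁ := Finset.univ.filter (· < w)) (Finset.subset_univ _)]
    · refine (Finset.prod_bij (fun (v : Fin n) _ => (v : ℕ)) ?_ ?_ ?_ ?_).symm
      · intro v hv; simpa using hv
      · intro v _ v' _ h; exact Fin.ext h
      · intro v hv
        have hv := Finset.mem_range.1 hv
        exact ⟨⟨v, by omega⟩, Finset.mem_filter.2 ⟨Finset.mem_univ _, hv⟩, rfl⟩
      · intro v hv
        have hv : v < w := by simpa using hv
        by_cases hvS : v ∈ S <;> simp [hv, hvS, natVector]
    · intro v _ hv
      have hv : ¬ v < w := by simpa using hv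
      rw [if_neg fun h => hv h.1]
  rw [h1, ← Finset.prod_filter]
  refine Finset.prod_congr ?_ fun _ _ => rfl
  ext v; simp [and_comm]

theorem weight_bits_eq_prod (S : Finset (Fin n)) :
    weight (natVector G.card) (bits S) n = ∏ v ∈ S, G.card v := by
  unfold weight
  rw [Finset.prod_range]
  simp only [bits_val]
  rw [← Finset.prod_filter_mul_prod_filter_not Finset.univ (· ∈ S)]
  rw [Finset.prod_congr (s₂ := S) (g := fun v => G.card v) (by ext; simp)]
  · rw [Finset.prod_eq_one (s := Finset.univ.filter (· ∉ S)), mul_one]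
    intro v hv
    simp_all
  · intro v hv; simp [hv, natVector]

theorem encode_on (S : Finset (Fin n)) (z : G.Outcome) :
    G.encode S (z.on S) = encodeDigits (natVector G.card) (bits S) z.digits n := by
  unfold encode encodeDigits
  rw [Finset.sum_range]
  simp only [bits_val, Outcome.digits_val, weight_bits, Outcome.on]
  rw [Finset.univ_eq_attach, Finset.sum_attach S fun w => (z w : ℕ) * G.stride S w]
  rw [← Finset.sum_filter_add_sum_filter_not Finset.univ (· ∈ S)]
  rw [Finset.sum_congr (s₂ := S) (g := fun v => (z v : ℕ) * G.stride S v)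
    (s₁ := Finset.univ.filter (· ∈ S)) (by ext; simp)]
  · rw [Finset.sum_eq_zero (s := Finset.univ.filter (· ∉ S)), add_zero]
    intro v hv
    simp_all
  · intro v hv; simp [hv]

theorem encode_on_lt (S : Finset (Fin n)) (z : G.Outcome) :
    G.encode S (z.on S) < ∏ v ∈ S, G.card v := by
  rw [encode_on, ← weight_bits_eq_prod]
  exact encodeDigits_lt fun w hw => z.digits_lt hw

theorem encode_on_inj {S : Finset (Fin n)} {z z' : G.Outcome} :
    G.encode S (z.on S) = G.encode S (z'.on S) ↔ ∀ v ∈ S, z v = z' v := by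
  constructor
  · intro h v hv
    rw [encode_on, encode_on] at h
    have h1 := encodeDigits_digit (b := bits S) (fun w hw => z.digits_lt hw) v.2 (by simp [hv])
    have h2 := encodeDigits_digit (b := bits S) (fun w hw => z'.digits_lt hw) v.2 (by simp [hv])
    rw [h, h2] at h1
    simpa [Fin.ext_iff] using h1.symm
  · intro h
    have : z.on S = z'.on S := funext fun w => h w.1 w.2
    rw [this]

theorem on_eq_on_iff {S : Finset (Fin n)} {z z' : G.Outcome} :
    z.on S = z'.on S ↔ ∀ v ∈ S, z v = z' v :=
  ⟨fun h v hv => congrFun h ⟨v, hv⟩, fun h => funext fun w => h w.1 w.2⟩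

theorem decode_encode {S : Finset (Fin n)} (z : G.Outcome) {v : Fin n} (hv : v ∈ S) :
    G.decode S (G.encode S (z.on S)) v = z v := by
  have h1 := encodeDigits_digit (b := bits S) (fun w hw => z.digits_lt hw) v.2 (by simp [hv])
  rw [weight_bits] at h1
  have hcard : natVector G.card v = G.card v := by simp [natVector]
  ext
  rw [decode, encode_on]
  rwa [hcard, Outcome.digits_val] at h1

theorem encode_decode {S : Finset (Fin n)} {x : ℕ} (hx : x < ∏ v ∈ S, G.card v) :
    G.encode S ((G.decode S x).on S) = x := by
  rw [encode_on]
  rw [← weight_bits_eq_prod] at hx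
  conv_rhs => rw [← Nat.mod_eq_of_lt hx, ← encodeDigits_mod]
  refine Finset.sum_congr rfl fun w hw => ?_
  have hw := Finset.mem_range.1 hw
  have : (G.decode S x).digits w =
      x / weight (natVector G.card) (bits S) w % natVector G.card w := by
    have h := weight_bits G S ⟨w, hw⟩
    simp only at h
    simp [Outcome.digits, hw, decode, natVector, h]
  rw [this]

/-- The bridge from numbers to assignments: assignments to two cliques agree on the intersection if
and only if their projections have the same number, which is the test that defines the kernel. -/
theorem project_encode (C S : Finset (Fin n)) (z : G.Outcome) :
    project (natVector G.card) (bits C) (bits S) n (G.encode C (z.on C)) =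
      G.encode (C ∩ S) (z.on (C ∩ S)) := by
  rw [encode_on, encode_on, project_encodeDigits (fun w hw => z.digits_lt hw)
    (fun w _ => bits_le _ _) (fun w _ => bits_le _ _)]
  simp only [bits_mul]

/-- If outcomes for the nodes of a tree agree along the edges, and the occurrences of each variable
are connected, then they agree on all common variables. -/
theorem exists_outcome {m : ℕ} {par : ℕ → ℕ} {cl : ℕ → Finset (Fin n)}
    (hcov : ∀ v, ∃ t ≤ m, v ∈ cl t)
    (hrip : ∀ v, ∀ t ≤ m, ∀ t' ≤ m, v ∈ cl t → v ∈ cl t' →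
      Relation.EqvGen (fun a b => 0 < a ∧ a ≤ m ∧ b = par a ∧ v ∈ cl a ∧ v ∈ cl b) t t')
    {y : ℕ → G.Outcome}
    (hy : ∀ t ≤ m, 0 < t → ∀ v ∈ cl t ∩ cl (par t), y t v = y (par t) v) :
    ∃ z : G.Outcome, ∀ t ≤ m, ∀ v ∈ cl t, z v = y t v := by
  -- The value of `v` is taken from an arbitrary node that contains `v`; connectedness of the
  -- occurrences makes the choice irrelevant.
  choose f hf hv using hcov
  refine ⟨fun v => y (f v) v, fun t ht v hvt => ?_⟩
  have h := hrip v (f v) (hf v) t ht (hv v) hvt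
  have : ∀ a b, Relation.EqvGen (fun a b => 0 < a ∧ a ≤ m ∧ b = par a ∧ v ∈ cl a ∧ v ∈ cl b) a b →
      y a v = y b v := by
    intro a b hab
    induction hab with
    | rel a b h =>
      obtain ⟨h0, hm, rfl, h1, h2⟩ := h
      exact hy a hm h0 v (Finset.mem_inter.2 ⟨h1, h2⟩)
    | refl => rfl
    | symm _ _ _ ih => exact ih.symm
    | trans _ _ _ _ _ ih1 ih2 => exact ih1.trans ih2
  exact this _ _ h

/-- An outcome is determined by its restrictions to the cliques, so outcomes embed into the tuples
of numbers over which `total_eq_sum` ranges. On the image all kernels are one. A tuple with a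
non-zero term consists of numbers of actual assignments, by `hA`, that agree along all edges, by
`hK`; by `exists_outcome` it comes from an outcome. -/
theorem total_eq_sum_outcome {R : Type*} [CommRing R] {m d : ℕ} {par : ℕ → ℕ}
    {cl : ℕ → Finset (Fin n)} (hpar : ∀ t ≤ m, 0 < t → par t < t)
    (hcov : ∀ v, ∃ t ≤ m, v ∈ cl t)
    (hrip : ∀ v, ∀ t ≤ m, ∀ t' ≤ m, v ∈ cl t → v ∈ cl t' →
      Relation.EqvGen (fun a b => 0 < a ∧ a ≤ m ∧ b = par a ∧ v ∈ cl a ∧ v ∈ cl b) t t')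
    (hd : ∀ t ≤ m, ∏ v ∈ cl t, G.card v ≤ d) {K : ℕ → ℕ → ℕ → R} {A : ℕ → ℕ → R}
    (hK : ∀ t ≤ m, 0 < t → ∀ z z' : G.Outcome,
      K t (G.encode (cl t) (z.on _)) (G.encode (cl (par t)) (z'.on _)) =
        if ∀ v ∈ cl t ∩ cl (par t), z v = z' v then 1 else 0)
    (hA : ∀ t ≤ m, ∀ x < d, ∏ v ∈ cl t, G.card v ≤ x → A t x = 0) :
    TreeSum.total d K par m A =
      ∑ z : G.Outcome, ∏ t : Fin (m + 1), A t (G.encode (cl t) (z.on _)) := by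
  classical
  rw [TreeSum.total_eq_sum m hpar]
  set code : G.Outcome → Fin (m + 1) → ℕ := fun z t => G.encode (cl t) (z.on _) with hcode
  have hinj : Function.Injective code := by
    intro z z' h
    funext v
    obtain ⟨t, ht, hv⟩ := hcov v
    have := congrFun h ⟨t, by omega⟩
    exact (G.encode_on_inj.1 this) v hv
  have hofNat : ∀ t : Fin m, ((Fin.ofNat (m + 1) (par (t + 1)) : Fin (m + 1)) : ℕ) = par (t + 1) := by
    intro t
    have := hpar (t + 1) (by omega) (by omega)
    simp [Fin.ofNat, Nat.mod_eq_of_lt (show par (t + 1) < m + 1 by omega)]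
  have hsub : Finset.univ.image code ⊆ Fintype.piFinset fun _ : Fin (m + 1) => Finset.range d := by
    intro x hx
    obtain ⟨z, -, rfl⟩ := Finset.mem_image.1 hx
    rw [Fintype.mem_piFinset]
    exact fun t => Finset.mem_range.2 ((G.encode_on_lt _ _).trans_le (hd t (by omega)))
  rw [← Finset.sum_subset hsub, Finset.sum_image fun z _ z' _ h => hinj h]
  · refine Finset.sum_congr rfl fun z _ => ?_
    rw [Finset.prod_eq_one (s := Finset.univ (α := Fin m)), mul_one]
    intro t _
    have hone : ∀ k : Fin (m + 1), (k : ℕ) = par (t + 1) →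
        K (t + 1) (code z t.succ) (code z k) = 1 := by
      intro k hk
      simp only [hcode, Fin.val_succ]
      rw [hk, hK (t + 1) (by omega) (by omega), if_pos fun _ _ => rfl]
    exact hone _ (hofNat t)
  · intro x hx hx'
    by_contra hne
    have hx := Fintype.mem_piFinset.1 hx
    have hlt : ∀ t : Fin (m + 1), x t < ∏ v ∈ cl t, G.card v := by
      intro t
      by_contra h
      exact hne (by rw [Finset.prod_eq_zero (Finset.mem_univ t)
        (hA t (by omega) _ (Finset.mem_range.1 (hx t)) (by omega)), zero_mul])
    -- Each coordinate is decoded to a full outcome that matters only on its clique; the value for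
    -- `t > m` is a dummy.
    set y : ℕ → G.Outcome := fun t =>
      if h : t < m + 1 then G.decode (cl t) (x ⟨t, h⟩) else G.decode ∅ 0 with hy
    have hxy : ∀ t : Fin (m + 1), x t = G.encode (cl t) ((y t).on _) := by
      intro t
      simp only [hy, t.2, dif_pos]
      exact (G.encode_decode (hlt t)).symm
    have hagree : ∀ t ≤ m, 0 < t → ∀ v ∈ cl t ∩ cl (par t), y t v = y (par t) v := by
      intro t ht h0
      by_contra hna
      refine hne ?_
      obtain ⟨t, rfl⟩ : ∃ k, t = k + 1 := ⟨t - 1, by omega⟩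
      rw [Finset.prod_eq_zero (s := Finset.univ (α := Fin m)) (Finset.mem_univ ⟨t, by omega⟩),
        mul_zero]
      have hzero : ∀ k : Fin (m + 1), (k : ℕ) = par (t + 1) →
          K (t + 1) (x (Fin.succ ⟨t, by omega⟩)) (x k) = 0 := by
        intro k hk
        rw [hxy, hxy, hk]
        exact (hK (t + 1) ht h0 _ _).trans (if_neg hna)
      exact hzero _ (hofNat ⟨t, by omega⟩)
    obtain ⟨z, hz⟩ := G.exists_outcome hcov hrip hagree
    refine hx' (Finset.mem_image.2 ⟨z, Finset.mem_univ _, funext fun t => ?_⟩)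
    rw [hxy t]
    exact G.encode_on_inj.2 (hz t (by omega))

end MAID

/-! ### Reading the input arrays -/

namespace RealRAM

theorem natVector_val {k : ℕ} (f : Fin k → ℕ) (i : Fin k) : natVector f i = f i := by
  simp [natVector]

open Classical in
theorem bitMatrix_val {k m : ℕ} (r : Fin k → Fin m → Prop) (i : Fin k) (j : Fin m) :
    bitMatrix r (i * m + j) = if r i j then 1 else 0 := by
  have hm : 0 < m := j.pos
  have h1 : ((i : ℕ) * m + j) / m = i := by
    rw [mul_comm, Nat.mul_add_div hm, Nat.div_eq_of_lt j.2, add_zero]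
  have h2 : ((i : ℕ) * m + j) % m = j := by
    rw [mul_comm, Nat.mul_add_mod, Nat.mod_eq_of_lt j.2]
  unfold bitMatrix
  simp only [h1, h2, i.2, j.2, and_self, dif_pos]

theorem bitMatrix_eq_one {k m : ℕ} (r : Fin k → Fin m → Prop) (i : Fin k) (j : Fin m) :
    bitMatrix r (i * m + j) = 1 ↔ r i j := by
  rw [bitMatrix_val]
  split_ifs <;> simp_all

theorem bitMatrix_mem {k n : ℕ} (S : Fin k → Finset (Fin n)) (i : Fin k) {w : ℕ} (hw : w < n) :
    bitMatrix (fun i w => w ∈ S i) (i * n + w) = MAID.bits (S i) w := by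
  have h := bitMatrix_val (fun i w => w ∈ S i) i ⟨w, hw⟩
  simp only at h
  rw [h, MAID.bits]
  simp [hw]

theorem tables_val {k d : ℕ} (f : Fin k → ℕ → ℝ) (i : Fin k) {j : ℕ} (hj : j < d) :
    tables d f (i * d + j) = f i j := by
  have h1 : ((i : ℕ) * d + j) / d = i := by
    rw [mul_comm, Nat.mul_add_div (by omega), Nat.div_eq_of_lt hj, add_zero]
  have h2 : ((i : ℕ) * d + j) % d = j := by
    rw [mul_comm, Nat.mul_add_mod, Nat.mod_eq_of_lt hj]
  unfold tables
  simp only [h1, h2, i.2, dif_pos]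

end RealRAM

/-! ### Sizes of cliques and the separation property of the rooted tree -/

namespace MAID

open RealRAM

variable {N n u : ℕ} {G : MAID N n u} {ℓ : ℕ} (T : G.CliqueTree ℓ)

namespace CliqueTree

/-- The chance and decision variables of a clique. -/
noncomputable def vars (c : Fin ℓ) : Finset (Fin n) := (T.clique c).toLeft

theorem mem_vars {c : Fin ℓ} {v : Fin n} : v ∈ T.vars c ↔ Sum.inl v ∈ T.clique c := by
  simp [vars]

theorem family_subset_vars (v : Fin n) : G.family v ⊆ T.vars (T.home (Sum.inl v)) :=
  fun x hx => T.mem_vars.2 (T.family_subset v x hx)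

theorem utilParents_subset_vars (j : Fin u) : G.utilParents j ⊆ T.vars (T.home (Sum.inr j)) :=
  fun x hx => T.mem_vars.2 (T.utilParents_subset j x hx)

theorem domCard_inr_pos (j : Fin u) : 0 < G.domCard (Sum.inr j) := by
  have : Nonempty (G.Assign (G.utilParents j)) := ⟨fun w => ⟨0, G.card_pos w.1⟩⟩
  exact (Set.ncard_pos (Set.finite_range _)).2 (Set.range_nonempty _)

/-- Utility variables in a clique have non-empty domains, so leaving them out can only decrease the
number of assignments. -/
theorem prod_vars_le (c : Fin ℓ) : ∏ v ∈ T.vars c, G.card v ≤ T.maxSize := by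
  refine le_trans ?_ (Finset.le_sup (f := T.potentialSize) (Finset.mem_univ c))
  rw [potentialSize, ← Finset.toLeft_disjSum_toRight (u := T.clique c), Finset.prod_disjSum]
  exact Nat.le_mul_of_pos_right _ (Finset.prod_pos fun j _ => domCard_inr_pos j)

theorem prod_vars_pos (S : Finset (Fin n)) : 0 < ∏ v ∈ S, G.card v :=
  Finset.prod_pos fun v _ => G.card_pos v

theorem prod_le_of_subset {S S' : Finset (Fin n)} (h : S ⊆ S') :
    ∏ v ∈ S, G.card v ≤ ∏ v ∈ S', G.card v :=
  Finset.prod_le_prod_of_subset_of_one_le' h fun v _ _ => G.card_pos v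

theorem prod_family_le (v : Fin n) : ∏ w ∈ G.family v, G.card w ≤ T.maxSize :=
  (prod_le_of_subset (T.family_subset_vars v)).trans (T.prod_vars_le _)

theorem prod_utilParents_le (j : Fin u) : ∏ w ∈ G.utilParents j, G.card w ≤ T.maxSize :=
  (prod_le_of_subset (T.utilParents_subset_vars j)).trans (T.prod_vars_le _)

theorem maxSize_pos : 0 < T.maxSize := by
  obtain ⟨c⟩ := T.isTree.connected.nonempty
  exact (prod_vars_pos _).trans_le (T.prod_vars_le c)

/-- With two or more values per variable, `k` variables have at least `2 ^ k` assignments. -/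
theorem card_vars_le_log (hcard : ∀ v, 2 ≤ G.card v) (c : Fin ℓ) :
    (T.vars c).card ≤ Nat.log 2 T.maxSize := by
  refine Nat.le_log_of_pow_le (by omega) (le_trans ?_ (T.prod_vars_le c))
  exact Finset.pow_card_le_prod _ _ _ fun v _ => hcard v

/-- Every chance or decision variable lies in its home clique, so the cliques cover all of them. -/
theorem vars_le (hcard : ∀ v, 2 ≤ G.card v) : n ≤ ℓ * Nat.log 2 T.maxSize := by
  have h : (Finset.univ : Finset (Fin n)) ⊆ Finset.univ.biUnion T.vars := fun v _ =>
    Finset.mem_biUnion.2 ⟨_, Finset.mem_univ _,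
      T.family_subset_vars v (Finset.mem_insert_self v _)⟩
  have h1 := (Finset.card_le_card h).trans Finset.card_biUnion_le
  have h2 := Finset.sum_le_card_nsmul Finset.univ (fun c => (T.vars c).card) _
    fun c _ => T.card_vars_le_log hcard c
  simpa using h1.trans h2

/-- The adjacency relation of the tree on the indices of the cliques. -/
def adj (a b : ℕ) : Prop := ∃ (ha : a < ℓ) (hb : b < ℓ), T.tree.Adj ⟨a, ha⟩ ⟨b, hb⟩

/-- The chance and decision variables of the clique at a place of an enumeration. -/
noncomputable def nodeVars (ord : ℕ → ℕ) (t : ℕ) : Finset (Fin n) :=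
  if h : ord t < ℓ then T.vars ⟨ord t, h⟩ else ∅

theorem nodeVars_eq {ord : ℕ → ℕ} {t : ℕ} {c : Fin ℓ} (h : ord t = c) :
    T.nodeVars ord t = T.vars c := by
  have : ord t < ℓ := h ▸ c.2
  rw [nodeVars, dif_pos this]
  congr 1
  exact Fin.ext h

theorem connected_of_closed (P : ℕ → Prop) (h0 : P 0)
    (hP : ∀ a < ℓ, ∀ b < ℓ, P a → T.adj a b → P b) {b : ℕ} (hb : b < ℓ) : P b := by
  obtain ⟨p⟩ := T.isTree.connected.preconnected ⟨0, by omega⟩ ⟨b, hb⟩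
  have : ∀ {a c : Fin ℓ}, T.tree.Walk a c → P a → P c := by
    intro a c p
    induction p with
    | nil => exact id
    | cons h p ih => exact fun ha => ih (hP _ (Fin.is_lt _) _ (Fin.is_lt _) ha ⟨_, _, h⟩)
  exact this p h0

variable {T} {ord pos par : ℕ → ℕ}

/-- The edges between the nodes of a rooted tree and their parents. -/
def parentGraph (ℓ : ℕ) (pos par : ℕ → ℕ) : SimpleGraph (Fin ℓ) :=
  SimpleGraph.fromRel fun i j => 0 < pos j ∧ pos i = par (pos j)

/-- Only this inclusion is needed: the parent graph is connected by construction, and a path in it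
is a path in the tree. Equality of the two graphs, which would require counting edges, plays no
role. -/
theorem parentGraph_le (h : Rooted ℓ T.adj ord pos par) : parentGraph ℓ pos par ≤ T.tree := by
  have key : ∀ i j : Fin ℓ, 0 < pos j → pos i = par (pos j) → T.tree.Adj i j := by
    intro i j hj hij
    obtain ⟨ha, hb, hadj⟩ := h.adj_par (pos j) (h.pos_lt j j.2) hj
    have hi : (⟨_, ha⟩ : Fin ℓ) = i := Fin.ext (by simp only [← hij]; exact h.ord_pos i i.2)
    have hj : (⟨_, hb⟩ : Fin ℓ) = j := Fin.ext (h.ord_pos j j.2)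
    rwa [hi, hj] at hadj
  intro i j hij
  obtain ⟨-, ⟨h1, h2⟩ | ⟨h1, h2⟩⟩ := (SimpleGraph.fromRel_adj _ _ _).1 hij
  · exact key i j h1 h2
  · exact (key j i h1 h2).symm

theorem parentGraph_reachable (h : Rooted ℓ T.adj ord pos par) (t : ℕ) :
    ∀ i j : Fin ℓ, pos i = t → pos j = 0 → (parentGraph ℓ pos par).Reachable i j := by
  induction t using Nat.strong_induction_on with
  | _ t ih =>
    intro i j hi hj
    rcases Nat.eq_zero_or_pos t with rfl | h0
    · have : i = j := Fin.ext (by rw [← h.ord_pos i i.2, ← h.ord_pos j j.2, hi, hj])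
      exact this ▸ .refl _
    · have ht : t < ℓ := hi ▸ h.pos_lt i i.2
      have hp := h.par_lt t ht h0
      set k : Fin ℓ := ⟨ord (par t), h.ord_lt _ (hp.trans ht)⟩ with hk
      have hpk : pos k = par t := h.pos_ord _ (hp.trans ht)
      refine SimpleGraph.Reachable.trans (v := k) (SimpleGraph.Adj.reachable ?_) (ih _ hp k j hpk hj)
      refine (SimpleGraph.fromRel_adj _ _ _).2 ⟨fun hik => ?_, .inr ⟨by omega, by rw [hpk, hi]⟩⟩
      rw [hik, hpk] at hi
      omega

/-- The places of the cliques that contain a variable are connected. -/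
theorem eqvGen_nodeVars {m : ℕ} (hm : ℓ = m + 1) (h : Rooted ℓ T.adj ord pos par) (v : Fin n) :
    ∀ t ≤ m, ∀ t' ≤ m, v ∈ T.nodeVars ord t → v ∈ T.nodeVars ord t' →
      Relation.EqvGen (fun a b => 0 < a ∧ a ≤ m ∧ b = par a ∧ v ∈ T.nodeVars ord a ∧
        v ∈ T.nodeVars ord b) t t' := by
  intro t ht t' ht' hv hv'
  have hord := h.ord_lt t (by omega)
  have hord' := h.ord_lt t' (by omega)
  rw [T.nodeVars_eq (c := ⟨ord t, hord⟩) rfl, mem_vars] at hv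
  rw [T.nodeVars_eq (c := ⟨ord t', hord'⟩) rfl, mem_vars] at hv'
  set r : ℕ → ℕ → Prop := fun a b => 0 < a ∧ a ≤ m ∧ b = par a ∧ v ∈ T.nodeVars ord a ∧
    v ∈ T.nodeVars ord b with hr
  have hreach : (parentGraph ℓ pos par).Reachable ⟨ord t, hord⟩ ⟨ord t', hord'⟩ := by
    have h0 : pos (⟨ord 0, h.ord_lt 0 (by omega)⟩ : Fin ℓ) = 0 := h.pos_ord 0 (by omega)
    exact (parentGraph_reachable h _ _ _ rfl h0).trans (parentGraph_reachable h _ _ _ rfl h0).symm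
  -- The path is chosen in the parent graph, so that each of its edges joins a node and its parent;
  -- viewed in the tree, it is a path to which separation applies.
  obtain ⟨p, hp⟩ := hreach.exists_isPath
  have hsupp : ∀ j ∈ p.support, v ∈ T.vars j := by
    intro j hj
    have := T.separation _ _ (p.mapLe (parentGraph_le h)) (hp.mapLe _) j
      (by rwa [SimpleGraph.Walk.support_mapLe_eq_support])
    exact T.mem_vars.2 (this (Finset.mem_inter.2 ⟨hv, hv'⟩))
  have key : ∀ {i k : Fin ℓ} (p : (parentGraph ℓ pos par).Walk i k),
      (∀ j ∈ p.support, v ∈ T.vars j) → Relation.EqvGen r (pos i) (pos k) := by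
    intro i k p
    induction p with
    | nil => exact fun _ => .refl _
    | @cons i j k hij p ih =>
      intro hs
      refine .trans _ _ _ ?_ (ih fun x hx => hs x (by simp [hx]))
      have hi : v ∈ T.nodeVars ord (pos i) := by
        rw [T.nodeVars_eq (h.ord_pos i i.2)]; exact hs i (by simp)
      have hj : v ∈ T.nodeVars ord (pos j) := by
        rw [T.nodeVars_eq (h.ord_pos j j.2)]; exact hs j (by simp)
      have hli := h.pos_lt i i.2
      have hlj := h.pos_lt j j.2
      obtain ⟨-, ⟨h1, h2⟩ | ⟨h1, h2⟩⟩ := (SimpleGraph.fromRel_adj _ _ _).1 hij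
      · exact .symm _ _ (.rel _ _ ⟨h1, by omega, h2, hj, hi⟩)
      · exact .rel _ _ ⟨h1, by omega, h2, hi, hj⟩
  have := key p hsupp
  rwa [h.pos_ord t (by omega), h.pos_ord t' (by omega)] at this

theorem exists_nodeVars {m : ℕ} (hm : ℓ = m + 1) (h : Rooted ℓ T.adj ord pos par) (v : Fin n) :
    ∃ t ≤ m, v ∈ T.nodeVars ord t := by
  set c := T.home (Sum.inl v)
  refine ⟨pos c, by have := h.pos_lt c c.2; omega, ?_⟩
  rw [T.nodeVars_eq (h.ord_pos c c.2)]
  exact T.family_subset_vars v (Finset.mem_insert_self v _)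

theorem prod_nodeVars_le (h : Rooted ℓ T.adj ord pos par) {t : ℕ} (ht : t < ℓ) :
    ∏ v ∈ T.nodeVars ord t, G.card v ≤ T.maxSize := by
  rw [T.nodeVars_eq (c := ⟨ord t, h.ord_lt t ht⟩) rfl]
  exact T.prod_vars_le _

end CliqueTree

theorem notMem_parents (v w : Fin n) (h : w ∈ G.parents v) : v ∉ G.parents w := fun h' =>
  G.acyclic v (.tail (.single h') h)

/-- Under perfect recall the last decision of the agent satisfies the hypothesis. This is how all
terminal sequences of an agent fit into a single clique. -/
theorem scope_eq_family {k : Fin N} {w : Fin n} (hw : G.owner w = some k)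
    (h : ∀ v, G.owner v = some k → G.family v ⊆ G.family w) : G.scope k = G.family w := by
  apply Finset.Subset.antisymm
  · intro x hx
    obtain ⟨v, hv, hx⟩ := Finset.mem_biUnion.1 hx
    exact h v (Finset.mem_filter.1 hv).2 hx
  · exact Finset.subset_biUnion_of_mem G.family (Finset.mem_filter.2 ⟨Finset.mem_univ _, hw⟩)

end MAID

/-! ### A formula for the Jacobian -/

namespace MAID

variable {N n u : ℕ} (G : MAID N n u)

open Classical in
-- In the product at a leaf every agent other than the owner of `p` occurs exactly once and the
-- owner of `p` not at all. So moving the coordinate `q` changes at most one factor, at the leaves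
-- whose history is `q`, and the dependence on `t` is affine.
theorem deviation_add_smul_single (σ : G.Seq → ℝ) (p q : G.Seq) (t : ℝ) :
    G.deviation (σ + t • Pi.single q 1) p = G.deviation σ p + t *
      if p.1 = q.1 then 0 else ∑ z : G.Outcome, if G.history p.1 z = p ∧ G.history q.1 z = q then
        G.payoff p.1 z * (G.nature z * ∏ k ∈ (Finset.univ.erase p.1).erase q.1, σ (G.history k z))
        else 0 := by
  have hne : ∀ (z : G.Outcome) (k : Fin N), k ≠ q.1 →
      (σ + t • (Pi.single q 1 : G.Seq → ℝ)) (G.history k z) = σ (G.history k z) := by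
    intro z k hk
    have : G.history k z ≠ q := fun h => hk (by rw [← h]; rfl)
    simp [this]
  unfold deviation
  split_ifs with hpq
  · rw [mul_zero, add_zero]
    refine Finset.sum_congr rfl fun z _ => ?_
    rw [Finset.prod_congr rfl fun k hk => hne z k (hpq ▸ (Finset.mem_erase.1 hk).1)]
  · rw [← Finset.sum_filter, ← Finset.filter_filter, Finset.sum_filter (G.history q.1 · = q),
      Finset.mul_sum, ← Finset.sum_add_distrib]
    refine Finset.sum_congr rfl fun z _ => ?_
    have hmem : q.1 ∈ Finset.univ.erase p.1 :=
      Finset.mem_erase.2 ⟨fun h => hpq h.symm, Finset.mem_univ _⟩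
    rw [← Finset.mul_prod_erase _ _ hmem, ← Finset.mul_prod_erase _ _ hmem,
      Finset.prod_congr rfl fun k hk => hne z k (Finset.mem_erase.1 hk).1]
    by_cases h : G.history q.1 z = q
    · rw [if_pos h, h]
      simp
      ring
    · simp [h]

open Classical in
/-- A common denominator for the entries of the Jacobian. -/
theorem jacobian_eq {σ : G.Seq → ℝ} (hσ : ∀ p, 0 < σ p) (p q : G.Seq) :
    G.jacobian σ p q = if p.1 = q.1 then 0 else
      (∑ z : G.Outcome, if G.history p.1 z = p ∧ G.history q.1 z = q then
        G.payoff p.1 z * (G.nature z * ∏ k, σ (G.history k z)) else 0) / (σ p * σ q) := by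
  have h1 := ((G.differentiable_deviation p σ).hasFDerivAt.hasLineDerivAt (Pi.single q 1))
  unfold HasLineDerivAt at h1
  simp only [deviation_add_smul_single] at h1
  have h2 := ((hasDerivAt_id (0 : ℝ)).mul_const (if p.1 = q.1 then 0 else
    ∑ z : G.Outcome, if G.history p.1 z = p ∧ G.history q.1 z = q then
        G.payoff p.1 z * (G.nature z * ∏ k ∈ (Finset.univ.erase p.1).erase q.1, σ (G.history k z))
        else 0)).const_add (G.deviation σ p)
  rw [jacobian, h1.unique h2, one_mul]
  split_ifs with hpq
  · rfl
  -- On leaves consistent with `p` and `q` the factors of their owners are `σ p` and `σ q`;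
  -- multiplying by both completes the product over all agents.
  rw [eq_div_iff (mul_pos (hσ p) (hσ q)).ne', Finset.sum_mul]
  refine Finset.sum_congr rfl fun z _ => ?_
  split_ifs with h
  · have hmem : q.1 ∈ Finset.univ.erase p.1 :=
      Finset.mem_erase.2 ⟨fun h => hpq h.symm, Finset.mem_univ _⟩
    rw [← Finset.mul_prod_erase Finset.univ _ (Finset.mem_univ p.1),
      ← Finset.mul_prod_erase _ _ hmem, h.1, h.2]
    ring
  · rw [zero_mul]

theorem exists_history_eq (p : G.Seq) : ∃ z : G.Outcome, G.history p.1 z = p := by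
  obtain ⟨k, a⟩ := p
  refine ⟨fun v => if h : v ∈ G.scope k then a ⟨v, h⟩ else ⟨0, G.card_pos v⟩, ?_⟩
  exact Sigma.ext rfl (heq_of_eq (funext fun w => dif_pos w.2))

theorem history_eq_iff (k : Fin N) (z z' : G.Outcome) :
    G.history k z = G.history k z' ↔ z.on (G.scope k) = z'.on (G.scope k) := by
  simp [history]

end MAID

/-! ### The computed entries are the entries of the Jacobian -/

namespace RealRAM

open TreeSum

theorem dualNumber_mul (a b c e : ℝ) :
    dualNumber a b * dualNumber c e = dualNumber (a * c) (a * e + c * b) := by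
  refine dual_ext ?_ ?_ <;> simp [mul_comm]

/-- Since `ε² = 0`, a product of factors `a (1 + ε w)` adds up the `w`. In this way a sum-product
algorithm handles an additive payoff. -/
theorem prod_dualNumber {ι : Type*} (S : Finset ι) (a w : ι → ℝ) :
    ∏ t ∈ S, dualNumber (a t) (a t * w t) = dualNumber (∏ t ∈ S, a t) ((∏ t ∈ S, a t) * ∑ t ∈ S, w t) := by
  classical
  induction S using Finset.induction_on with
  | empty => exact dual_ext (by simp) (by simp)
  | insert t S ht ih =>
    rw [Finset.prod_insert ht, Finset.prod_insert ht, Finset.sum_insert ht, ih, dualNumber_mul]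
    exact dual_ext rfl (by simp only [snd_dualNumber]; ring)

theorem snd_sum {ι : Type*} (S : Finset ι) (f : ι → DualNumber ℝ) :
    (∑ t ∈ S, f t).snd = ∑ t ∈ S, (f t).snd :=
  map_sum (TrivSqZeroExt.sndHom ℝ ℝ) f S

end RealRAM

namespace MAID

open RealRAM TreeSum

variable {N n u : ℕ} {G : MAID N n u} {ℓ : ℕ}

theorem inputReal_zero (T : G.CliqueTree ℓ) (σ : G.Seq → ℝ) (v : Fin n) (z : G.Outcome) :
    G.inputReal T σ 0 (v * T.maxSize + G.encode (G.family v) (z.on _)) =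
      if h : G.owner v = none then G.cpd ⟨v, h⟩ (z.on (G.parents v)) (z v) else 0 := by
  have hdec := fun x hx => G.decode_encode (S := G.family v) (v := x) z hx
  have hon : (G.decode (G.family v) (G.encode (G.family v) (z.on _))).on (G.parents v) =
      z.on (G.parents v) :=
    G.on_eq_on_iff.2 fun x hx => hdec x (Finset.mem_insert_of_mem hx)
  simp only [inputReal]
  rw [tables_val _ v ((G.encode_on_lt _ z).trans_le (T.prod_family_le v)), hon,
    hdec v (Finset.mem_insert_self _ _)]

theorem inputReal_one (T : G.CliqueTree ℓ) (σ : G.Seq → ℝ) (j : Fin u) (z : G.Outcome) :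
    G.inputReal T σ 1 (j * T.maxSize + G.encode (G.utilParents j) (z.on _)) =
      G.utility j (z.on _) := by
  simp only [inputReal]
  rw [tables_val _ j ((G.encode_on_lt _ z).trans_le (T.prod_utilParents_le j))]
  congr 1
  exact G.on_eq_on_iff.2 fun x hx => G.decode_encode z hx

theorem inputReal_two (T : G.CliqueTree ℓ) (σ : G.Seq → ℝ) (k : Fin N)
    (hk : ∏ v ∈ G.scope k, G.card v ≤ T.maxSize) (z : G.Outcome) :
    G.inputReal T σ 2 (k * T.maxSize + G.encode (G.scope k) (z.on _)) = σ (G.history k z) := by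
  simp only [inputReal]
  rw [tables_val _ k ((G.encode_on_lt _ z).trans_le hk)]
  congr 1
  exact (G.history_eq_iff k _ _).2 (G.on_eq_on_iff.2 fun x hx => G.decode_encode z hx)

/-- The memory contains the diagram with its clique tree and the tables that are computed before
the Jacobian. -/
structure Tabulated (T : G.CliqueTree ℓ) (σ : G.Seq → ℝ) (last : Fin N → Fin n) (s : State) :
    Prop where
  nat_eq : ∀ a ≤ 10, s.nat a = G.inputNat T a
  real_eq : ∀ a ≤ 2, s.real a = G.inputReal T σ a
  rooted : Rooted ℓ T.adj (s.nat 14) (s.nat 15) (s.nat 16)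
  last_eq : ∀ k : Fin N, s.nat 20 k = last k + 1
  scope_eq : ∀ k, G.scope k = G.family (last k)
  kernel_eq : ∀ t < ℓ, ∀ x < T.maxSize, ∀ y < T.maxSize,
    s.real 5 (t * (T.maxSize * T.maxSize) + (x * T.maxSize + y)) =
      if project (natVector G.card) (bits (T.nodeVars (s.nat 14) t))
          (bits (T.nodeVars (s.nat 14) (s.nat 16 t))) n x =
        project (natVector G.card) (bits (T.nodeVars (s.nat 14) (s.nat 16 t)))
          (bits (T.nodeVars (s.nat 14) t)) n y then 1 else 0
  evidence_eq : ∀ v : Fin n, ∀ x < T.maxSize, ∀ h < T.maxSize,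
    s.real 6 ((v * T.maxSize + x) * T.maxSize + h) =
      if project (natVector G.card) (bits (T.vars (T.home (Sum.inl v)))) (bits (G.family v)) n x = h
      then 1 else 0
  potential_eq : ∀ t < ℓ, ∀ x < T.maxSize, s.real 4 (t * T.maxSize + x) =
    (if x < ∏ v ∈ T.nodeVars (s.nat 14) t, G.card v then 1 else 0) *
    (∏ v : Fin n, if G.owner v = none ∧ s.nat 15 (T.home (Sum.inl v)) = t then
      s.real 0 (v * T.maxSize + project (natVector G.card) (bits (T.vars (T.home (Sum.inl v))))
        (bits (G.family v)) n x) else 1) *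
    ∏ k : Fin N, if s.nat 15 (T.home (Sum.inl (last k))) = t then
      s.real 2 (k * T.maxSize + project (natVector G.card)
        (bits (T.vars (T.home (Sum.inl (last k))))) (bits (G.family (last k))) n x) else 1

namespace Tabulated

variable {T : G.CliqueTree ℓ} {σ : G.Seq → ℝ} {last : Fin N → Fin n} {s : State}
  (H : Tabulated T σ last s)
theorem prod_scope_le (H : Tabulated T σ last s) (k : Fin N) :
    ∏ v ∈ G.scope k, G.card v ≤ T.maxSize := by
  rw [H.scope_eq]
  exact T.prod_family_le _

theorem nodeVars_pos (H : Tabulated T σ last s) (c : Fin ℓ) :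
    T.nodeVars (s.nat 14) (s.nat 15 c) = T.vars c :=
  T.nodeVars_eq (H.rooted.ord_pos c c.2)

theorem encode_lt (H : Tabulated T σ last s) {t : ℕ} (ht : t < ℓ) (z : G.Outcome) :
    G.encode (T.nodeVars (s.nat 14) t) (z.on _) < T.maxSize :=
  (G.encode_on_lt _ z).trans_le (CliqueTree.prod_nodeVars_le H.rooted ht)

/-- Every factor is a table over a set `S` inside its home clique, so intersecting with the clique
loses nothing and the projection is the cell of that table. -/
theorem project_home (H : Tabulated T σ last s) {c : Fin ℓ} {S : Finset (Fin n)}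
    (hS : S ⊆ T.vars c) {t : ℕ} (ht : s.nat 15 c = t) (z : G.Outcome) :
    project (natVector G.card) (bits (T.vars c)) (bits S) n
      (G.encode (T.nodeVars (s.nat 14) t) (z.on _)) = G.encode S (z.on S) := by
  rw [← ht, H.nodeVars_pos, G.project_encode, Finset.inter_eq_right.2 hS]

theorem kernel_encode (H : Tabulated T σ last s) {t : ℕ} (ht : t < ℓ) (z z' : G.Outcome) :
    s.kernel T.maxSize t (G.encode (T.nodeVars (s.nat 14) t) (z.on _))
        (G.encode (T.nodeVars (s.nat 14) (s.nat 16 t)) (z'.on _)) =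
      if ∀ v ∈ T.nodeVars (s.nat 14) t ∩ T.nodeVars (s.nat 14) (s.nat 16 t), z v = z' v
        then 1 else 0 := by
  rw [State.kernel, H.kernel_eq t ht _ (H.encode_lt ht z) _ (H.encode_lt (H.rooted.par_lt' ht) z'),
    G.project_encode, G.project_encode, Finset.inter_comm (T.nodeVars (s.nat 14) (s.nat 16 t))]
  simp only [G.encode_on_inj]
  split_ifs <;> rfl

theorem evidence_encode (H : Tabulated T σ last s) (k : Fin N) (z : G.Outcome) {h : ℕ}
    (hh : h < T.maxSize) :
    s.real 6 ((last k * T.maxSize + G.encode (T.nodeVars (s.nat 14)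
        (s.nat 15 (T.home (Sum.inl (last k))))) (z.on _)) * T.maxSize + h) =
      if G.encode (G.scope k) (z.on _) = h then 1 else 0 := by
  rw [H.evidence_eq _ _ (H.encode_lt (H.rooted.pos_lt _ (Fin.is_lt _)) z) _ hh,
    H.project_home (T.family_subset_vars _) rfl, H.scope_eq]

theorem utilitySum_encode (H : Tabulated T σ last s) (i : Fin N) {t : ℕ} (z : G.Outcome) :
    s.utilitySum n u T.maxSize i t (G.encode (T.nodeVars (s.nat 14) t) (z.on _)) =
      ∑ j : Fin u, if G.utilOwner j = i ∧ s.nat 15 (T.home (Sum.inr j)) = t then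
        G.utility j (z.on _) else 0 := by
  rw [State.utilitySum, Finset.sum_range]
  refine Finset.sum_congr rfl fun j _ => ?_
  have h4 : s.nat 4 j = G.utilOwner j := by rw [H.nat_eq 4 (by omega), inputNat, natVector_val]
  have h10 : s.nat 10 j = T.home (Sum.inr j) := by
    rw [H.nat_eq 10 (by omega), inputNat, natVector_val]
  simp only [h4, h10, Fin.val_inj]
  refine ite_congr rfl (fun h => ?_) fun _ => rfl
  rw [show s.nat 1 = natVector G.card from H.nat_eq 1 (by omega), H.nat_eq 5 (by omega), H.nat_eq 7 (by omega), H.real_eq 1 (by omega),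
    project_congr (b' := bits (T.vars (T.home (Sum.inr j)))) (e' := bits (G.utilParents j)),
    H.project_home (T.utilParents_subset_vars j) h.2, inputReal_one]
  · intro w hw
    simp only [inputNat, ← T.mem_vars]
    exact bitMatrix_mem _ _ hw
  · intro w hw
    exact bitMatrix_mem _ _ hw

theorem potential_encode (H : Tabulated T σ last s) {t : ℕ} (ht : t < ℓ) (z : G.Outcome) :
    s.real 4 (t * T.maxSize + G.encode (T.nodeVars (s.nat 14) t) (z.on _)) =
      (∏ v : Fin n, if s.nat 15 (T.home (Sum.inl v)) = t then
        (if h : G.owner v = none then G.cpd ⟨v, h⟩ (z.on (G.parents v)) (z v) else 1) else 1) *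
      ∏ k : Fin N, if s.nat 15 (T.home (Sum.inl (last k))) = t then σ (G.history k z) else 1 := by
  rw [H.potential_eq t ht _ (H.encode_lt ht z), if_pos (G.encode_on_lt _ z), one_mul]
  congr 1
  · refine Finset.prod_congr rfl fun v _ => ?_
    by_cases h1 : G.owner v = none <;> by_cases h2 : s.nat 15 (T.home (Sum.inl v)) = t
    · rw [if_pos ⟨h1, h2⟩, if_pos h2, dif_pos h1, H.project_home (T.family_subset_vars v) h2,
        H.real_eq 0 (by omega), inputReal_zero, dif_pos h1]
    all_goals simp [h1, h2]
  · refine Finset.prod_congr rfl fun k _ => ?_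
    refine ite_congr rfl (fun h => ?_) fun _ => rfl
    rw [H.project_home (T.family_subset_vars _) h, H.real_eq 2 (by omega), ← H.scope_eq,
      inputReal_two _ _ _ (H.prod_scope_le k)]

theorem prod_fiber {m : ℕ} {ι M : Type*} [Fintype ι] [CommMonoid M] (r : ι → ℕ)
    (hr : ∀ i, r i < m) (f : ι → M) : ∏ t : Fin m, ∏ i, (if r i = t then f i else 1) = ∏ i, f i := by
  rw [Finset.prod_comm]
  refine Finset.prod_congr rfl fun i _ => ?_
  rw [Finset.prod_eq_single ⟨r i, hr i⟩ (fun t _ ht => if_neg fun h => ht (Fin.ext h.symm))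
    fun h => absurd (Finset.mem_univ _) h, if_pos rfl]

theorem sum_fiber {m : ℕ} {ι M : Type*} [Fintype ι] [AddCommMonoid M] (r : ι → ℕ)
    (hr : ∀ i, r i < m) (f : ι → M) : ∑ t : Fin m, ∑ i, (if r i = t then f i else 0) = ∑ i, f i := by
  rw [Finset.sum_comm]
  refine Finset.sum_congr rfl fun i _ => ?_
  rw [Finset.sum_eq_single ⟨r i, hr i⟩ (fun t _ ht => if_neg fun h => ht (Fin.ext h.symm))
    fun h => absurd (Finset.mem_univ _) h, if_pos rfl]

/-- Each chance distribution is multiplied into exactly one clique and so is each plan; by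
`prod_fiber` the product over all cliques meets every factor once. -/
theorem prod_potential (H : Tabulated T σ last s) (z : G.Outcome) :
    ∏ t : Fin ℓ, s.real 4 (t * T.maxSize + G.encode (T.nodeVars (s.nat 14) t) (z.on _)) =
      G.nature z * ∏ k, σ (G.history k z) := by
  rw [Finset.prod_congr rfl fun (t : Fin ℓ) _ => H.potential_encode t.2 z, Finset.prod_mul_distrib,
    prod_fiber _ (fun v => H.rooted.pos_lt _ (Fin.is_lt _)),
    prod_fiber _ (fun v => H.rooted.pos_lt _ (Fin.is_lt _))]
  congr 1
  rw [Fintype.prod_dite]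
  simp [nature]

theorem sum_utilitySum (H : Tabulated T σ last s) (i : Fin N) (z : G.Outcome) :
    ∑ t : Fin ℓ, s.utilitySum n u T.maxSize i t (G.encode (T.nodeVars (s.nat 14) t) (z.on _)) =
      G.payoff i z := by
  simp only [H.utilitySum_encode, and_comm (a := G.utilOwner _ = i), ite_and]
  rw [sum_fiber _ (fun j => H.rooted.pos_lt _ (Fin.is_lt _)), payoff, Finset.sum_filter]

/-- The entries that are computed from the tables are those of the Jacobian. -/
theorem entry_eq (H : Tabulated T σ last s) {m : ℕ} (hm : ℓ = m + 1) (hσ : ∀ p, 0 < σ p)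
    (p q : G.Seq) :
    s.entry n u m T.maxSize p.1 (G.encode _ p.2) q.1 (G.encode _ q.2) = G.jacobian σ p q := by
  obtain ⟨zp, hzp⟩ := G.exists_history_eq p
  obtain ⟨zq, hzq⟩ := G.exists_history_eq q
  obtain ⟨i, a⟩ := p
  obtain ⟨k, b⟩ := q
  obtain rfl : zp.on (G.scope i) = a := by simpa [history] using hzp
  obtain rfl : zq.on (G.scope k) = b := by simpa [history] using hzq
  clear hzp hzq
  have hlt : ∀ i (z : G.Outcome), G.encode (G.scope i) (z.on _) < T.maxSize := fun i z =>
    (G.encode_on_lt _ z).trans_le (H.prod_scope_le i)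
  rw [jacobian_eq G hσ]
  simp only [State.entry]
  rw [H.real_eq 2 (by omega), inputReal_two _ _ _ (H.prod_scope_le i),
    inputReal_two _ _ _ (H.prod_scope_le k)]
  have hlast : ∀ k : Fin N, s.nat 20 k - 1 = last k := fun k => by rw [H.last_eq, Nat.add_sub_cancel]
  have h9 : ∀ v : Fin n, s.nat 9 v = T.home (Sum.inl v) := fun v => by
    rw [H.nat_eq 9 (by omega), inputNat, natVector_val]
  have h4 : ∀ j : Fin u, s.nat 4 j = G.utilOwner j := fun j => by
    rw [H.nat_eq 4 (by omega), inputNat, natVector_val]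
  by_cases hik : i = k
  · simp [hik]
  rw [if_neg hik]
  -- The skipped agents have payoff zero at every leaf, so their rows are rightly zero.
  by_cases hu : ∀ j < u, s.nat 4 j ≠ i
  · have hpay : ∀ z, G.payoff i z = 0 := fun z => Finset.sum_eq_zero fun j hj => by
      refine absurd ?_ (hu j j.2)
      rw [h4, (Finset.mem_filter.1 hj).2]
    rw [if_pos (.inr hu)]
    simp [hpay]
  rw [if_neg (by simpa [Fin.val_inj, hik] using hu)]
  congr 1
  set d := T.maxSize
  set cl := T.nodeVars (s.nat 14)
  set r : Fin N → ℕ := fun k => s.nat 15 (T.home (Sum.inl (last k))) with hr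
  set hp := G.encode (G.scope i) (zp.on _)
  set hq := G.encode (G.scope k) (zq.on _)
  set w := s.agentWeight n u d i hp with hw
  set E : ℕ → ℝ := fun x => s.real 6 ((last k * d + x) * d + hq)
  have hrm : ∀ k, r k ≤ m := fun k => by
    have := H.rooted.pos_lt (T.home (Sum.inl (last k))) (Fin.is_lt _)
    simp only [hr]; omega
  have hpar : ∀ t ≤ m, 0 < t → s.nat 16 t < t := fun t ht => H.rooted.par_lt t (by omega)
  -- By linearity in the weights of the clique at `r k`, the sum written by the program is the total
  -- after the indicator of `q` has been multiplied into this row. The indicator is real, so it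
  -- commutes with taking the `ε` part.
  have hsum : (∑ x ∈ Finset.range d, E x * (w (r k) x *
      TreeSum.deriv d (s.kernel d) (s.nat 16) m w (r k) x).snd) =
      (total d (s.kernel d) (s.nat 16) m (Function.update w (r k) fun x =>
        dualNumber (E x) 0 * w (r k) x)).snd := by
    rw [total_update m hpar w (hrm k), snd_sum]
    refine Finset.sum_congr rfl fun x _ => ?_
    simp
    ring
  simp only [hlast, h9]
  refine hsum.trans ?_
  set e : Fin N → ℕ → ℕ → ℕ → ℝ := fun k h t x =>
    if t = r k then s.real 6 ((last k * d + x) * d + h) else 1 with he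
  -- Both indicators enter as real factors, which preserves the form `a (1 + ε W)`. The cliques of
  -- the two agents may coincide, hence the case distinction.
  have hA : ∀ t x, Function.update w (r k) (fun x => dualNumber (E x) 0 * w (r k) x) t x =
      dualNumber (s.real 4 (t * d + x) * e i hp t x * e k hq t x)
        (s.real 4 (t * d + x) * e i hp t x * e k hq t x * s.utilitySum n u d i t x) := by
    intro t x
    have hwt : w t x = dualNumber (s.real 4 (t * d + x) * e i hp t x)
        (s.real 4 (t * d + x) * e i hp t x * s.utilitySum n u d i t x) := by
      simp only [hw, State.agentWeight, he, hr, hlast, h9]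
    by_cases ht : t = r k
    · subst ht
      rw [Function.update_self, hwt, dualNumber_mul]
      have : e k hq (r k) x = E x := by simp [he, E]
      rw [this]
      exact dual_ext (by simp; ring) (by simp; ring)
    · rw [Function.update_of_ne ht, hwt]
      have : e k hq t x = 1 := by simp [he, ht]
      rw [this, mul_one]
  rw [G.total_eq_sum_outcome (cl := cl) hpar (CliqueTree.exists_nodeVars hm H.rooted)
    (CliqueTree.eqvGen_nodeVars hm H.rooted)
    (fun t ht => CliqueTree.prod_nodeVars_le H.rooted (by omega))
    (fun t ht _ z z' => H.kernel_encode (by omega) z z') ?_, snd_sum]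
  · refine Finset.sum_congr rfl fun z _ => ?_
    simp only [hA]
    rw [prod_dualNumber, snd_dualNumber]
    subst hm
    rw [H.sum_utilitySum, Finset.prod_mul_distrib, Finset.prod_mul_distrib, H.prod_potential]
    -- The evidence is one at all cliques but that of the last decision, where it compares the
    -- restriction to the scope with the given sequence.
    have hev : ∀ k z', ∏ t : Fin (m + 1), e k (G.encode (G.scope k) (Outcome.on z' _)) t
        (G.encode (cl t) (z.on _)) = if G.history k z = G.history k z' then 1 else 0 := by
      intro k z'
      rw [Finset.prod_eq_single ⟨r k, by have := hrm k; omega⟩ (fun t _ ht =>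
        if_neg fun h => ht (Fin.ext h)) fun h => absurd (Finset.mem_univ _) h]
      simp only [if_pos]
      rw [H.evidence_encode k z (hlt k z')]
      simp only [G.history_eq_iff, G.on_eq_on_iff, G.encode_on_inj]
    rw [hev, hev]
    change _ = if G.history i z = G.history i zp ∧ G.history k z = G.history k zq then _ else _
    by_cases h1 : G.history i z = G.history i zp
    · by_cases h2 : G.history k z = G.history k zq
      · rw [if_pos h1, if_pos h2, if_pos ⟨h1, h2⟩, mul_one, mul_one, mul_comm]
      · rw [if_neg h2, if_neg (show ¬ (_ ∧ _) from fun h => h2 h.2), mul_zero, zero_mul]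
    · rw [if_neg h1, if_neg (show ¬ (_ ∧ _) from fun h => h1 h.1), mul_zero, zero_mul, zero_mul]
  -- Padding cells have potential zero by `initPotentials`, so they contribute nothing to the tree
  -- sum.
  · intro t ht x hx hle
    rw [hA, H.potential_eq t (by omega) x hx, if_neg (not_lt.2 hle)]
    exact dual_ext (by simp) (by simp)

end Tabulated

end MAID

/-! ### Correctness of the preparation -/

namespace RealRAM

/-- The tables that do not depend on agents and terminal sequences. -/
def prepare : Program :=
  .seq listCliques <| .seq searchTree <| .seq listFamilies <| .seq findLast <|
  .seq indexFamilies <| .seq indexEdges <| .seq tabulateKernel <| .seq tabulateEvidence <|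
  .seq initPotentials <| .seq multiplyChance multiplyPlans

/-- A bound for the number of steps of the preparation. -/
def prepareCost (N n ℓ d L : ℕ) : ℕ :=
  (ℓ * (n * 80 + 60) + 20) + ((ℓ * (ℓ * 100 + 100) + 100) + ((n * n * 30 + n * 30 + 40) +
  ((n * 100 + 10) + ((n * (d * (projectCost L d + 50) + 50) + 20) +
  ((ℓ * (d * (projectCost L d * 2 + 100) + 30) + 20) + ((ℓ * (d * (d * 80 + 30) + 30) + 10) +
  ((n * d * (d * 50 + 40) + 20) + ((ℓ * (d * 60 + 40) + 20) + ((n * (d * 80 + 60) + 20) +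
  (N * (d * 80 + 60) + 20))))))))))

theorem length_members_bits {n : ℕ} (S : Finset (Fin n)) :
    (members (MAID.bits S) n).length = S.card := by
  have h : (members (MAID.bits S) n).toFinset = S.map Fin.valEmbedding := by
    ext v
    simp only [members, List.toFinset_filter, Finset.mem_filter, List.mem_toFinset,
      List.mem_range, decide_eq_true_eq, Finset.mem_map, Fin.valEmbedding_apply]
    constructor
    · rintro ⟨hv, h⟩
      have hb := MAID.bits_val S ⟨v, hv⟩
      simp only [h] at hb
      exact ⟨⟨v, hv⟩, by by_contra hS; simp [hS] at hb, rfl⟩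
    · rintro ⟨w, hw, rfl⟩
      exact ⟨w.2, by simp [hw]⟩
  have hnd : (members (MAID.bits S) n).Nodup := List.nodup_range.filter _
  rw [← List.toFinset_card_of_nodup hnd, h, Finset.card_map]

theorem members_congr {b b' : ℕ → ℕ} {m : ℕ} (h : ∀ v < m, b v = b' v) :
    members b m = members b' m :=
  List.filter_congr fun v hv => by rw [h v (List.mem_range.1 hv)]

theorem Rooted.congr {ℓ : ℕ} {adj adj' : ℕ → ℕ → Prop} {ord pos par : ℕ → ℕ}
    (h : Rooted ℓ adj ord pos par) (h' : ∀ a < ℓ, ∀ b < ℓ, adj a b → adj' a b) :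
    Rooted ℓ adj' ord pos par :=
  { h with
    adj_par := fun t ht h0 =>
      h' _ (h.ord_lt _ (h.par_lt' ht)) _ (h.ord_lt t ht) (h.adj_par t ht h0) }

end RealRAM

namespace MAID

open RealRAM

variable {N n u : ℕ} {G : MAID N n u} {ℓ : ℕ}

/-- The memory still contains the input. -/
structure Loaded (T : G.CliqueTree ℓ) (σ : G.Seq → ℝ) (s : State) : Prop where
  nat_eq : ∀ a ≤ 10, s.nat a = G.inputNat T a
  real_eq : ∀ a ≤ 3, s.real a = G.inputReal T σ a

namespace Loaded

variable {T : G.CliqueTree ℓ} {σ : G.Seq → ℝ} {s s' : State} {p : Program}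

theorem frame (h : Loaded T σ s) (f : Frame p s s') (hn : ∀ a ≤ 10, p.keepsNat a = true)
    (hr : ∀ a ≤ 3, p.keepsReal a = true) : Loaded T σ s' :=
  ⟨fun a ha => (f.nat a (hn a ha)).trans (h.nat_eq a ha),
    fun a ha => (f.real a (hr a ha)).trans (h.real_eq a ha)⟩

theorem size_agents (h : Loaded T σ s) : s.nat 0 0 = N := by
  rw [h.nat_eq 0 (by omega)]; simp [inputNat, natVector]

theorem size_vars (h : Loaded T σ s) : s.nat 0 1 = n := by
  rw [h.nat_eq 0 (by omega)]; simp [inputNat, natVector]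

theorem size_utils (h : Loaded T σ s) : s.nat 0 2 = u := by
  rw [h.nat_eq 0 (by omega)]; simp [inputNat, natVector]

theorem size_cliques (h : Loaded T σ s) : s.nat 0 3 = ℓ := by
  rw [h.nat_eq 0 (by omega)]; simp [inputNat, natVector]

theorem size_max (h : Loaded T σ s) : s.nat 0 4 = T.maxSize := by
  rw [h.nat_eq 0 (by omega)]; simp [inputNat, natVector]

theorem card_eq (h : Loaded T σ s) : s.nat 1 = natVector G.card := h.nat_eq 1 (by omega)

theorem owner_eq_zero (h : Loaded T σ s) (v : Fin n) : s.nat 2 v = 0 ↔ G.owner v = none := by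
  rw [h.nat_eq 2 (by omega), inputNat, natVector_val]
  cases G.owner v <;> simp

theorem owner_eq_succ (h : Loaded T σ s) (v : Fin n) (k : Fin N) :
    s.nat 2 v = k + 1 ↔ G.owner v = some k := by
  rw [h.nat_eq 2 (by omega), inputNat, natVector_val]
  cases G.owner v <;> simp [Fin.ext_iff]

theorem parents_eq_one (h : Loaded T σ s) (v w : Fin n) :
    s.nat 3 (v * n + w) = 1 ↔ w ∈ G.parents v := by
  rw [h.nat_eq 3 (by omega), inputNat, bitMatrix_eq_one]

theorem adj_iff (h : Loaded T σ s) {a b : ℕ} (ha : a < ℓ) (hb : b < ℓ) :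
    s.nat 6 (a * ℓ + b) = 1 ↔ T.adj a b := by
  rw [h.nat_eq 6 (by omega), inputNat]
  have := bitMatrix_eq_one (fun i j => T.tree.Adj i j) ⟨a, ha⟩ ⟨b, hb⟩
  rw [CliqueTree.adj]
  simp [ha, hb, this]

theorem clique_bits (h : Loaded T σ s) (c : Fin ℓ) {w : ℕ} (hw : w < n) :
    s.nat 7 (c * n + w) = bits (T.vars c) w := by
  rw [h.nat_eq 7 (by omega)]
  simp only [inputNat, ← T.mem_vars]
  exact bitMatrix_mem _ _ hw

theorem home_eq (h : Loaded T σ s) (v : Fin n) : s.nat 9 v = T.home (Sum.inl v) := by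
  rw [h.nat_eq 9 (by omega), inputNat, natVector_val]

theorem util_home_eq (h : Loaded T σ s) (j : Fin u) : s.nat 10 j = T.home (Sum.inr j) := by
  rw [h.nat_eq 10 (by omega), inputNat, natVector_val]

theorem size_eq (h : Loaded T σ s) {list len size : ℕ → ℕ} (c : Fin ℓ)
    (hL : Listed n n (s.nat 7) (s.nat 1) list len size c) :
    size c = ∏ v ∈ T.vars c, G.card v := by
  rw [hL.size_eq, ← weight_bits_eq_prod, h.card_eq, weight]
  exact Finset.prod_congr rfl fun w hw => by rw [h.clique_bits c (Finset.mem_range.1 hw)]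

theorem len_le (h : Loaded T σ s) (hcard : ∀ v, 2 ≤ G.card v) {list len size : ℕ → ℕ} (c : Fin ℓ)
    (hL : Listed n n (s.nat 7) (s.nat 1) list len size c) : len c ≤ Nat.log 2 T.maxSize := by
  have h1 := congrArg List.length hL.list_eq
  rw [List.length_map, List.length_range, members_congr fun w hw => h.clique_bits c hw,
    length_members_bits] at h1
  rw [h1]
  exact T.card_vars_le_log hcard c

/-- Ownership of some decision variable by every agent ensures that a candidate has been stored for
it. -/
theorem exists_last (h : Loaded T σ s) (hown : ∀ k, ∃ v, G.owner v = some k) {last : ℕ → ℕ}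
    (hl : ∀ v < n, s.nat 2 v ≠ 0 → LastDecision n (s.nat 2) (s.nat 3) last v) :
    ∃ l : Fin N → Fin n, ∀ k : Fin N, last k = l k + 1 ∧ G.scope k = G.family (l k) := by
  have key : ∀ k : Fin N, ∃ w : Fin n, last k = w + 1 ∧ G.scope k = G.family w := by
    intro k
    have hL : ∀ v : Fin n, G.owner v = some k → s.nat 2 v = k + 1 ∧
        LastDecision n (s.nat 2) (s.nat 3) last v := fun v hv => by
      have hk := (h.owner_eq_succ v k).2 hv
      exact ⟨hk, hl v v.2 (by omega)⟩
    obtain ⟨v, hv⟩ := hown k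
    obtain ⟨hk, hlv⟩ := hL v hv
    have h0 := hlv.ne_zero
    have h1 := hlv.lt
    have h2 := hlv.owner_eq
    rw [hk, Nat.add_sub_cancel] at h0 h1 h2
    refine ⟨⟨last k - 1, h1⟩, by simp only; omega,
      scope_eq_family ((h.owner_eq_succ ⟨_, h1⟩ k).1 h2) fun v' hv' x hx => ?_⟩
    obtain ⟨hk', hlv'⟩ := hL v' hv'
    have h3 := hlv'.family_subset x x.2
    rw [hk', Nat.add_sub_cancel] at h3
    rw [family, Finset.mem_insert] at hx ⊢
    have h4 := h3 (hx.imp (fun h => by rw [h]) (h.parents_eq_one v' x).2)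
    exact h4.imp (fun h => Fin.ext h) (h.parents_eq_one ⟨_, h1⟩ x).1
  choose l hl using key
  exact ⟨l, hl⟩

end Loaded

theorem loaded_input (T : G.CliqueTree ℓ) (σ : G.Seq → ℝ) : Loaded T σ (G.input T σ) :=
  ⟨fun _ _ => rfl, fun _ _ => rfl⟩

end MAID

namespace MAID

open RealRAM

variable {N n u : ℕ} {G : MAID N n u} {ℓ : ℕ}

/-- The subprograms are chained. After each one, the facts that are still needed are rewritten to
the new state by the frame property, and the new table is translated from memory cells into terms of
the diagram. -/
theorem tr_prepare (T : G.CliqueTree ℓ) (σ : G.Seq → ℝ) {m : ℕ} (hm : ℓ = m + 1)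
    (hcard : ∀ v, 2 ≤ G.card v) (hown : ∀ k, ∃ v, G.owner v = some k) (hrec : G.PerfectRecall) :
    Tr prepare (G.input T σ) (prepareCost N n ℓ T.maxSize (Nat.log 2 T.maxSize)) fun s =>
      Loaded T σ s ∧ (∃ last, Tabulated T σ last s) ∧
        Prepared s N n u m T.maxSize (Nat.log 2 T.maxSize) (s.nat 13) := by
  set d := T.maxSize with hd
  set L := Nat.log 2 d with hL
  have h0 := G.loaded_input T σ
  have z17 : (G.input T σ).nat 17 = fun _ => 0 := rfl
  have z20 : (G.input T σ).nat 20 = fun _ => 0 := rfl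
  -- Of the initial state only the input arrays and the zeros in the arrays `17` (visited nodes) and
  -- `20` (last decisions) matter.
  generalize G.input T σ = s0 at h0 z17 z20 ⊢
  unfold prepare prepareCost
  refine (tr_listCliques h0.size_vars h0.size_cliques).seq fun s1 f1 hlist => ?_
  have h1 := h0.frame f1 (by decide) (by decide)
  rw [← f1.nat 17 rfl] at z17
  rw [← f1.nat 20 rfl] at z20
  rw [← f1.nat 7 rfl, ← f1.nat 1 rfl] at hlist
  refine (tr_searchTree h1.size_cliques (by omega) z17 fun P hP0 hP b hb =>
    T.connected_of_closed P hP0 (fun a ha b hb hPa hab =>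
      hP a ha b hb hPa ((h1.adj_iff ha hb).2 hab)) hb).seq fun s2 f2 hroot => ?_
  have h2 := h1.frame f2 (by decide) (by decide)
  replace hroot := hroot.congr (adj' := T.adj) fun a ha b hb => (h1.adj_iff ha hb).1
  rw [← f2.nat 20 rfl] at z20
  rw [← f2.nat 7 rfl, ← f2.nat 1 rfl, ← f2.nat 11 rfl, ← f2.nat 12 rfl, ← f2.nat 13 rfl] at hlist
  refine (tr_listFamilies h2.size_vars).seq fun s3 f3 hfam => ?_
  have h3 := h2.frame f3 (by decide) (by decide)
  rw [← f3.nat 20 rfl] at z20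
  rw [← f3.nat 7 rfl, ← f3.nat 1 rfl, ← f3.nat 11 rfl, ← f3.nat 12 rfl, ← f3.nat 13 rfl] at hlist
  rw [← f3.nat 14 rfl, ← f3.nat 15 rfl, ← f3.nat 16 rfl] at hroot
  replace hfam : ∀ v : Fin n, ∀ w < n, s3.nat 19 (v * n + w) = bits (G.family v) w := by
    intro v w hw
    rw [hfam v v.2 w hw, h2.nat_eq 3 (by omega)]
    simp only [inputNat, bitMatrix_mem G.parents v hw]
    have hb := bits_val (G.family v) ⟨w, hw⟩
    have hb' := bits_val (G.parents v) ⟨w, hw⟩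
    simp only at hb hb'
    rw [hb, hb']
    by_cases hvw : (v : ℕ) = w
    · have : v = ⟨w, hw⟩ := Fin.ext hvw
      simp [hvw, family, ← this]
    · have : (⟨w, hw⟩ : Fin n) ≠ v := fun h => hvw (by rw [← h])
      simp [hvw, family, this]
  refine (tr_findLast h3.size_vars z20 ?_ ?_).seq fun s4 f4 hlast => ?_
  · intro v hv w hw hvw hwv
    exact notMem_parents ⟨w, hw⟩ ⟨v, hv⟩ ((h3.parents_eq_one ⟨w, hw⟩ ⟨v, hv⟩).1 hwv)
      ((h3.parents_eq_one ⟨v, hv⟩ ⟨w, hw⟩).1 hvw)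
  · intro v hv w hw hvw hv0 hne
    obtain ⟨k, hk⟩ := Option.ne_none_iff_exists'.1
      (mt (h3.owner_eq_zero ⟨v, hv⟩).2 hv0)
    have hkv := (h3.owner_eq_succ ⟨v, hv⟩ k).2 hk
    have hkw := (h3.owner_eq_succ ⟨w, hw⟩ k).1 (hvw ▸ hkv)
    have key : ∀ a b : Fin n, G.family a ⊆ G.parents b →
        ∀ x < n, x = a ∨ s3.nat 3 (a * n + x) = 1 → s3.nat 3 (b * n + x) = 1 := by
      intro a b hab x hx h
      refine (h3.parents_eq_one b ⟨x, hx⟩).2 (hab (Finset.mem_insert.2 ?_))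
      exact h.imp (fun h => Fin.ext h) (h3.parents_eq_one a ⟨x, hx⟩).1
    exact (hrec k ⟨⟨v, hv⟩, hk⟩ ⟨⟨w, hw⟩, hkw⟩ (by simpa using hne)).imp
      (key ⟨v, hv⟩ ⟨w, hw⟩) (key ⟨w, hw⟩ ⟨v, hv⟩)
  have h4 := h3.frame f4 (by decide) (by decide)
  obtain ⟨last, hl⟩ := h3.exists_last hown hlast
  clear hlast
  rw [← f4.nat 7 rfl, ← f4.nat 1 rfl, ← f4.nat 11 rfl, ← f4.nat 12 rfl, ← f4.nat 13 rfl] at hlist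
  rw [← f4.nat 14 rfl, ← f4.nat 15 rfl, ← f4.nat 16 rfl] at hroot
  rw [← f4.nat 19 rfl] at hfam
  have hpos : ∀ v < n, 0 < s4.nat 1 v := fun v hv => by
    rw [h4.card_eq]; simpa [natVector, hv] using G.card_pos ⟨v, hv⟩
  have hlen : ∀ c < ℓ, s4.nat 12 c ≤ L := fun c hc => h4.len_le hcard ⟨c, hc⟩ (hlist c hc)
  refine (tr_indexFamilies h4.size_vars h4.size_max (fun v hv => by
    rw [h4.home_eq ⟨v, hv⟩]; exact Fin.is_lt _) hlist hlen hpos).seq fun s5 f5 hidx => ?_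
  have h5 := h4.frame f5 (by decide) (by decide)
  replace hidx : ∀ v : Fin n, ∀ x < d, s5.nat 22 (v * d + x) = project (natVector G.card)
      (bits (T.vars (T.home (Sum.inl v)))) (bits (G.family v)) n x := by
    intro v x hx
    rw [hidx v v.2 x hx, h4.card_eq, h4.home_eq]
    exact project_congr (fun w hw => h4.clique_bits _ hw) (fun w hw => hfam v w hw) x
  rw [← f5.nat 7 rfl, ← f5.nat 1 rfl, ← f5.nat 11 rfl, ← f5.nat 12 rfl, ← f5.nat 13 rfl] at hlist
  rw [← f5.nat 14 rfl, ← f5.nat 15 rfl, ← f5.nat 16 rfl] at hroot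
  rw [← f5.nat 20 rfl] at hl
  rw [← f5.nat 1 rfl] at hpos
  rw [← f5.nat 12 rfl] at hlen
  refine (tr_indexEdges h5.size_vars h5.size_cliques h5.size_max hroot.ord_lt
    (fun t ht => hroot.par_lt' ht) hlist hlen hpos).seq fun s6 f6 hedge => ?_
  have h6 := h5.frame f6 (by decide) (by decide)
  have hnode : ∀ t < ℓ, ∀ w < n, s5.nat 7 (s5.nat 14 t * n + w) =
      bits (T.nodeVars (s5.nat 14) t) w := by
    intro t ht w hw
    have hot := hroot.ord_lt t ht
    rw [T.nodeVars_eq (c := ⟨s5.nat 14 t, hot⟩) rfl]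
    exact h5.clique_bits ⟨s5.nat 14 t, hot⟩ hw
  replace hedge : ∀ t < ℓ, ∀ x < d,
      s6.nat 23 (t * d + x) = project (natVector G.card) (bits (T.nodeVars (s5.nat 14) t))
          (bits (T.nodeVars (s5.nat 14) (s5.nat 16 t))) n x ∧
      s6.nat 24 (t * d + x) = project (natVector G.card)
        (bits (T.nodeVars (s5.nat 14) (s5.nat 16 t))) (bits (T.nodeVars (s5.nat 14) t)) n x := by
    intro t ht x hx
    have h := hedge t ht x hx
    rw [Prod.mk.injEq, h5.card_eq] at h
    have hp := hroot.par_lt' ht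
    exact ⟨h.1.trans (project_congr (hnode t ht) (hnode _ hp) x),
      h.2.trans (project_congr (hnode _ hp) (hnode t ht) x)⟩
  clear hnode
  rw [← f6.nat 7 rfl, ← f6.nat 1 rfl, ← f6.nat 11 rfl, ← f6.nat 12 rfl, ← f6.nat 13 rfl] at hlist
  rw [← f6.nat 14 rfl, ← f6.nat 15 rfl, ← f6.nat 16 rfl] at hroot
  rw [← f6.nat 14 rfl, ← f6.nat 16 rfl] at hedge
  rw [← f6.nat 20 rfl] at hl
  rw [← f6.nat 12 rfl] at hlen
  rw [← f6.nat 22 rfl] at hidx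
  refine (tr_tabulateKernel h6.size_cliques h6.size_max).seq fun s7 f7 hker => ?_
  have h7 := h6.frame f7 (by decide) (by decide)
  replace hker : ∀ t < ℓ, ∀ x < d, ∀ y < d, s7.real 5 (t * (d * d) + (x * d + y)) =
      if project (natVector G.card) (bits (T.nodeVars (s6.nat 14) t))
          (bits (T.nodeVars (s6.nat 14) (s6.nat 16 t))) n x =
        project (natVector G.card) (bits (T.nodeVars (s6.nat 14) (s6.nat 16 t)))
          (bits (T.nodeVars (s6.nat 14) t)) n y then 1 else 0 := by
    intro t ht x hx y hy
    rw [hker t ht x hx y hy, (hedge t ht x hx).1, (hedge t ht y hy).2]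
  clear hedge
  rw [← f7.nat 7 rfl, ← f7.nat 1 rfl, ← f7.nat 11 rfl, ← f7.nat 12 rfl, ← f7.nat 13 rfl] at hlist
  rw [← f7.nat 14 rfl, ← f7.nat 15 rfl, ← f7.nat 16 rfl] at hroot
  rw [← f7.nat 14 rfl, ← f7.nat 16 rfl] at hker
  rw [← f7.nat 20 rfl] at hl
  rw [← f7.nat 12 rfl] at hlen
  rw [← f7.nat 22 rfl] at hidx
  refine (tr_tabulateEvidence h7.size_vars h7.size_max).seq fun s8 f8 hev => ?_
  have h8 := h7.frame f8 (by decide) (by decide)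
  replace hev : ∀ v : Fin n, ∀ x < d, ∀ h < d, s8.real 6 ((v * d + x) * d + h) =
      if project (natVector G.card) (bits (T.vars (T.home (Sum.inl v)))) (bits (G.family v)) n x = h
      then 1 else 0 := by
    intro v x hx h hh
    rw [hev _ (by have := v.2; nlinarith) h hh, hidx v x hx]
  rw [← f8.nat 7 rfl, ← f8.nat 1 rfl, ← f8.nat 11 rfl, ← f8.nat 12 rfl, ← f8.nat 13 rfl] at hlist
  rw [← f8.nat 14 rfl, ← f8.nat 15 rfl, ← f8.nat 16 rfl] at hroot
  rw [← f8.nat 14 rfl, ← f8.nat 16 rfl, ← f8.real 5 rfl] at hker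
  rw [← f8.nat 20 rfl] at hl
  rw [← f8.nat 12 rfl] at hlen
  rw [← f8.nat 22 rfl] at hidx
  refine (tr_initPotentials h8.size_cliques h8.size_max).seq fun s9 f9 hphi => ?_
  have h9 := h8.frame f9 (by decide) (by decide)
  have hsize : ∀ t < ℓ, s8.nat 13 (s8.nat 14 t) = ∏ v ∈ T.nodeVars (s8.nat 14) t, G.card v := by
    intro t ht
    have hot := hroot.ord_lt t ht
    rw [T.nodeVars_eq (c := ⟨s8.nat 14 t, hot⟩) rfl]
    exact h8.size_eq ⟨s8.nat 14 t, hot⟩ (hlist _ hot)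
  rw [← f9.nat 7 rfl, ← f9.nat 1 rfl, ← f9.nat 11 rfl, ← f9.nat 12 rfl, ← f9.nat 13 rfl] at hlist
  rw [← f9.nat 14 rfl, ← f9.nat 15 rfl, ← f9.nat 16 rfl] at hroot
  rw [← f9.nat 14 rfl, ← f9.nat 16 rfl, ← f9.real 5 rfl] at hker
  rw [← f9.nat 14 rfl] at hphi hsize
  rw [← f9.real 6 rfl] at hev
  rw [← f9.nat 20 rfl] at hl
  rw [← f9.nat 12 rfl] at hlen
  rw [← f9.nat 22 rfl] at hidx
  refine (tr_multiplyChance h9.size_vars h9.size_max).seq fun s10 f10 hphi1 => ?_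
  have h10 := h9.frame f10 (by decide) (by decide)
  refine (tr_multiplyPlans h10.size_agents h10.size_max).mono le_rfl fun s11 f11 hphi2 => ?_
  have h11 := h10.frame f11 (by decide) (by decide)
  have hl10 := hl
  have hidx10 := hidx
  rw [← f10.nat 20 rfl] at hl10
  rw [← f10.nat 22 rfl] at hidx10
  have hpot : ∀ t < ℓ, ∀ x < d, s11.real 4 (t * d + x) =
      (if x < ∏ v ∈ T.nodeVars (s9.nat 14) t, G.card v then 1 else 0) *
      (∏ v : Fin n, if G.owner v = none ∧ s9.nat 15 (T.home (Sum.inl v)) = t then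
        s9.real 0 (v * d + project (natVector G.card) (bits (T.vars (T.home (Sum.inl v))))
          (bits (G.family v)) n x) else 1) *
      ∏ k : Fin N, if s9.nat 15 (T.home (Sum.inl (last k))) = t then
        s9.real 2 (k * d + project (natVector G.card)
          (bits (T.vars (T.home (Sum.inl (last k))))) (bits (G.family (last k))) n x) else 1 := by
    intro t ht x hx
    rw [hphi2 t x hx, hphi1 t x hx, hphi t ht x hx, hsize t ht, Finset.prod_range,
      Finset.prod_range]
    congr 1
    · congr 1
      refine Finset.prod_congr rfl fun v _ => ?_
      simp only [h9.owner_eq_zero, h9.home_eq, ← hd, hidx v x hx]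
    · refine Finset.prod_congr rfl fun k _ => ?_
      simp only [(hl10 k).1, Nat.add_sub_cancel, h10.home_eq, ← hd, hidx10 (last k) x hx,
        f10.nat 15 rfl, f10.real 2 rfl]
  clear hphi hphi1 hphi2 hsize hidx hidx10 hl
  have e14 := (f11.nat 14 rfl).trans (f10.nat 14 rfl)
  have e15 := (f11.nat 15 rfl).trans (f10.nat 15 rfl)
  have e16 := (f11.nat 16 rfl).trans (f10.nat 16 rfl)
  have e20 := f11.nat 20 rfl
  have e7 := (f11.nat 7 rfl).trans (f10.nat 7 rfl)
  have e1 := (f11.nat 1 rfl).trans (f10.nat 1 rfl)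
  have e11 := (f11.nat 11 rfl).trans (f10.nat 11 rfl)
  have e12 := (f11.nat 12 rfl).trans (f10.nat 12 rfl)
  have e13 := (f11.nat 13 rfl).trans (f10.nat 13 rfl)
  have r0 := (f11.real 0 rfl).trans (f10.real 0 rfl)
  have r2 := (f11.real 2 rfl).trans (f10.real 2 rfl)
  have r5 := (f11.real 5 rfl).trans (f10.real 5 rfl)
  have r6 := (f11.real 6 rfl).trans (f10.real 6 rfl)
  rw [← e14, ← e15, ← e16] at hroot
  rw [← e14, ← e16, ← r5] at hker
  rw [← e14, ← e15, ← r0, ← r2] at hpot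
  rw [← r6] at hev
  rw [← e20] at hl10
  rw [← e7, ← e1, ← e11, ← e12, ← e13] at hlist
  rw [← e12] at hlen
  refine ⟨h11, ⟨last, h11.nat_eq, fun a ha => h11.real_eq a (by omega), hroot,
    fun k => (hl10 k).1, fun k => (hl10 k).2, hker, hev, hpot⟩, ?_⟩
  refine ⟨h11.size_agents, h11.size_vars, h11.size_utils, by rw [h11.size_cliques, hm],
    h11.size_max, fun j hj => ?_, fun c hc => hlist c (by omega), fun c hc => hlen c (by omega),
    fun v hv => ?_, fun t ht h0 => hroot.par_lt t (by omega) h0, fun k hk => ?_⟩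
  · rw [h11.util_home_eq ⟨j, hj⟩, ← hm]; exact Fin.is_lt _
  · rw [h11.card_eq]; simpa [natVector, hv] using G.card_pos ⟨v, hv⟩
  · rw [(hl10 ⟨k, hk⟩).1, Nat.add_sub_cancel, h11.home_eq]
    have := hroot.pos_lt (T.home (Sum.inl (last ⟨k, hk⟩))) (Fin.is_lt _)
    omega

end MAID

/-! ### The time bound -/

theorem sq_log_two_le (d : ℕ) (hd : 0 < d) : Nat.log 2 d * Nat.log 2 d ≤ 2 * d := by
  -- The constant 2 is needed for small exponents, such as `k = 3`. The lemma absorbs two logarithms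
  -- at once: with `n ≤ ℓ L` it bounds `n L` by `2 ℓ d`.
  have key : ∀ k : ℕ, k * k ≤ 2 * 2 ^ k := by
    intro k
    induction k using Nat.strong_induction_on with
    | _ k ih =>
      rcases Nat.lt_or_ge k 3 with hk | hk
      · interval_cases k <;> norm_num
      · obtain ⟨j, rfl⟩ : ∃ j, k = j + 1 := ⟨k - 1, by omega⟩
        have h := ih j (by omega)
        rw [pow_succ]
        rcases Nat.lt_or_ge j 3 with hj | hj
        · obtain rfl : j = 2 := by omega
          norm_num
        · nlinarith
  exact (key _).trans (Nat.mul_le_mul_left 2 (Nat.pow_log_le_self 2 hd.ne'))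

namespace RealRAM

/-- The step bounds of the preparation and of the evaluation are within the time bound. -/
theorem cost_le {N n u ℓ d L e : ℕ} (hl : 0 < ℓ) (hd : 0 < d) (hL : L * L ≤ 2 * d) (hn : n ≤ ℓ * L)
    (hN : N ≤ n) (heu : e ≤ u) (heN : e ≤ N) {c : ℕ}
    (hc : c ≤ 450 * (ℓ * d) + ℓ * (d * (d * 350 + 700) + 200) +
      N * (d * (d * 100 + 200) + 100) + 200 * d + 200) :
    prepareCost N n ℓ d L + (N * (ℓ * d * 30 + u * (d * (projectCost L d + 80) + 100) + 120) +
      e * (d * c) + 10) ≤ 20000 * (ℓ ^ 2 * d ^ 3 + u * N * d ^ 4) := by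
  have hA : ∀ i ≤ 2, ∀ j ≤ 3, ℓ ^ i * d ^ j ≤ ℓ ^ 2 * d ^ 3 := fun i hi j hj =>
    Nat.mul_le_mul (Nat.pow_le_pow_right hl hi) (Nat.pow_le_pow_right hd hj)
  have hB : ∀ j ≤ 4, u * N * d ^ j ≤ u * N * d ^ 4 := fun j hj =>
    Nat.mul_le_mul_left _ (Nat.pow_le_pow_right hd hj)
  set A := ℓ ^ 2 * d ^ 3
  set B := u * N * d ^ 4
  have hLd : L ≤ 2 * d := by
    rcases Nat.eq_zero_or_pos L with h | h <;> nlinarith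
  have hnd : n ≤ 2 * (ℓ * d) := by nlinarith
  -- Used for `indexFamilies`, whose cost is of order `n d · L d`.
  have hnL : n * L ≤ 2 * (ℓ * d) := by nlinarith
  have hnn : n * n ≤ 2 * (ℓ ^ 2 * d) := by
    calc n * n ≤ n * (ℓ * L) := Nat.mul_le_mul_left _ hn
      _ = ℓ * (n * L) := by ring
      _ ≤ ℓ * (2 * (ℓ * d)) := Nat.mul_le_mul_left _ hnL
      _ = 2 * (ℓ ^ 2 * d) := by ring
  -- If `e ≤ ℓ` the product is at most `ℓ²`; otherwise it is at most `e²`, hence at most `u N`.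
  have hel : e * ℓ ≤ ℓ ^ 2 + u * N := by
    have : e * e ≤ u * N := Nat.mul_le_mul heu heN
    rcases Nat.le_total e ℓ with h | h <;> nlinarith
  have heuN : e ≤ u * N := by
    have : e * e ≤ u * N := Nat.mul_le_mul heu heN
    nlinarith [Nat.le_mul_self e]
  -- These families bound every monomial of the cost polynomials by multiples of `A` and `B`; the
  -- three estimates below are then linear combinations of their instances.
  have powL : ∀ i ≤ 1, ∀ j ≤ 2, ℓ ^ i * d ^ j * L ≤ 2 * A := fun i hi j hj => by
    have := Nat.mul_le_mul_left (ℓ ^ i * d ^ j) hLd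
    have h2 := hA i (by omega) (j + 1) (by omega)
    calc _ ≤ _ := this
      _ = 2 * (ℓ ^ i * d ^ (j + 1)) := by ring
      _ ≤ _ := by omega
  have pown : ∀ i ≤ 1, ∀ j ≤ 2, ℓ ^ i * d ^ j * n ≤ 2 * A := fun i hi j hj => by
    have := Nat.mul_le_mul_left (ℓ ^ i * d ^ j) hnd
    have h2 := hA (i + 1) (by omega) (j + 1) (by omega)
    calc _ ≤ _ := this
      _ = 2 * (ℓ ^ (i + 1) * d ^ (j + 1)) := by ring
      _ ≤ _ := by omega
  have powN : ∀ i ≤ 1, ∀ j ≤ 2, ℓ ^ i * d ^ j * N ≤ 2 * A := fun i hi j hj =>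
    (Nat.mul_le_mul_left _ hN).trans (pown i hi j hj)
  have pownL : ∀ j ≤ 2, d ^ j * (n * L) ≤ 2 * A := fun j hj => by
    have := Nat.mul_le_mul_left (d ^ j) hnL
    have h2 := hA 1 (by omega) (j + 1) (by omega)
    calc _ ≤ _ := this
      _ = 2 * (ℓ ^ 1 * d ^ (j + 1)) := by ring
      _ ≤ _ := by omega
  have powuNL : ∀ j ≤ 2, u * N * d ^ j * L ≤ 2 * B := fun j hj => by
    have := Nat.mul_le_mul_left (u * N * d ^ j) hLd
    have h2 := hB (j + 1) (by omega)
    calc _ ≤ _ := this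
      _ = 2 * (u * N * d ^ (j + 1)) := by ring
      _ ≤ _ := by omega
  have powel : ∀ j ≤ 3, e * ℓ * d ^ j ≤ A + B := fun j hj => by
    have := Nat.mul_le_mul_right (d ^ j) hel
    have h1 := hA 2 le_rfl j hj
    have h2 := hB j (by omega)
    calc _ ≤ _ := this
      _ = ℓ ^ 2 * d ^ j + u * N * d ^ j := by ring
      _ ≤ _ := by omega
  have poweN : ∀ j ≤ 3, e * N * d ^ j ≤ B := fun j hj =>
    (Nat.mul_le_mul_right _ (Nat.mul_le_mul_right _ heu)).trans (hB j (by omega))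
  have powe : ∀ j ≤ 3, e * d ^ j ≤ B := fun j hj =>
    (Nat.mul_le_mul_right _ heuN).trans (hB j (by omega))
  have hprep : prepareCost N n ℓ d L ≤ 6000 * A := by
    have hnn' : n * n ≤ 2 * A := hnn.trans (by have := hA 2 le_rfl 1 (by omega); rw [pow_one] at this; omega)
    simp only [prepareCost, projectCost]
    linarith only [hnn', hA 0 (by omega) 0 (by omega), hA 1 (by omega) 0 (by omega),
      hA 2 (by omega) 0 (by omega), hA 1 (by omega) 1 (by omega), hA 1 (by omega) 2 (by omega),
      powL 1 le_rfl 1 (by omega), powL 1 le_rfl 2 (by omega), pown 0 (by omega) 0 (by omega),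
      pown 0 (by omega) 1 (by omega), pown 0 (by omega) 2 (by omega), pown 1 le_rfl 0 (by omega),
      powN 0 (by omega) 0 (by omega), powN 0 (by omega) 1 (by omega), pownL 1 (by omega),
      pownL 2 (by omega)]
  have heval : N * (ℓ * d * 30 + u * (d * (projectCost L d + 80) + 100) + 120) ≤
      400 * A + 500 * B := by
    simp only [projectCost]
    linarith only [powN 0 (by omega) 0 (by omega), powN 1 le_rfl 1 (by omega),
      powuNL 1 (by omega), powuNL 2 (by omega), hB 0 (by omega), hB 1 (by omega)]
  have hseq : e * (d * c) ≤ 2000 * A + 3000 * B := by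
    refine (Nat.mul_le_mul_left _ (Nat.mul_le_mul_left _ hc)).trans ?_
    linarith only [powel 1 (by omega), powel 2 (by omega), powel 3 (by omega),
      poweN 1 (by omega), poweN 2 (by omega), poweN 3 (by omega), powe 1 (by omega),
      powe 2 (by omega)]
  have := hA 0 (by omega) 0 (by omega)
  simp only [pow_zero, mul_one] at this
  omega

end RealRAM

/-! ### The main theorem -/

open RealRAM in
theorem mainTheorem3 :
    ∃ (prog : RealRAM.Program) (C : ℕ),
      ∀ (N n u ℓ : ℕ) (G : MAID N n u) (T : G.CliqueTree ℓ) (σ : G.Seq → ℝ),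
        (∀ v, 2 ≤ G.card v) →
        (∀ k, ∃ v, G.owner v = some k) →
        G.PerfectRecall →
        G.IsRealizationPlan σ →
        (∀ p, 0 < σ p) →
        ∃ (t : ℕ) (s : RealRAM.State),
          RealRAM.Exec prog (G.input T σ) s t ∧
          t ≤ C * (ℓ ^ 2 * T.maxSize ^ 3 + u * N * T.maxSize ^ 4) ∧
          G.OutputsJacobian T σ s := by
  refine ⟨.seq prepare evaluate, 20000, fun N n u ℓ G T σ hcard hown hrec _ hσ => ?_⟩
  obtain ⟨m, hm⟩ : ∃ m, ℓ = m + 1 := by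
    obtain ⟨c⟩ := T.isTree.connected.nonempty
    exact ⟨ℓ - 1, by have := c.2; omega⟩
  -- The number of agents that receive a utility; as an image of the utility variables it is at most
  -- `u`, as a set of agents at most `N`.
  set e := (Finset.univ.image fun j : Fin u => (G.utilOwner j : ℕ)).card with he
  have hrun := (MAID.tr_prepare T σ hm hcard hown hrec).seq (q := evaluate)
    (B' := N * ((m + 1) * T.maxSize * 30 +
      u * (T.maxSize * (projectCost (Nat.log 2 T.maxSize) T.maxSize + 80) + 100) + 120) +
      e * (T.maxSize * (sequenceCost N m T.maxSize + 20)) + 10)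
    (R' := fun s => G.OutputsJacobian T σ s) fun s f ⟨hload, ⟨last, htab⟩, hprep⟩ => by
      have h4 : ∀ j : Fin u, s.nat 4 j = G.utilOwner j := fun j => by
        rw [hload.nat_eq 4 (by omega), MAID.inputNat, natVector_val]
      refine (tr_evaluate hprep (hload.real_eq 3 le_rfl)).mono ?_ fun s' f' h p q => ?_
      · refine Nat.add_le_add_right (Nat.add_le_add_left (Nat.mul_le_mul_right _ ?_) _) _
        refine Finset.card_le_card fun i hi => ?_
        obtain ⟨-, j, hj, hji⟩ := Finset.mem_filter.1 hi
        exact Finset.mem_image.2 ⟨⟨j, hj⟩, Finset.mem_univ _, (h4 ⟨j, hj⟩).symm.trans hji⟩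
      · have hlt : ∀ p : G.Seq, G.encode (G.scope p.1) p.2 < T.maxSize := fun p => by
          obtain ⟨z, hz⟩ := G.exists_history_eq p
          rw [← hz]
          exact (G.encode_on_lt _ z).trans_le (htab.prod_scope_le _)
        have := h p.1 p.1.2 _ (hlt p) q.1 q.1.2 _ (hlt q)
        rw [htab.entry_eq hm hσ] at this
        exact this
  obtain ⟨s, t, hex, ht, hout⟩ := hrun
  refine ⟨t, s, hex, ht.trans ?_, hout⟩
  rw [← hm]
  choose dec hdec using hown
  refine cost_le (by omega) T.maxSize_pos (sq_log_two_le _ T.maxSize_pos) (T.vars_le hcard)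
    ?_ ?_ ?_ ?_
  -- Choosing a decision variable for each agent is injective because a variable has one owner;
  -- hence `N ≤ n`.
  · have hinj : Function.Injective dec := fun k k' h => by
      have := hdec k
      rw [h, hdec k'] at this
      exact (Option.some.inj this).symm
    simpa using Fintype.card_le_of_injective dec hinj
  · simpa using Finset.card_image_le (s := Finset.univ) (f := fun j : Fin u => (G.utilOwner j : ℕ))
  · have hsub : (Finset.univ.image fun j : Fin u => (G.utilOwner j : ℕ)) ⊆ Finset.range N := by
      intro x hx
      obtain ⟨j, -, rfl⟩ := Finset.mem_image.1 hx
      exact Finset.mem_range.2 (Fin.is_lt _)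
    simpa using Finset.card_le_card hsub
  · rw [sequenceCost]
    subst hm
    have : m * (T.maxSize * (T.maxSize * 350 + 700) + 200) ≤
      (m + 1) * (T.maxSize * (T.maxSize * 350 + 700) + 200) := Nat.mul_le_mul_right _ (by omega)
    have : (m + 1) * T.maxSize * 120 = 120 * ((m + 1) * T.maxSize) := by ring
    omega
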